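/- **Setting.** Let $\mathsf{IS}=(\mathsf{KGen},\mathcal P,\mathcal V)$ be an identification scheme (with completeness). A hash function $\mathsf H$ consists of a distribution $\mathsf H.\mathsf{KGen}(1^n)$ on keys of polynomial length and of an evaluation $\mathsf H.\mathsf{Eval}(k,\cdot):\{0,1\}^*\to\{0,1\}^n$ that is efficient (computable by polynomial-size circuits). An $\ell$-near-collision of $h:\{0,1\}^*\to\{0,1\}^n$ is a pair $M\neq M'$ for which $h(M)$ and $h(M')$ agree in the first $\ell$ bits. Let $\ell=\ell(n)\le\log_2 n$ and let $r=r(n)\ge 1$ be polynomially bounded (both inequalities for all large $n$). The protocol $\mathsf{IS}^*$ with public key $(\mathsf{pk},\ell)$ first runs $r$ rounds of a collision stage: the verifier $\mathcal V^*$ sends a fresh key $k_i\leftarrow\mathsf H.\mathsf{KGen}(1^n)$, and the round is won if the prover answers with an $\ell$-near-collision of $\mathsf H.\mathsf{Eval}(k_i,\cdot)$ before $\mathcal V^*$ has made $\lceil\sqrt[3]{2^\ell}\rceil$ hash evaluations. Then $\mathsf{IS}$ is run; $\mathcal V^*$ accepts if $\mathcal V$ accepts or if more than $r/4$ rounds were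 won. Only hash evaluations cost time, classical and quantum evaluations cost the same, and the impersonator can make $\alpha$ evaluations in the time in which the verifier makes one, where $\alpha\geq 1$ is a constant. Quantum evaluation of $h$ is the unitary $|x,y\rangle\mapsto|x,y\oplus h(x)\rangle$. In the random oracle model $\mathsf H.\mathsf{Eval}(k,\cdot)$ is replaced by $H(k,\cdot)$ for a uniformly random function $H$ with values in $\{0,1\}^n$ ($k$ being a salt). $\mathsf{IS}^*$ is insecure if some efficient impersonator makes $\mathcal V^*$ accept with non-negligible probability. **Statement.** There are an absolute constant $\alpha\ge1$ and a family of quantum circuits $\mathcal A_{n,\ell}$ ($2^\ell\le n$) with oracle gates, of size polynomial in $n$ and with at most $\alpha\sqrt[3]{2^\ell}$ oracle gates, not depending on the hash function, such that, for every oracle $f$ with $n$-bit values, $\mathcal A_{n,\ell}$ outputs an $\ell$-near-collision of $f$ with probability greater than $1/2$, and the following hold. 1. *Every hash function.* For every hash function $\mathsf H$, the oracle gates can be replaced by quantum circuits for $\mathsf H.\mathsf{Eval}$ so that, for all $\ell,r$ as above, the whole attack has polynomial size and, for every $\mathsf{IS}$, the impersonator that runs the resulting oracle-free circuit on $k_i$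 in each round makes $\mathcal V^*$ accept with probability at least $1-e^{-r/16}$ for every $n$ with $2^{\ell(n)}\le n$. In particular $\mathsf{IS}^*$ is insecure. 2. *Quantum-accessible random oracle model.* For all $\mathsf{IS}$, $\ell$, $r$ as above and every distribution of the salts, the impersonator that runs $\mathcal A_{n,\ell}$ with quantum access to $H(k_i,\cdot)$ in each round makes $\mathcal V^*$ accept with probability at least $1-e^{-r/16}$ for every $n$ with $2^{\ell(n)}\le n$. In particular $\mathsf{IS}^*$ is not secure in the quantum-accessible random oracle model. 3. *Separation from classical access.* For the same $\alpha$ there is $\ell_0$ such that, for all $n,\ell,r$ with $\ell\ge\ell_0$ and $2^\ell\le n$, every (even unbounded) algorithm that in round $i$ makes at most $\alpha\lceil\sqrt[3]{2^\ell}\rceil$ classical queries to $h_i$ (and may know $h_1,\dots,h_{i-1}$) finds an $\ell$-near-collision of $h_i$ in more than $r/4$ of the rounds $i=1,\dots,r$ with probability at most $e^{-r/16}$, where $h_1,\dots,h_r$ are independent uniformly random functions from a finite set of messages to $\{0,1\}^n$. -/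

import Mathlib

open scoped ENNReal

noncomputable section

namespace QRO

/-- Bit strings of length `m`. -/
abbrev Bits (m : ℕ) : Type := Fin m → Bool

/-- Bit strings of arbitrary length, used for messages and keys of the underlying scheme. -/
abbrev Str : Type := List Bool

/-- A function is bounded by a polynomial on the arguments satisfying `D`. -/
def PolyBoundedOn (D : ℕ → Prop) (f : ℕ → ℕ) : Prop :=
  ∃ p : Polynomial ℕ, ∀ n, D n → f n ≤ p.eval n

/-- `ε` is negligible: for every (eventually positive) polynomial `p`, `ε n < 1 / p n` for all
sufficiently large `n`. -/
def Negligible (ε : ℕ → ℝ) : Prop :=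
  ∀ p : Polynomial ℝ, (∀ᶠ n : ℕ in Filter.atTop, 0 < p.eval (n : ℝ)) →
    ∀ᶠ n : ℕ in Filter.atTop, ε n < (p.eval (n : ℝ))⁻¹

/-! ### Quantum circuits -/

section Quantum

/-- A vector of amplitudes of a register with one qubit for every element of `W`. -/
abbrev State (W : Type) : Type := (W → Bool) → ℂ

/-- Squared Euclidean norm of a vector of amplitudes. -/
def normSq {W : Type} [Fintype W] [DecidableEq W] (ψ : State W) : ℝ := ∑ x, ‖ψ x‖ ^ 2

/-- Computational basis state. -/
def ket {W : Type} [Fintype W] [DecidableEq W] (z : W → Bool) : State W :=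
  fun x => if x = z then 1 else 0

/-- The elementary gates: Hadamard, phase, `π/8` and CNOT, together with NOT and Toffoli (which are
products of a constant number of the other four). -/
inductive Gate (W : Type) : Type
  | had (i : W)
  | phase (i : W)
  | pi8 (i : W)
  | not (i : W)
  | cnot (c t : W) (h : c ≠ t)
  | toffoli (c d t : W) (hc : c ≠ t) (hd : d ≠ t)

namespace Gate

variable {W W' : Type}

/-- Action of a gate on a vector of amplitudes. The three last gates permute the basis by an
involution. -/
def apply [DecidableEq W] : Gate W → State W → State W
  | had i, ψ => fun x =>
      (1 / (Real.sqrt 2 : ℂ)) *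
        (ψ (Function.update x i false) +
          (if x i then -1 else 1) * ψ (Function.update x i true))
  | phase i, ψ => fun x => (if x i then Complex.I else 1) * ψ x
  | pi8 i, ψ => fun x =>
      (if x i then Complex.exp ((Real.pi / 4 : ℝ) * Complex.I) else 1) * ψ x
  | not i, ψ => fun x => ψ (Function.update x i (!(x i)))
  | cnot c t _, ψ => fun x => ψ (Function.update x t (xor (x t) (x c)))
  | toffoli c d t _ _, ψ => fun x => ψ (Function.update x t (xor (x t) (x c && x d)))

/-- The same gate on renamed wires. -/
def map (e : W ↪ W') : Gate W → Gate W'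
  | had i => had (e i)
  | phase i => phase (e i)
  | pi8 i => pi8 (e i)
  | not i => not (e i)
  | cnot c t h => cnot (e c) (e t) (fun H => h (e.injective H))
  | toffoli c d t hc hd =>
      toffoli (e c) (e d) (e t) (fun H => hc (e.injective H)) (fun H => hd (e.injective H))

end Gate

theorem normSq_ket {W : Type} [Fintype W] [DecidableEq W] (z : W → Bool) :
    normSq (ket z) = 1 := by
  unfold normSq ket
  rw [Finset.sum_eq_single z] <;> simp +contextual

theorem normSq_comp_involutive {W : Type} [Fintype W] [DecidableEq W] (ψ : State W)
    (σ : (W → Bool) → (W → Bool)) (hσ : Function.Involutive σ) :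
    normSq (fun x => ψ (σ x)) = normSq ψ := by
  unfold normSq
  exact Equiv.sum_comp (hσ.toPerm σ) (fun x => ‖ψ x‖ ^ 2)

theorem normSq_had {W : Type} [Fintype W] [DecidableEq W] (i : W) (ψ : State W) :
    normSq ((Gate.had i).apply ψ) = normSq ψ := by
  have hσ : Function.Involutive (fun x : W → Bool => Function.update x i (!(x i))) := by
    intro x; simp
  have h2 : ∀ φ : State W, 2 * normSq φ =
      ∑ x, (‖φ x‖ ^ 2 + ‖φ (Function.update x i (!(x i)))‖ ^ 2) := by
    intro φ
    rw [Finset.sum_add_distrib, two_mul]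
    congr 1
    exact (normSq_comp_involutive φ _ hσ).symm
  have hs : ‖(1 / (Real.sqrt 2 : ℂ))‖ ^ 2 = 1 / 2 := by
    rw [norm_div, norm_one, Complex.norm_real, Real.norm_eq_abs, div_pow, sq_abs]
    norm_num
  have hpar : ∀ a b : ℂ, ‖a + b‖ ^ 2 + ‖a - b‖ ^ 2 = 2 * (‖a‖ ^ 2 + ‖b‖ ^ 2) := by
    intro a b
    have := parallelogram_law_with_norm ℝ a b
    nlinarith
  have key : 2 * normSq ((Gate.had i).apply ψ) = 2 * normSq ψ := by
    rw [h2, h2]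
    refine Finset.sum_congr rfl fun x _ => ?_
    have hp := hpar (ψ (Function.update x i false)) (ψ (Function.update x i true))
    have hx : ∀ b, x i = b → Function.update x i b = x := by
      intro b hb; subst hb; simp
    rcases hb : x i with _ | _
    · have h0 := hx _ hb
      simp only [Gate.apply, norm_mul, mul_pow, hs, hb, Function.update_self,
        Function.update_idem, Bool.not_false, h0, if_true, if_false, Bool.false_eq_true, one_mul,
        neg_one_mul, ← sub_eq_add_neg]
      rw [h0] at hp
      linarith
    · have h0 := hx _ hb
      simp only [Gate.apply, norm_mul, mul_pow, hs, hb, Function.update_self,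
        Function.update_idem, Bool.not_true, h0, if_true, if_false, Bool.false_eq_true, one_mul,
        neg_one_mul, ← sub_eq_add_neg]
      rw [h0] at hp
      linarith
  linarith

theorem normSq_apply {W : Type} [Fintype W] [DecidableEq W] (g : Gate W) (ψ : State W) :
    normSq (g.apply ψ) = normSq ψ := by
  cases g with
  | had i => exact normSq_had i ψ
  | phase i =>
    refine Finset.sum_congr rfl fun x _ => ?_
    simp only [Gate.apply, norm_mul]
    split <;> simp
  | pi8 i =>
    refine Finset.sum_congr rfl fun x _ => ?_
    simp only [Gate.apply, norm_mul]
    split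
    · rw [Complex.norm_exp_ofReal_mul_I, one_mul]
    · simp
  | not i =>
    refine normSq_comp_involutive ψ _ ?_
    intro x; simp
  | cnot c t h =>
    refine normSq_comp_involutive ψ _ ?_
    intro x; simp [Function.update_of_ne h]
  | toffoli c d t hc hd =>
    refine normSq_comp_involutive ψ _ ?_
    intro x; simp [Function.update_of_ne hc, Function.update_of_ne hd]

/-- Run a list of gates, first gate first. -/
def runGates {W : Type} [DecidableEq W] (gs : List (Gate W)) (ψ : State W) : State W :=
  gs.foldl (fun φ g => g.apply φ) ψ

theorem normSq_runGates {W : Type} [Fintype W] [DecidableEq W] (gs : List (Gate W))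
    (ψ : State W) : normSq (runGates gs ψ) = normSq ψ := by
  induction gs generalizing ψ with
  | nil => rfl
  | cons g gs ih => exact (ih (g.apply ψ)).trans (normSq_apply g ψ)

/-- Measurement of all qubits of a normalised state in the computational basis. -/
def measure {W : Type} [Fintype W] [DecidableEq W] (ψ : State W) (h : normSq ψ = 1) :
    PMF (W → Bool) :=
  PMF.ofFintype (fun x => ENNReal.ofReal (‖ψ x‖ ^ 2)) (by
    rw [← ENNReal.ofReal_sum_of_nonneg (fun x _ => by positivity)]
    unfold normSq at h
    rw [h, ENNReal.ofReal_one])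

/-- Wires of a circuit with oracle access: `m` message qubits, `d` digest qubits (these are the
qubits on which the oracle acts), `a` work qubits. -/
abbrev QWire (m d a : ℕ) : Type := Fin m ⊕ Fin d ⊕ Fin a

/-- A step of an oracle circuit: an elementary gate or an oracle call. -/
inductive Step (m d a : ℕ) : Type
  | gate (g : Gate (QWire m d a))
  | query

/-- `|x, y, w⟩ ↦ |x, y ⊕ f x, w⟩` on basis states. -/
def queryPerm {m d a : ℕ} (f : Bits m → Bits d) (z : QWire m d a → Bool) :
    QWire m d a → Bool :=
  Sum.elim (fun i => z (Sum.inl i))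
    (Sum.elim
      (fun j => xor (z (Sum.inr (Sum.inl j))) (f (fun i => z (Sum.inl i)) j))
      (fun w => z (Sum.inr (Sum.inr w))))

theorem queryPerm_involutive {m d a : ℕ} (f : Bits m → Bits d) :
    Function.Involutive (queryPerm f : (QWire m d a → Bool) → QWire m d a → Bool) := by
  intro z
  funext w
  rcases w with i | j | w <;> simp [queryPerm]

/-- Action of a step, the oracle answering with the function `f`. -/
def Step.apply {m d a : ℕ} (f : Bits m → Bits d) :
    Step m d a → State (QWire m d a) → State (QWire m d a)
  | .gate g, ψ => g.apply ψ
  | .query, ψ => fun z => ψ (queryPerm f z)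

/-- A quantum circuit with quantum access to an oracle with `d` bits of output. The circuit fixes
the length `msgLen` of the oracle inputs. It starts in the state `|0…0⟩`; at the end
all qubits are measured, and two messages of length `msgLen` are read off the wires `out₁`,
`out₂`. -/
structure OracleCircuit (d : ℕ) where
  msgLen : ℕ
  work : ℕ
  steps : List (Step msgLen d work)
  out₁ : Fin msgLen → QWire msgLen d work
  out₂ : Fin msgLen → QWire msgLen d work

namespace OracleCircuit

variable {d : ℕ}

/-- Number of oracle calls. -/
def queries (A : OracleCircuit d) : ℕ :=
  A.steps.countP fun s => match s with
    | .query => true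
    | .gate _ => false

/-- Number of steps (gates and oracle calls) plus number of qubits. -/
def size (A : OracleCircuit d) : ℕ := A.steps.length + (A.msgLen + d + A.work)

/-- Final state with oracle `f`. -/
def run (A : OracleCircuit d) (f : Bits A.msgLen → Bits d) :
    State (QWire A.msgLen d A.work) :=
  A.steps.foldl (fun φ s => s.apply f φ) (ket fun _ => false)

theorem normSq_run (A : OracleCircuit d) (f : Bits A.msgLen → Bits d) :
    normSq (A.run f) = 1 := by
  have : ∀ (l : List (Step A.msgLen d A.work)) (ψ : State (QWire A.msgLen d A.work)),
      normSq (l.foldl (fun φ s => s.apply f φ) ψ) = normSq ψ := by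
    intro l
    induction l with
    | nil => intro ψ; rfl
    | cons s l ih =>
      intro ψ
      refine (ih (s.apply f ψ)).trans ?_
      cases s with
      | gate g => exact normSq_apply g ψ
      | query => exact normSq_comp_involutive ψ _ (queryPerm_involutive f)
  exact (this _ _).trans (normSq_ket _)

/-- Distribution of the pair of messages output by the circuit with oracle `f`. -/
def output (A : OracleCircuit d) (f : Bits A.msgLen → Bits d) :
    PMF (Bits A.msgLen × Bits A.msgLen) :=
  (measure (A.run f) (A.normSq_run f)).map fun z => (fun i => z (A.out₁ i), fun i => z (A.out₂ i))

end OracleCircuit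

/-! ### Replacing the oracle by a circuit for a concrete keyed function -/

/-- An oracle-free circuit on `κ` key qubits, `m` message qubits, `d` digest qubits and `anc`
auxiliary qubits. -/
structure EvalCircuit (κ m d : ℕ) where
  anc : ℕ
  gates : List (Gate (Fin κ ⊕ QWire m d anc))

/-- The circuit maps `|k, x, y, 0⟩` to `|k, x, y ⊕ f k x, 0⟩`. -/
def EvalCircuit.Implements {κ m d : ℕ} (E : EvalCircuit κ m d)
    (f : Bits κ → Bits m → Bits d) : Prop :=
  ∀ (k : Bits κ) (x : Bits m) (y : Bits d),
    runGates E.gates (ket (Sum.elim k (Sum.elim x (Sum.elim y fun _ => false)))) =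
      ket (Sum.elim k (Sum.elim x (Sum.elim (fun j => xor (y j) (f k x j)) fun _ => false)))

/-- Wires of an instantiated circuit: key, message, digest, work qubits, auxiliary qubits. -/
abbrev FullWire (κ m d a b : ℕ) : Type := Fin κ ⊕ Fin m ⊕ Fin d ⊕ Fin a ⊕ Fin b

/-- The wires of the oracle circuit among all wires. -/
def circuitWires (κ m d a b : ℕ) : QWire m d a ↪ FullWire κ m d a b where
  toFun := Sum.elim (fun i => .inr (.inl i))
    (Sum.elim (fun j => .inr (.inr (.inl j))) (fun w => .inr (.inr (.inr (.inl w)))))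
  inj' := by
    intro u v h
    rcases u with u | u | u <;> rcases v with v | v | v <;> simp_all

/-- The wires of the evaluation circuit among all wires. -/
def evalWires (κ m d a b : ℕ) : Fin κ ⊕ QWire m d b ↪ FullWire κ m d a b where
  toFun := Sum.elim (fun k => .inl k) (Sum.elim (fun i => .inr (.inl i))
    (Sum.elim (fun j => .inr (.inr (.inl j))) (fun w => .inr (.inr (.inr (.inr w))))))
  inj' := by
    intro u v h
    rcases u with u | u | u | u <;> rcases v with v | v | v | v <;> simp_all

namespace OracleCircuit

variable {d κ : ℕ}

/-- The oracle-free circuit obtained by replacing every oracle call by the circuit `E`. -/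
def instantiate (A : OracleCircuit d) (E : EvalCircuit κ A.msgLen d) :
    List (Gate (FullWire κ A.msgLen d A.work E.anc)) :=
  A.steps.flatMap fun s => match s with
    | .gate g => [g.map (circuitWires κ A.msgLen d A.work E.anc)]
    | .query => E.gates.map (Gate.map (evalWires κ A.msgLen d A.work E.anc))

/-- Number of gates plus number of qubits of the instantiated circuit. -/
def instSize (A : OracleCircuit d) (E : EvalCircuit κ A.msgLen d) : ℕ :=
  (A.instantiate E).length + (κ + A.msgLen + d + A.work + E.anc)

/-- Distribution of the pair of messages output by the instantiated circuit, started in the state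
`|k, 0…0⟩`. -/
def instOutput (A : OracleCircuit d) (E : EvalCircuit κ A.msgLen d) (k : Bits κ) :
    PMF (Bits A.msgLen × Bits A.msgLen) :=
  (measure (runGates (A.instantiate E) (ket (Sum.elim k fun _ => false)))
      ((normSq_runGates _ _).trans (normSq_ket _))).map fun z =>
    (fun i => z (circuitWires κ A.msgLen d A.work E.anc (A.out₁ i)),
      fun i => z (circuitWires κ A.msgLen d A.work E.anc (A.out₂ i)))

end OracleCircuit

end Quantum

/-! ### Hash functions -/

/-- A Boolean circuit as a straight-line program over NAND: the gate `(i, j)` appends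
the NAND of the `i`-th and `j`-th values computed so far (the inputs come first, and an index that
is out of range denotes the constant `false`). -/
structure BoolCircuit (ins outs : ℕ) where
  gates : List (ℕ × ℕ)
  out : Fin outs → ℕ

/-- The function computed by a Boolean circuit. -/
def BoolCircuit.eval {ins outs : ℕ} (C : BoolCircuit ins outs) (x : Bits ins) : Bits outs :=
  fun o => (C.gates.foldl
    (fun v g => v ++ [!(v.getD g.1 false && v.getD g.2 false)]) (List.ofFn x)).getD (C.out o) false

/-- A hash function: for security parameter `n`, keys of `keyLen n` bits are drawn from `kgen n`,
and messages of arbitrary length are mapped to digests of `n` bits. -/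
structure HashFunction where
  keyLen : ℕ → ℕ
  kgen : ∀ n, PMF (Bits (keyLen n))
  eval : ∀ n, Bits (keyLen n) → Str → Bits n

/-- Efficiency: keys have polynomial length, and evaluation on messages of length `m` is
computed by Boolean circuits of size polynomial in `n + m` (in particular this holds for polynomial
time evaluation algorithms). -/
def HashFunction.IsEfficient (H : HashFunction) : Prop :=
  ∃ p : Polynomial ℕ, (∀ n, H.keyLen n ≤ p.eval n) ∧
    ∀ n m, ∃ C : BoolCircuit (H.keyLen n + m) n, C.gates.length ≤ p.eval (n + m) ∧
      ∀ (k : Bits (H.keyLen n)) (x : Bits m),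
        C.eval (Fin.append k x) = H.eval n k (List.ofFn x)

/-- `M ≠ M'` have digests agreeing in the leading `ℓ` bits. -/
def NearCollision {X : Type} {n : ℕ} (h : X → Bits n) (ℓ : ℕ) (M M' : X) : Prop :=
  M ≠ M' ∧ ∀ i : Fin n, (i : ℕ) < ℓ → h M i = h M' i

/-! ### Identification schemes -/

/-- Transcripts: pairs (message of the verifier, answer of the prover). -/
abbrev Transcript : Type := List (Str × Str)

/-- Interaction of a verifier (with fixed coins) and a possibly randomised prover for a given
number of moves, continuing a transcript. -/
def interact (chal : Transcript → Str) (resp : Transcript → Str → PMF Str) :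
    ℕ → Transcript → PMF Transcript
  | 0, t => PMF.pure t
  | j + 1, t => (resp t (chal t)).bind fun a => interact chal resp j (t ++ [(chal t, a)])

/-- An identification scheme: key generation `(sk, pk)`, an honest prover and a verifier, each
with its random coins, such that the honest prover is always accepted. -/
structure IdentScheme where
  keyGen : ℕ → PMF (Str × Str)
  moves : ℕ → ℕ
  proverCoins : ℕ → PMF Str
  respond : (n : ℕ) → (sk pk coins : Str) → Transcript → Str → Str
  verifierCoins : ℕ → PMF Str
  challenge : (n : ℕ) → (pk coins : Str) → Transcript → Str
  accepts : (n : ℕ) → (pk coins : Str) → Transcript → Bool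
  complete : ∀ n, ∀ key ∈ (keyGen n).support, ∀ ρ ∈ (proverCoins n).support,
    ∀ ρ' ∈ (verifierCoins n).support,
    ∀ t ∈ (interact (challenge n key.2 ρ')
        (fun t c => PMF.pure (respond n key.1 key.2 ρ t c)) (moves n) []).support,
      accepts n key.2 ρ' t = true

/-! ### The protocol with the collision-finding stage -/

/-- Parameters: the number `ℓ n ≤ log n` of leading bits, and the polynomial number `r n ≥ 1` of
rounds of the collision stage. -/
structure Params where
  ell : ℕ → ℕ
  rounds : ℕ → ℕ
  ell_le : ∀ᶠ n in Filter.atTop, 2 ^ ell n ≤ n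
  rounds_pos : ∀ᶠ n in Filter.atTop, 1 ≤ rounds n
  rounds_poly : PolyBoundedOn (fun _ => True) rounds

/-- The answer of a prover in one round of the collision stage: two messages, and the time at
which the answer arrives, in units of one hash evaluation of the verifier. -/
structure Reply where
  fst : Str
  snd : Str
  time : ℝ

/-- The rounds of the collision stage played so far: keys sent and replies received. -/
abbrev CollTranscript (κ : ℕ) : Type := List (Bits κ × Reply)

/-- A prover, honest or not, as seen by the verifier: the distribution of its next message given
the messages exchanged so far. -/
structure ProverStrategy (κ : ℕ) where
  collide : CollTranscript κ → Bits κ → PMF Reply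
  respond : CollTranscript κ → Transcript → Str → PMF Str

/-- The verifier's evaluations take `⌈∛(2^ℓ)⌉` units of time. -/
def deadline (ℓ : ℕ) : ℕ := ⌈((2 : ℝ) ^ ℓ) ^ ((1 : ℝ) / 3)⌉₊

/-- A round is won if a near-collision arrives in time. -/
def RoundWon {κ n : ℕ} (eval : Bits κ → Str → Bits n) (ℓ : ℕ) (e : Bits κ × Reply) : Prop :=
  e.2.time ≤ deadline ℓ ∧ NearCollision (eval e.1) ℓ e.2.fst e.2.snd

open Classical in
/-- The number of rounds won. -/
def collCount {κ n : ℕ} (eval : Bits κ → Str → Bits n) (ℓ : ℕ) (t : CollTranscript κ) : ℕ :=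
  t.countP fun e => decide (RoundWon eval ℓ e)

/-- The collision stage: in each round a fresh key is drawn and sent to the prover. -/
def collisionStage {κ : ℕ} (kgen : PMF (Bits κ)) (P : ProverStrategy κ) :
    ℕ → CollTranscript κ → PMF (CollTranscript κ)
  | 0, t => PMF.pure t
  | j + 1, t => kgen.bind fun k => (P.collide t k).bind fun a =>
      collisionStage kgen P j (t ++ [(k, a)])

/-- The output of the verifier of the extended protocol with public key `(pk, ℓ)`: it accepts if
the underlying verifier accepts, or if more than a quarter of the `r` rounds of the collision stage
were won. -/
def verifierOutput (IS : IdentScheme) (n ℓ r : ℕ) {κ : ℕ} (kgen : PMF (Bits κ))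
    (eval : Bits κ → Str → Bits n) (pk : Str) (P : ProverStrategy κ) : PMF Bool :=
  (collisionStage kgen P r []).bind fun t =>
    (IS.verifierCoins n).bind fun ρ =>
      (interact (IS.challenge n pk ρ) (P.respond t) (IS.moves n) []).map fun u =>
        IS.accepts n pk ρ u || decide (r < 4 * collCount eval ℓ t)

/-- Probability that an impersonator, who knows only `(pk, ℓ)` and did not even interact with the
honest prover before, makes the verifier of the extended protocol accept. -/
def impersonationProb (IS : IdentScheme) (n ℓ r : ℕ) {κ : ℕ} (kgen : PMF (Bits κ))
    (eval : Bits κ → Str → Bits n) (P : Str → ProverStrategy κ) : ℝ≥0∞ :=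
  ((IS.keyGen n).bind fun key => verifierOutput IS n ℓ r kgen eval key.2 (P key.2)) true

/-! ### The attack -/

/-- The impersonator that answers a key `k` by a pair of messages drawn from `out k`, using `q`
evaluations of the hash function at a rate of `α` evaluations per unit of time (and no time for
anything else), and sends empty strings in the identification stage. -/
def impersonator {κ m : ℕ} (α : ℝ) (q : ℕ) (out : Bits κ → PMF (Bits m × Bits m)) :
    Str → ProverStrategy κ := fun _ =>
  { collide := fun _ k => (out k).map fun M => ⟨List.ofFn M.1, List.ofFn M.2, q / α⟩
    respond := fun _ _ _ => PMF.pure [] }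

/-- Success probability of the impersonator that runs, in each round, the circuit `A` with
the evaluation circuit `E` of the hash function `H` in place of the oracle. -/
def hashAttackProb (α : ℝ) (IS : IdentScheme) (H : HashFunction) (n ℓ r : ℕ)
    (A : OracleCircuit n) (E : EvalCircuit (H.keyLen n) A.msgLen n) : ℝ≥0∞ :=
  impersonationProb IS n ℓ r (H.kgen n) (H.eval n) (impersonator α A.queries (A.instOutput E))

/-- The random oracle: the values at all pairs (salt, message) are independent and uniform. -/
def randomOracle (κ n : ℕ) : MeasureTheory.Measure (Bits κ × Str → Bits n) :=
  MeasureTheory.Measure.infinitePi fun _ => (PMF.uniformOfFintype (Bits n)).toMeasure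

/-- Success probability, in the quantum-accessible random oracle model with salts drawn from
`kgen`, of the impersonator that runs, in each round, the circuit `A` with quantum access
to `H(k, ·)`. -/
def oracleAttackProb (α : ℝ) (IS : IdentScheme) (n ℓ r : ℕ) {κ : ℕ} (kgen : PMF (Bits κ))
    (A : OracleCircuit n) : ℝ≥0∞ :=
  ∫⁻ H, impersonationProb IS n ℓ r kgen (fun k M => H (k, M))
    (impersonator α A.queries fun k => A.output fun x => H (k, List.ofFn x)) ∂(randomOracle κ n)

/-! ### Algorithms with classical oracle access -/

/-- A (computationally unbounded) algorithm with classical access to an oracle `X → Y`. -/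
inductive QueryAlg (X Y R : Type) : Type
  | done (a : R)
  | query (x : X) (next : Y → QueryAlg X Y R)

namespace QueryAlg

variable {X Y R : Type}

/-- The algorithm never makes more than `q` queries. -/
def QueriesAtMost : ℕ → QueryAlg X Y R → Prop
  | _, done _ => True
  | 0, query _ _ => False
  | q + 1, query _ next => ∀ y, QueriesAtMost q (next y)

/-- The output with oracle `h`. -/
def run (h : X → Y) : QueryAlg X Y R → R
  | done a => a
  | query x next => run h (next (h x))

end QueryAlg

open Classical in
/-- The number of rounds in which an algorithm with classical access to independent oracles
`h 0, …, h (r-1)` finds an `ℓ`-near-collision. In round `i` the algorithm queries `h i`, and it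
may know all of the oracles of the earlier rounds. -/
def classicalCollCount {X : Type} {n r : ℕ} (ℓ : ℕ)
    (B : List (X → Bits n) → QueryAlg X (Bits n) (X × X)) (h : Fin r → X → Bits n) : ℕ :=
  (Finset.univ.filter fun i : Fin r =>
    let M := (B ((List.ofFn h).take i)).run (h i)
    NearCollision (h i) ℓ M.1 M.2).card

end QRO

end

/-!
The collision finder is a variant of the quantum algorithm of Brassard, Høyer and Tapp, made robust
against the unknown structure of the oracle. With `k = 2 ^ (ℓ / 3)` and messages of `ℓ + 3` bits, it
draws a uniform seed `s`, builds a table of the shifts `s ⊕ e 0, …, s ⊕ e (k - 1)` with their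
digests, and runs Grover searches for messages that collide with an entry of the table.

*Success.* At most `2 ^ ℓ` messages are without a partner, because such messages have distinct
prefixes (`card_lonely_le`). Each shift of the seed is uniform, so for at least three quarters of
the seeds at least half of the entries have a partner (`card_bad_le`). Unless two entries collide
with one another, in which case the finder has already succeeded, these partners are distinct
(`le_card_partners`), so that the angle `θ` of the Grover rotation satisfies `3 ^ L * θ ≥ π / 6` for
some `L` with `3 ^ L = O(k)`. The number of partners being unknown, the searches use the angles
`3 ^ i * θ` for all `i ≤ L`: at the first `i` with `3 ^ i * θ ≥ π / 6`, the squared cosine is at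
most `3 / 4` (`exists_cos_sq_le`). Every level is run five times, so the failure probability is at
most `1 / 4 + (3 / 4) ^ 5 < 1 / 2` (`weight_run_finderOps_lt`), while the number of iterations is a
geometric sum of order `k`.

*No intermediate measurements.* The seed and the searches use separate registers, and the
measurement is deferred to the end. A register that is never written to again keeps the branches of
the superposition disjoint (`HOp.apply_eq_of_avoids`, `weight_sum_smul`), so that the probabilities
of failure of the searches multiply (`weight_run_searchOps_le`).

*Circuits.* The finder is first written as a list of logical operations (`HOp`): Hadamard gates,
phase and bit flips controlled by a propositional formula, and oracle calls on arbitrary registers.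
Their translation into gates computes the formula on auxiliary qubits, applies the flip and
uncomputes (`Form.compile`, `CGate.conj`), and implements an oracle call on arbitrary registers by
copying the message to the query register, copying the digest back, and cleaning up with a second
query (`HOp.compile`). For a concrete hash function, a Boolean circuit is made reversible by
computing its gates, copying the output and uncomputing (`BoolCircuit.toEvalCircuit`), and inserting
the result preserves the output distribution (`OracleCircuit.instOutput_eq`).

*The protocol.* In every round the finder succeeds with probability greater than `1 / 2`,
independently of the past, and a Chernoff bound gives the probability of winning more than `r / 4`
rounds (`le_impersonationProb`).

*Classical queries.* By lazy sampling, an algorithm with `q` queries to a random function finds a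
near-collision with probability at most of order `q ^ 2 / 2 ^ ℓ`, which for `q = O(∛(2 ^ ℓ))` is
small (`card_filter_nearCollision_mul_le`). The oracle of a round is independent of those of the
earlier rounds, so a Chernoff bound applies again (`toOuterMeasure_classicalCollCount_le`).
-/

open scoped ENNReal

noncomputable section

namespace QRO

/-! ### Linearity, renaming of wires, and measurement -/

section Gates

variable {W W' : Type}

theorem extend_comp_self (e : W ↪ W') (z : W' → Bool) : Function.extend e (z ∘ e) z = z := by
  funext w
  by_cases h : ∃ v, e v = w
  · obtain ⟨v, rfl⟩ := h
    rw [e.injective.extend_apply]; rfl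
  · rw [Function.extend_apply' _ _ _ h]

theorem extend_extend (e : W ↪ W') (z : W' → Bool) (x y : W → Bool) :
    Function.extend e y (Function.extend e x z) = Function.extend e y z := by
  funext w
  by_cases h : ∃ v, e v = w
  · obtain ⟨v, rfl⟩ := h
    rw [e.injective.extend_apply, e.injective.extend_apply]
  · rw [Function.extend_apply' _ _ _ h, Function.extend_apply' _ _ _ h,
      Function.extend_apply' _ _ _ h]

theorem extend_comp (e : W ↪ W') (z : W' → Bool) (x : W → Bool) :
    Function.extend e x z ∘ e = x := by
  funext w
  exact e.injective.extend_apply _ _ _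

variable [DecidableEq W] [DecidableEq W']

theorem Gate.isLinearMap_apply (g : Gate W) : IsLinearMap ℂ g.apply := by
  constructor
  · intro φ ψ
    cases g <;> funext x <;> simp only [Gate.apply, Pi.add_apply] <;> ring
  · intro c φ
    cases g <;> funext x <;> simp only [Gate.apply, Pi.smul_apply, smul_eq_mul] <;> ring

theorem runGates_cons (g : Gate W) (gs : List (Gate W)) (ψ : State W) :
    runGates (g :: gs) ψ = runGates gs (g.apply ψ) := rfl

theorem runGates_append (gs hs : List (Gate W)) (ψ : State W) :
    runGates (gs ++ hs) ψ = runGates hs (runGates gs ψ) := by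
  simp [runGates, List.foldl_append]

theorem isLinearMap_runGates (gs : List (Gate W)) : IsLinearMap ℂ (runGates gs) := by
  induction gs with
  | nil => exact ⟨fun _ _ => rfl, fun _ _ => rfl⟩
  | cons g gs ih =>
    constructor
    · intro φ ψ
      simp only [runGates_cons, g.isLinearMap_apply.map_add, ih.map_add]
    · intro c φ
      simp only [runGates_cons, g.isLinearMap_apply.map_smul, ih.map_smul]

theorem extend_update (e : W ↪ W') (z : W' → Bool) (x : W → Bool) (i : W) (b : Bool) :
    Function.extend e (Function.update x i b) z =
      Function.update (Function.extend e x z) (e i) b := by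
  funext w
  by_cases h : ∃ v, e v = w
  · obtain ⟨v, rfl⟩ := h
    rw [e.injective.extend_apply]
    by_cases hv : v = i
    · subst hv; simp
    · rw [Function.update_of_ne hv, Function.update_of_ne (fun h => hv (e.injective h)),
        e.injective.extend_apply]
  · rw [Function.extend_apply' _ _ _ h, Function.update_of_ne, Function.extend_apply' _ _ _ h]
    rintro rfl
    exact h ⟨i, rfl⟩

/-- A gate on renamed wires acts on every slice of the state in which the remaining wires
are fixed. -/
theorem Gate.apply_map (e : W ↪ W') (g : Gate W) (ψ : State W') (z : W' → Bool) :
    (g.map e).apply ψ z = g.apply (fun x => ψ (Function.extend e x z)) (z ∘ e) := by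
  cases g <;> simp only [Gate.map, Gate.apply, extend_update, extend_comp_self, Function.comp]

/-- `Gate.apply_map` for a list of gates. -/
theorem runGates_map (e : W ↪ W') (gs : List (Gate W)) (ψ : State W') (z : W' → Bool) :
    runGates (gs.map (Gate.map e)) ψ z =
      runGates gs (fun x => ψ (Function.extend e x z)) (z ∘ e) := by
  induction gs generalizing ψ with
  | nil => simp [runGates, extend_comp_self]
  | cons g gs ih =>
    rw [List.map_cons, runGates_cons, ih, runGates_cons]
    congr 1
    funext x
    rw [Gate.apply_map, extend_comp]
    simp only [extend_extend]

variable [Fintype W] [Fintype W']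

theorem sum_smul_ket (ψ : State W) : ∑ z, ψ z • ket z = ψ := by
  funext x
  simp [ket, Finset.sum_apply]

theorem normSq_extend (ι : (W → Bool) → (W' → Bool)) (hι : Function.Injective ι) (φ : State W) :
    normSq (Function.extend ι φ 0 : State W') = normSq φ := by
  classical
  unfold normSq
  rw [← Finset.sum_subset (Finset.subset_univ (Finset.univ.image ι)),
    Finset.sum_image (fun a _ b _ h => hι h)]
  · exact Finset.sum_congr rfl fun x _ => by rw [hι.extend_apply]
  · intro z _ hz
    rw [Function.extend_apply' _ _ _ (fun ⟨x, hx⟩ => hz (by simp [← hx]))]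
    simp

/-- Measuring a state supported on the image of an injection `ι` of basis states. -/
theorem measure_extend (ι : (W → Bool) → (W' → Bool)) (hι : Function.Injective ι) (φ : State W)
    (h : normSq φ = 1) (h' : normSq (Function.extend ι φ 0 : State W') = 1) :
    measure (Function.extend ι φ 0 : State W') h' = (measure φ h).map ι := by
  classical
  ext z
  rw [PMF.map_apply, tsum_fintype]
  simp only [measure, PMF.ofFintype_apply]
  by_cases hz : ∃ x, ι x = z
  · obtain ⟨x, rfl⟩ := hz
    rw [hι.extend_apply, Finset.sum_eq_single x]
    · simp
    · intro y _ hy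
      rw [if_neg (fun h => hy (hι h).symm)]
    · simp
  · rw [Function.extend_apply' _ _ _ hz, Finset.sum_eq_zero]
    · simp
    · intro y _
      rw [if_neg (fun h => hz ⟨y, h.symm⟩)]

theorem extend_ket (ι : (W → Bool) → (W' → Bool)) (hι : Function.Injective ι) (z : W → Bool) :
    (Function.extend ι (ket z) 0 : State W') = ket (ι z) := by
  funext y
  by_cases hy : ∃ x, ι x = y
  · obtain ⟨x, rfl⟩ := hy
    rw [hι.extend_apply]
    simp [ket, hι.eq_iff]
  · rw [Function.extend_apply' _ _ _ hy]
    have : y ≠ ι z := fun h => hy ⟨z, h.symm⟩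
    simp [ket, this]

end Gates

/-! ### Classical reversible circuits -/

/-- Classical reversible gates: NOT, and Toffoli with controls `c`, `d` and target `t`. A Toffoli
gate whose target is one of its controls is void; `c = d` gives CNOT. -/
inductive CGate (W : Type) : Type
  | not (t : W)
  | tof (c d t : W)

namespace CGate

variable {W : Type}

/-- Compute, apply further gates, uncompute. -/
def conj (cs ds : List (CGate W)) : List (CGate W) := cs ++ (ds ++ cs.reverse)

theorem reverse_conj (cs ds : List (CGate W)) : (conj cs ds).reverse = conj cs ds.reverse := by
  simp [conj]

variable [DecidableEq W]

/-- Action of a classical gate on basis states. -/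
def act : CGate W → (W → Bool) → W → Bool
  | not t, z => Function.update z t (!(z t))
  | tof c d t, z => if c ≠ t ∧ d ≠ t then Function.update z t (xor (z t) (z c && z d)) else z

/-- The elementary gates realising a classical gate. -/
def toGates : CGate W → List (Gate W)
  | not t => [Gate.not t]
  | tof c d t => if h : c ≠ t ∧ d ≠ t then [Gate.toffoli c d t h.1 h.2] else []

/-- The elementary gates realising a list of classical gates. -/
def compile (cs : List (CGate W)) : List (Gate W) := cs.flatMap toGates

/-- Action of a list of classical gates on basis states, first gate first. -/
def run (cs : List (CGate W)) (z : W → Bool) : W → Bool := cs.foldl (fun z g => g.act z) z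

theorem run_append (cs ds : List (CGate W)) (z : W → Bool) :
    run (cs ++ ds) z = run ds (run cs z) := by
  simp [run, List.foldl_append]

theorem run_cons (c : CGate W) (cs : List (CGate W)) (z : W → Bool) :
    run (c :: cs) z = run cs (c.act z) := rfl

theorem act_act (c : CGate W) (z : W → Bool) : c.act (c.act z) = z := by
  cases c with
  | not t => simp [act]
  | tof c d t =>
    by_cases h : c ≠ t ∧ d ≠ t
    · simp [act, h]
    · simp only [act, if_neg h]

theorem run_reverse_run (cs : List (CGate W)) (z : W → Bool) : run cs.reverse (run cs z) = z := by
  induction cs generalizing z with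
  | nil => rfl
  | cons c cs ih =>
    rw [List.reverse_cons, run_append, run_cons c cs, ih]
    exact act_act c z

theorem run_run_reverse (cs : List (CGate W)) (z : W → Bool) : run cs (run cs.reverse z) = z := by
  have := run_reverse_run cs.reverse z
  rwa [List.reverse_reverse] at this

theorem length_compile_le (cs : List (CGate W)) : (compile cs).length ≤ cs.length := by
  induction cs with
  | nil => simp [compile]
  | cons c cs ih =>
    have : (toGates c).length ≤ 1 := by
      cases c with
      | not t => simp [toGates]
      | tof c d t =>
        by_cases h : c ≠ t ∧ d ≠ t
        · simp only [toGates, dif_pos h, List.length_singleton, le_refl]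
        · simp [toGates, dif_neg h]
    simp only [compile, List.flatMap_cons, List.length_append, List.length_cons] at ih ⊢
    omega

theorem runGates_toGates (c : CGate W) (ψ : State W) : runGates c.toGates ψ = ψ ∘ c.act := by
  cases c with
  | not t => rfl
  | tof c d t =>
    by_cases h : c ≠ t ∧ d ≠ t
    · funext z
      simp [toGates, act, h, runGates, Gate.apply]
    · funext z
      simp only [toGates, act, dif_neg h, if_neg h, Function.comp]
      rfl

/-- Amplitudes are permuted by the inverse of the action on basis states. -/
theorem runGates_compile (cs : List (CGate W)) (ψ : State W) (z : W → Bool) :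
    runGates (compile cs) ψ z = ψ (run cs.reverse z) := by
  induction cs generalizing ψ with
  | nil => rfl
  | cons c cs ih =>
    have : compile (c :: cs) = c.toGates ++ compile cs := by simp [compile]
    rw [this, runGates_append, ih, runGates_toGates, List.reverse_cons, run_append]
    rfl

theorem runGates_compile_ket [Fintype W] (cs : List (CGate W)) (y : W → Bool) :
    runGates (compile cs) (ket y) = ket (run cs y) := by
  funext z
  rw [runGates_compile]
  have : run cs.reverse z = y ↔ z = run cs y := by
    constructor
    · rintro rfl
      rw [run_run_reverse]
    · rintro rfl
      rw [run_reverse_run]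
  simp only [ket, this]

/-- Compute, apply a phase flip controlled by the wire `t`, uncompute. Two phase gates `diag(1, i)`
make a phase flip `diag(1, -1)`. -/
def phaseGates (cs : List (CGate W)) (t : W) : List (Gate W) :=
  compile cs ++ ([Gate.phase t, Gate.phase t] ++ compile cs.reverse)

theorem runGates_phaseGates (cs : List (CGate W)) (t : W) (ψ : State W) (z : W → Bool) :
    runGates (phaseGates cs t) ψ z = (if run cs z t then -1 else 1) * ψ z := by
  rw [phaseGates, runGates_append, runGates_append, runGates_compile, List.reverse_reverse]
  simp only [runGates_cons, Gate.apply]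
  simp only [runGates, List.foldl_nil]
  have := runGates_compile cs ψ (run cs z)
  unfold runGates at this
  rw [this, run_reverse_run]
  split
  · rw [← mul_assoc, Complex.I_mul_I]
  · simp

theorem run_conj (cs ds : List (CGate W)) (z : W → Bool) :
    run (conj cs ds) z = run cs.reverse (run ds (run cs z)) := by
  rw [conj, run_append, run_append]

end CGate

namespace CGate

variable {W : Type}

/-- The gate does not touch the wire `w`. -/
def Avoids (w : W) : CGate W → Prop
  | not t => t ≠ w
  | tof c d t => c ≠ w ∧ d ≠ w ∧ t ≠ w

variable [DecidableEq W]

theorem run_injective (cs : List (CGate W)) : Function.Injective (run cs) :=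
  Function.LeftInverse.injective (run_reverse_run cs)

theorem act_update (c : CGate W) (w : W) (h : c.Avoids w) (z : W → Bool) (b : Bool) :
    c.act (Function.update z w b) = Function.update (c.act z) w b := by
  cases c with
  | not t => simp only [act, Function.update_of_ne h, Function.update_comm h]
  | tof c d t =>
    obtain ⟨hc, hd, ht⟩ := h
    simp only [act, Function.update_of_ne hc, Function.update_of_ne hd, Function.update_of_ne ht]
    split
    · rw [Function.update_comm ht]
    · rfl

theorem run_update (cs : List (CGate W)) (w : W) (h : ∀ c ∈ cs, c.Avoids w) (z : W → Bool)
    (b : Bool) : run cs (Function.update z w b) = Function.update (run cs z) w b := by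
  induction cs generalizing z with
  | nil => rfl
  | cons c cs ih =>
    rw [run_cons, act_update c w (h c (by simp)), ih (fun c hc => h c (by simp [hc]))]
    rfl

/-- A list of CNOT gates with sources `src j` and targets `tgt j`. -/
def copy {J : Type} (src tgt : J → W) (l : List J) : List (CGate W) :=
  l.map fun j => tof (src j) (src j) (tgt j)

theorem run_copy {J : Type} (src tgt : J → W) (ht : Function.Injective tgt)
    (hst : ∀ i j, src i ≠ tgt j) (l : List J) (hl : l.Nodup) (z : W → Bool) :
    (∀ j ∈ l, run (copy src tgt l) z (tgt j) = xor (z (tgt j)) (z (src j))) ∧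
      ∀ w, (∀ j ∈ l, tgt j ≠ w) → run (copy src tgt l) z w = z w := by
  induction l generalizing z with
  | nil => simp [copy, run]
  | cons a l ih =>
    obtain ⟨hal, hl⟩ := List.nodup_cons.1 hl
    have hz : run (copy src tgt (a :: l)) z =
        run (copy src tgt l) (Function.update z (tgt a) (xor (z (tgt a)) (z (src a)))) := by
      simp [copy, run_cons, act, hst]
    obtain ⟨h1, h2⟩ := ih hl (Function.update z (tgt a) (xor (z (tgt a)) (z (src a))))
    rw [hz]
    constructor
    · intro j hj
      rcases List.mem_cons.1 hj with rfl | hj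
      · rw [h2 _ (fun i hi h => hal (by rwa [← ht h])), Function.update_self]
      · have : j ≠ a := fun h => hal (h ▸ hj)
        rw [h1 j hj, Function.update_of_ne (ht.ne this), Function.update_of_ne (hst _ _)]
    · intro w hw
      rw [h2 w (fun j hj => hw j (by simp [hj])), Function.update_of_ne (hw a (by simp)).symm]

theorem run_copy_finRange {n : ℕ} (src tgt : Fin n → W) (ht : Function.Injective tgt)
    (hst : ∀ i j, src i ≠ tgt j) (z : W → Bool) :
    run (copy src tgt (List.finRange n)) z =
      Function.extend tgt (fun j => xor (z (tgt j)) (z (src j))) z := by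
  obtain ⟨h1, h2⟩ := run_copy src tgt ht hst _ (List.nodup_finRange n) z
  funext w
  by_cases h : ∃ j, tgt j = w
  · obtain ⟨j, rfl⟩ := h
    rw [ht.extend_apply, h1 j (List.mem_finRange j)]
  · rw [Function.extend_apply' _ _ _ h, h2 w (fun j _ hj => h ⟨j, hj⟩)]

end CGate

/-! ### Boolean formulas and their reversible evaluation -/

/-- Boolean formulas over NAND with variables in `B`. -/
inductive Form (B : Type) : Type
  | tru
  | var (b : B)
  | nand (φ ψ : Form B)

namespace Form

variable {B : Type}

/-- The truth value under the assignment `z`. -/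
def eval (z : B → Bool) : Form B → Bool
  | tru => true
  | var b => z b
  | nand φ ψ => !(φ.eval z && ψ.eval z)

/-- The number of ancillas needed for the evaluation: one for every node but the variables. -/
def size : Form B → ℕ
  | tru => 1
  | var _ => 0
  | nand φ ψ => φ.size + ψ.size + 1

/-- The variable `t` does not occur. -/
def Avoids (t : B) : Form B → Prop
  | tru => True
  | var b => b ≠ t
  | nand φ ψ => φ.Avoids t ∧ ψ.Avoids t

variable {W : Type} (lw : B → W) (anc : ℕ → W)

/-- Reversible evaluation, on the ancillas with indices from `off` on: the gates, and the wire that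
holds the value. -/
def compile : Form B → ℕ → List (CGate W) × W
  | tru, off => ([CGate.not (anc off)], anc off)
  | var b, _ => ([], lw b)
  | nand φ ψ, off =>
    let p := φ.compile off
    let q := ψ.compile (off + φ.size)
    let a := anc (off + φ.size + ψ.size)
    (p.1 ++ (q.1 ++ [CGate.tof p.2 q.2 a, CGate.not a]), a)

theorem length_compile (φ : Form B) (off : ℕ) : (φ.compile lw anc off).1.length ≤ 2 * φ.size := by
  induction φ generalizing off with
  | tru => simp [compile, size]
  | var b => simp [compile, size]
  | nand φ ψ h1 h2 =>
    have h1 := h1 off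
    have h2 := h2 (off + φ.size)
    simp only [compile, size, List.length_append, List.length_cons, List.length_nil] at h1 h2 ⊢
    omega

variable {lw anc}

/-- The value is held by a logical wire or by one of the ancillas assigned to the formula. -/
theorem compile_result (φ : Form B) (off : ℕ) :
    (∃ b, (φ.compile lw anc off).2 = lw b) ∨
      ∃ i, off ≤ i ∧ i < off + φ.size ∧ (φ.compile lw anc off).2 = anc i := by
  cases φ with
  | tru => exact Or.inr ⟨off, le_rfl, by simp [size], rfl⟩
  | var b => exact Or.inl ⟨b, rfl⟩
  | nand φ ψ => exact Or.inr ⟨off + φ.size + ψ.size, by omega, by simp only [size]; omega, rfl⟩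

variable {N : ℕ} (hanc : ∀ i < N, ∀ j < N, anc i = anc j → i = j)
  (hlw : ∀ i < N, ∀ b, anc i ≠ lw b)

section
variable [DecidableEq W]

include hanc hlw in
/-- Only the ancillas assigned to the formula change, and the result wire holds the value. -/
theorem run_compile (φ : Form B) (off : ℕ) (hN : off + φ.size ≤ N) (z : W → Bool)
    (hz : ∀ i, off ≤ i → i < N → z (anc i) = false) :
    (∀ w, (∀ i, off ≤ i → i < off + φ.size → w ≠ anc i) →
        CGate.run (φ.compile lw anc off).1 z w = z w) ∧
      CGate.run (φ.compile lw anc off).1 z (φ.compile lw anc off).2 = φ.eval (z ∘ lw) := by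
  induction φ generalizing off z with
  | tru =>
    simp only [size] at hN
    simp only [compile, CGate.run, List.foldl_cons, List.foldl_nil, CGate.act]
    constructor
    · intro w hw
      rw [Function.update_of_ne (hw off le_rfl (by simp [size]))]
    · rw [Function.update_self, hz off le_rfl (by omega)]
      rfl
  | var b => exact ⟨fun _ _ => rfl, rfl⟩
  | nand φ ψ h1 h2 =>
    simp only [size] at hN
    obtain ⟨p1, p2⟩ := h1 off (by omega) z hz
    set z₁ := CGate.run (φ.compile lw anc off).1 z with hz₁
    have hz1 : ∀ i, off + φ.size ≤ i → i < N → z₁ (anc i) = false := by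
      intro i hi hiN
      rw [p1 _ (fun j hj hj' h => by have := hanc i hiN j (by omega) h; omega),
        hz i (by omega) hiN]
    obtain ⟨q1, q2⟩ := h2 (off + φ.size) (by omega) z₁ hz1
    set z₂ := CGate.run (ψ.compile lw anc (off + φ.size)).1 z₁ with hz₂
    have hlw1 : z₁ ∘ lw = z ∘ lw := by
      funext b
      exact p1 _ (fun i _ hi h => hlw i (by omega) b h.symm)
    have hp : z₂ (φ.compile lw anc off).2 = φ.eval (z ∘ lw) := by
      rw [q1, p2]
      intro i hi hi' h
      rcases compile_result (lw := lw) (anc := anc) φ off with ⟨b, hb⟩ | ⟨j, hj, hj', hb⟩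
      · exact hlw i (by omega) b (h.symm.trans hb)
      · have := hanc i (by omega) j (by omega) (h.symm.trans hb)
        omega
    have hq : z₂ (ψ.compile lw anc (off + φ.size)).2 = ψ.eval (z ∘ lw) := by rw [q2, hlw1]
    have ha : z₂ (anc (off + φ.size + ψ.size)) = false := by
      rw [q1, hz1 _ (by omega) (by omega)]
      intro i hi hi' h
      have := hanc _ (by omega) i (by omega) h
      omega
    have hne : ∀ (χ : Form B) (o : ℕ), o + χ.size ≤ off + φ.size + ψ.size →
        (χ.compile lw anc o).2 ≠ anc (off + φ.size + ψ.size) := by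
      intro χ o ho h
      rcases compile_result (lw := lw) (anc := anc) χ o with ⟨b, hb⟩ | ⟨j, hj, hj', hb⟩
      · exact hlw _ (by omega) b (h.symm.trans hb)
      · have := hanc _ (by omega) j (by omega) (h.symm.trans hb)
        omega
    have hrun : CGate.run ((nand φ ψ).compile lw anc off).1 z =
        Function.update z₂ (anc (off + φ.size + ψ.size))
          (!(φ.eval (z ∘ lw) && ψ.eval (z ∘ lw))) := by
      have hc : (φ.compile lw anc off).2 ≠ anc (off + φ.size + ψ.size) ∧
          (ψ.compile lw anc (off + φ.size)).2 ≠ anc (off + φ.size + ψ.size) :=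
        ⟨hne _ _ (by omega), hne _ _ (by omega)⟩
      simp only [compile, CGate.run_append, ← hz₁, ← hz₂]
      simp only [CGate.run, List.foldl_cons, List.foldl_nil, CGate.act, if_pos hc, hp, hq, ha,
        Function.update_self, Function.update_idem, Bool.false_xor]
    rw [hrun]
    constructor
    · intro w hw
      have hwa : w ≠ anc (off + φ.size + ψ.size) := hw _ (by omega) (by simp only [size]; omega)
      rw [Function.update_of_ne hwa,
        q1 w (fun i hi hi' => hw i (by omega) (by simp only [size]; omega)),
        p1 w (fun i hi hi' => hw i (by omega) (by simp only [size]; omega))]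
    · simp only [compile, Function.update_self, eval]

end

include hlw in
/-- The evaluation does not touch a logical wire that does not occur in the formula. -/
theorem avoids_compile (hinj : Function.Injective lw) (φ : Form B) (t : B) (ht : φ.Avoids t)
    (off : ℕ) (hN : off + φ.size ≤ N) :
    (∀ c ∈ (φ.compile lw anc off).1, c.Avoids (lw t)) ∧ (φ.compile lw anc off).2 ≠ lw t := by
  induction φ generalizing off with
  | tru =>
    simp only [size] at hN
    have := hlw off (by omega) t
    simp [compile, CGate.Avoids, this]
  | var b => exact ⟨by simp [compile], hinj.ne ht⟩
  | nand φ ψ h1 h2 =>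
    simp only [size] at hN
    obtain ⟨p1, p2⟩ := h1 ht.1 off (by omega)
    obtain ⟨q1, q2⟩ := h2 ht.2 (off + φ.size) (by omega)
    have ha := hlw (off + φ.size + ψ.size) (by omega) t
    refine ⟨?_, ha⟩
    intro c hc
    simp only [compile, List.mem_append, List.mem_cons, List.not_mem_nil, or_false] at hc
    rcases hc with hc | hc | rfl | rfl
    · exact p1 c hc
    · exact q1 c hc
    · exact ⟨p2, q2, ha⟩
    · exact ha

include hanc hlw in
/-- Computing a formula, adding its value to a wire that does not occur in it, and uncomputing. -/
theorem run_conj_compile [DecidableEq W] (hinj : Function.Injective lw) (φ : Form B) (t : B)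
    (ht : φ.Avoids t)
    (hN : φ.size ≤ N) (z : W → Bool) (hz : ∀ i < N, z (anc i) = false) :
    CGate.run (CGate.conj (φ.compile lw anc 0).1
        [CGate.tof (φ.compile lw anc 0).2 (φ.compile lw anc 0).2 (lw t)]) z =
      Function.update z (lw t) (xor (z (lw t)) (φ.eval (z ∘ lw))) := by
  obtain ⟨h1, h2⟩ := run_compile hanc hlw φ 0 (by omega) z (fun i _ hi => hz i hi)
  obtain ⟨a1, a2⟩ := avoids_compile hlw hinj φ t ht 0 (by omega)
  have h3 := h1 (lw t) (fun i _ hi h => hlw i (by omega) t h.symm)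
  rw [CGate.run_conj]
  simp only [CGate.run_cons _ [], CGate.act, if_pos (And.intro a2 a2), h2, h3, Bool.and_self]
  rw [← CGate.run_reverse_run (φ.compile lw anc 0).1 (Function.update z _ _),
    CGate.run_update _ _ a1]
  rfl

end Form

/-! ### Logical circuits -/

/-- Operations on logical wires `B`: Hadamard, a phase flip or a bit flip controlled by a formula,
and an oracle call on registers `X`, `Y`. -/
inductive HOp (B : Type) (m d : ℕ) : Type
  | had (b : B)
  | phase (φ : Form B)
  | xor (φ : Form B) (t : B) (h : φ.Avoids t)
  | oracle (X : Fin m → B) (Y : Fin d → B) (hY : Function.Injective Y) (h : ∀ i j, X i ≠ Y j)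

/-- XOR the string `y` into the register `Y`. -/
def xorReg {B : Type} {d : ℕ} (Y : Fin d → B) (y : Bits d) (z : B → Bool) : B → Bool :=
  Function.extend Y (fun i => xor (z (Y i)) (y i)) z

theorem xorReg_xorReg {B : Type} {d : ℕ} (Y : Fin d → B) (hY : Function.Injective Y) (y : Bits d)
    (z : B → Bool) : xorReg Y y (xorReg Y y z) = z := by
  funext b
  by_cases h : ∃ i, Y i = b
  · obtain ⟨i, rfl⟩ := h
    simp only [xorReg, hY.extend_apply, Bool.xor_assoc, Bool.xor_self, Bool.xor_false]
  · simp only [xorReg, Function.extend_apply' _ _ _ h]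

theorem xorReg_comp {B : Type} {m d : ℕ} (X : Fin m → B) (Y : Fin d → B)
    (h : ∀ i j, X i ≠ Y j) (y : Bits d) (z : B → Bool) : xorReg Y y z ∘ X = z ∘ X := by
  funext i
  simp only [xorReg, Function.comp]
  rw [Function.extend_apply' _ _ _ (fun ⟨j, hj⟩ => h i j hj.symm)]

theorem Form.eval_update_of_avoids {B : Type} [DecidableEq B] (φ : Form B) (t : B)
    (h : φ.Avoids t) (z : B → Bool) (v : Bool) :
    φ.eval (Function.update z t v) = φ.eval z := by
  induction φ with
  | tru => rfl
  | var b => exact Function.update_of_ne h _ _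
  | nand φ ψ h1 h2 => simp only [Form.eval, h1 h.1, h2 h.2]

namespace HOp

variable {B : Type} {m d : ℕ}

/-- Action of an operation on a vector of amplitudes, with oracle `f`. -/
def eff [DecidableEq B] (f : Bits m → Bits d) : HOp B m d → State B → State B
  | had b, ψ => (Gate.had b).apply ψ
  | phase φ, ψ => fun z => (if φ.eval z then -1 else 1) * ψ z
  | xor φ t _, ψ => fun z => ψ (Function.update z t (Bool.xor (z t) (φ.eval z)))
  | oracle X Y _ _, ψ => fun z => ψ (xorReg Y (f (z ∘ X)) z)

/-- Action of a list of operations, first operation first. -/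
def run [DecidableEq B] (f : Bits m → Bits d) (l : List (HOp B m d)) (ψ : State B) : State B :=
  l.foldl (fun ψ o => o.eff f ψ) ψ

/-- Number of ancillas used. -/
def anc : HOp B m d → ℕ
  | phase φ => φ.size
  | xor φ _ _ => φ.size
  | _ => 0

/-- Number of oracle calls used: computing the digest of a register and cleaning up takes two. -/
def queries : HOp B m d → ℕ
  | oracle _ _ _ _ => 2
  | _ => 0

end HOp

/-! ### Compilation of logical circuits -/

/-- Run a list of steps of an oracle circuit. -/
def runSteps {m d a : ℕ} (f : Bits m → Bits d) (l : List (Step m d a))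
    (ψ : State (QWire m d a)) : State (QWire m d a) :=
  l.foldl (fun φ s => s.apply f φ) ψ

theorem runSteps_append {m d a : ℕ} (f : Bits m → Bits d) (l l' : List (Step m d a))
    (ψ : State (QWire m d a)) : runSteps f (l ++ l') ψ = runSteps f l' (runSteps f l ψ) := by
  simp [runSteps, List.foldl_append]

theorem runSteps_gates {m d a : ℕ} (f : Bits m → Bits d) (l : List (Gate (QWire m d a)))
    (ψ : State (QWire m d a)) : runSteps f (l.map Step.gate) ψ = runGates l ψ := by
  rw [runSteps, List.foldl_map]
  rfl

theorem runSteps_query {m d a : ℕ} (f : Bits m → Bits d) (ψ : State (QWire m d a)) :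
    runSteps f [Step.query] ψ = fun z => ψ (queryPerm f z) := rfl

theorem update_xor_involutive {B : Type} [DecidableEq B] (φ : Form B) (t : B) (h : φ.Avoids t) :
    Function.Involutive fun z : B → Bool => Function.update z t (xor (z t) (φ.eval z)) := by
  intro z
  simp [φ.eval_update_of_avoids t h]

section Compile

variable {B : Type} [Fintype B] (m d N : ℕ)

/-- Number of work qubits of a compiled circuit: the logical wires and `N + 1` ancillas. -/
abbrev workSize (B : Type) [Fintype B] (N : ℕ) : ℕ := Fintype.card (B ⊕ Fin (N + 1))

/-- The wire of a compiled circuit that holds a logical wire. -/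
def logWire (b : B) : QWire m d (workSize B N) :=
  .inr (.inr (Fintype.equivFin (B ⊕ Fin (N + 1)) (.inl b)))

/-- The ancillas of a compiled circuit. -/
def ancWire (B : Type) [Fintype B] (i : ℕ) : QWire m d (workSize B N) :=
  .inr (.inr (Fintype.equivFin (B ⊕ Fin (N + 1)) (.inr (Fin.ofNat (N + 1) i))))

/-- The basis state of a compiled circuit given by a basis state of the logical wires: all other
qubits are zero. -/
def embedBits (z : B → Bool) : QWire m d (workSize B N) → Bool :=
  Sum.elim (fun _ => false) (Sum.elim (fun _ => false) fun w =>
    Sum.elim z (fun _ => false) ((Fintype.equivFin (B ⊕ Fin (N + 1))).symm w))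

variable {m d N}

theorem logWire_injective : Function.Injective (logWire m d N : B → _) := by
  intro a b h
  simpa [logWire] using h

@[simp] theorem embedBits_logWire (z : B → Bool) (b : B) :
    embedBits m d N z (logWire m d N b) = z b := by
  simp [embedBits, logWire]

@[simp] theorem embedBits_comp_logWire (z : B → Bool) :
    embedBits m d N z ∘ logWire m d N = z := by
  funext b
  simp

theorem embedBits_ancWire (z : B → Bool) (i : ℕ) :
    embedBits m d N z (ancWire m d N B i) = false := by
  simp [embedBits, ancWire]

theorem embedBits_injective : Function.Injective (embedBits m d N : (B → Bool) → _) := by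
  intro z z' h
  rw [← embedBits_comp_logWire (m := m) (d := d) (N := N) z, h, embedBits_comp_logWire]

theorem ancWire_inj : ∀ i < N + 1, ∀ j < N + 1, ancWire m d N B i = ancWire m d N B j → i = j := by
  intro i hi j hj h
  simpa [ancWire, Fin.ext_iff, Nat.mod_eq_of_lt hi, Nat.mod_eq_of_lt hj] using h

theorem ancWire_ne_logWire (i : ℕ) (b : B) : ancWire m d N B i ≠ logWire m d N b := by
  simp [ancWire, logWire]

theorem embedBits_update [DecidableEq B] (z : B → Bool) (b : B) (v : Bool) :
    embedBits m d N (Function.update z b v) =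
      Function.update (embedBits m d N z) (logWire m d N b) v := by
  funext w
  by_cases hw : w = logWire m d N b
  · subst hw
    rw [Function.update_self, embedBits_logWire, Function.update_self]
  · rw [Function.update_of_ne hw]
    rcases w with w | w | w
    · rfl
    · rfl
    · obtain ⟨c, rfl⟩ := (Fintype.equivFin (B ⊕ Fin (N + 1))).surjective w
      rcases c with c | c
      · have : c ≠ b := fun h => hw (by rw [h]; rfl)
        simp only [embedBits, Sum.elim_inr, Equiv.symm_apply_apply, Sum.elim_inl,
          Function.update_of_ne this]
      · simp only [embedBits, Sum.elim_inr, Equiv.symm_apply_apply]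

/-- The state of a compiled circuit that corresponds to a state of the logical wires. -/
def lift (m d N : ℕ) (φ : State B) : State (QWire m d (workSize B N)) :=
  Function.extend (embedBits m d N) φ 0

theorem lift_embedBits (φ : State B) (z : B → Bool) : lift m d N φ (embedBits m d N z) = φ z :=
  embedBits_injective.extend_apply _ _ _

theorem lift_eq_zero (φ : State B) (y : QWire m d (workSize B N) → Bool)
    (h : ¬ ∃ z, embedBits m d N z = y) : lift m d N φ y = 0 :=
  Function.extend_apply' _ _ _ h

/-- A permutation of the basis states that restricts to the image of `embedBits` commutes with
`lift`. -/
theorem lift_comp (φ : State B)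
    (P : (QWire m d (workSize B N) → Bool) → QWire m d (workSize B N) → Bool)
    (p : (B → Bool) → B → Bool) (hP : Function.Injective P) (hp : Function.Surjective p)
    (h : ∀ z, P (embedBits m d N z) = embedBits m d N (p z)) :
    (fun y => lift m d N φ (P y)) = lift m d N (fun z => φ (p z)) := by
  funext y
  by_cases hy : ∃ z, embedBits m d N z = y
  · obtain ⟨z, rfl⟩ := hy
    rw [h, lift_embedBits, lift_embedBits]
  · rw [lift_eq_zero _ _ hy, lift_eq_zero]
    rintro ⟨z, hz⟩
    obtain ⟨w, rfl⟩ := hp z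
    rw [← h] at hz
    exact hy ⟨w, hP hz⟩

variable (N) in
/-- CNOT gates from the register `X` to the message qubits. -/
def copyX (X : Fin m → B) : List (CGate (QWire m d (workSize B N))) :=
  CGate.copy (fun j => logWire m d N (X j)) (fun j => .inl j) (List.finRange m)

variable (N) in
/-- CNOT gates from the digest qubits to the register `Y`. -/
def copyY (Y : Fin d → B) : List (CGate (QWire m d (workSize B N))) :=
  CGate.copy (fun j => .inr (.inl j)) (fun j => logWire m d N (Y j)) (List.finRange d)

variable (N) in
/-- The steps that realise an operation on logical wires. An oracle call copies the register
`X` to the message qubits, copies the digest to `Y`, and cleans up by a second call. -/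
def HOp.compile : HOp B m d → List (Step m d (workSize B N))
  | had b => [Step.gate (Gate.had (logWire m d N b))]
  | phase φ =>
    let p := φ.compile (logWire m d N) (ancWire m d N B) 0
    (CGate.phaseGates p.1 p.2).map Step.gate
  | xor φ t _ =>
    let p := φ.compile (logWire m d N) (ancWire m d N B) 0
    (CGate.compile (CGate.conj p.1 [CGate.tof p.2 p.2 (logWire m d N t)])).map Step.gate
  | oracle X Y _ _ =>
    (CGate.compile (copyX N X)).map Step.gate ++ ([Step.query] ++
      ((CGate.compile (copyY N Y)).map Step.gate ++ ([Step.query] ++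
        (CGate.compile (copyX N X).reverse).map Step.gate)))

theorem run_copyX_embedBits (X : Fin m → B) (z : B → Bool) :
    CGate.run (copyX N X) (embedBits m d N z) =
      Sum.elim (z ∘ X) (embedBits m d N z ∘ Sum.inr) := by
  rw [copyX, CGate.run_copy_finRange _ _ Sum.inl_injective (by simp [logWire])]
  funext w
  rcases w with w | w
  · rw [Sum.inl_injective.extend_apply]
    simp only [embedBits_logWire]
    simp [embedBits]
  · rw [Function.extend_apply' _ _ _ (by simp)]
    rfl

/-- Compilation is faithful. -/
theorem HOp.runSteps_compile [DecidableEq B] (f : Bits m → Bits d) (o : HOp B m d) (ho : o.anc ≤ N)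
    (φ : State B) : runSteps f (o.compile N) (lift m d N φ) = lift m d N (o.eff f φ) := by
  have hanc := @ancWire_inj B _ m d N
  have hlw : ∀ i < N + 1, ∀ b : B, ancWire m d N B i ≠ logWire m d N b :=
    fun i _ b => ancWire_ne_logWire i b
  cases o with
  | had b =>
    funext y
    simp only [HOp.compile, runSteps, List.foldl_cons, List.foldl_nil, Step.apply, HOp.eff,
      Gate.apply]
    by_cases hy : ∃ z, embedBits m d N z = y
    · obtain ⟨z, rfl⟩ := hy
      simp only [← embedBits_update, lift_embedBits, embedBits_logWire]
    · have h0 : ∀ v, lift m d N φ (Function.update y (logWire m d N b) v) = 0 := by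
        intro v
        apply lift_eq_zero
        rintro ⟨z, hz⟩
        refine hy ⟨Function.update z b (y (logWire m d N b)), ?_⟩
        rw [embedBits_update, hz, Function.update_idem, Function.update_eq_self]
      rw [h0, h0, lift_eq_zero _ _ hy]
      simp
  | phase χ =>
    funext y
    simp only [HOp.compile, HOp.eff]
    rw [runSteps_gates, CGate.runGates_phaseGates]
    by_cases hy : ∃ z, embedBits m d N z = y
    · obtain ⟨z, rfl⟩ := hy
      rw [(Form.run_compile hanc hlw χ 0 (by simp only [HOp.anc] at ho; omega) _
        (fun i _ _ => embedBits_ancWire z i)).2, lift_embedBits, lift_embedBits,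
        embedBits_comp_logWire]
    · rw [lift_eq_zero _ _ hy, lift_eq_zero _ _ hy, mul_zero]
  | xor χ t h =>
    simp only [HOp.compile, HOp.eff]
    rw [runSteps_gates]
    have : runGates (CGate.compile (CGate.conj (χ.compile (logWire m d N) (ancWire m d N B) 0).1
        [CGate.tof (χ.compile (logWire m d N) (ancWire m d N B) 0).2
          (χ.compile (logWire m d N) (ancWire m d N B) 0).2 (logWire m d N t)]))
        (lift m d N φ) = fun y => lift m d N φ (CGate.run (CGate.conj (χ.compile (logWire m d N)
          (ancWire m d N B) 0).1 [CGate.tof (χ.compile (logWire m d N) (ancWire m d N B) 0).2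
          (χ.compile (logWire m d N) (ancWire m d N B) 0).2 (logWire m d N t)]) y) := by
      funext y
      rw [CGate.runGates_compile, CGate.reverse_conj]
      rfl
    rw [this]
    refine lift_comp φ _ _ (CGate.run_injective _) (update_xor_involutive χ t h).surjective ?_
    intro z
    rw [Form.run_conj_compile hanc hlw logWire_injective χ t h
      (by simp only [HOp.anc] at ho; omega) _ (fun i _ => embedBits_ancWire z i),
      embedBits_update, embedBits_logWire, embedBits_comp_logWire]
  | oracle X Y hY h =>
    simp only [HOp.compile, HOp.eff]
    simp only [runSteps_append, runSteps_gates, runSteps_query]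
    have : ∀ ψ : State (QWire m d (workSize B N)),
        (runGates (CGate.compile (copyX N X).reverse) fun z =>
          runGates (CGate.compile (copyY N Y)) (fun z => runGates (CGate.compile (copyX N X)) ψ
            (queryPerm f z)) (queryPerm f z)) =
        fun z => ψ (CGate.run (copyX N X).reverse (queryPerm f (CGate.run (copyY N Y).reverse
          (queryPerm f (CGate.run (copyX N X) z))))) := by
      intro ψ
      funext z
      rw [CGate.runGates_compile, List.reverse_reverse, CGate.runGates_compile,
        CGate.runGates_compile]
    rw [this]
    refine lift_comp φ _ (fun z => xorReg Y (f (z ∘ X)) z) ?_ ?_ ?_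
    · exact (CGate.run_injective _).comp ((queryPerm_involutive f).injective.comp
        ((CGate.run_injective _).comp ((queryPerm_involutive f).injective.comp
          (CGate.run_injective _))))
    · refine Function.Involutive.surjective fun z => ?_
      simp only [xorReg_comp X Y h, xorReg_xorReg Y hY]
    · intro z
      have hYinj : Function.Injective fun j => logWire m d N (Y j) := logWire_injective.comp hY
      -- It suffices to compare the two sides in the middle, where the digest has been computed.
      have key : queryPerm f (CGate.run (copyX N X) (embedBits m d N z)) =
          CGate.run (copyY N Y) (queryPerm f (CGate.run (copyX N X)
            (embedBits m d N (xorReg Y (f (z ∘ X)) z)))) := by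
        rw [run_copyX_embedBits, run_copyX_embedBits, copyY,
          CGate.run_copy_finRange _ _ hYinj (by simp [logWire]), xorReg_comp X Y h]
        funext w
        by_cases hw : ∃ j, logWire m d N (Y j) = w
        · obtain ⟨j, rfl⟩ := hw
          rw [hYinj.extend_apply (g := fun j => _)]
          simp [queryPerm, logWire, embedBits, xorReg, hY.extend_apply, Function.comp_def]
        · rw [Function.extend_apply' _ _ _ hw]
          rcases w with w | w | w
          · rfl
          · rfl
          · obtain ⟨c, rfl⟩ := (Fintype.equivFin (B ⊕ Fin (N + 1))).surjective w
            rcases c with c | c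
            · have : ¬ ∃ j, Y j = c := fun ⟨j, hj⟩ => hw ⟨j, by rw [hj]; rfl⟩
              simp [queryPerm, embedBits, xorReg, Function.extend_apply' _ _ _ this]
            · simp [queryPerm, embedBits]
      rw [key, CGate.run_reverse_run, queryPerm_involutive f _, CGate.run_reverse_run]

end Compile

/-! ### The oracle circuit of a logical circuit -/

section OfOps

variable {B : Type} [Fintype B] {m d : ℕ}

theorem HOp.length_compile (N : ℕ) (o : HOp B m d) :
    (o.compile N).length ≤ 4 * o.anc + (2 * m + d + 3) := by
  have h1 : ∀ φ : Form B, (φ.compile (logWire m d N) (ancWire m d N B) 0).1.length ≤ 2 * φ.size :=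
    fun φ => φ.length_compile _ _ 0
  cases o with
  | had b =>
    simp only [HOp.compile, List.length_singleton]
    omega
  | phase φ =>
    have h2 := CGate.length_compile_le (φ.compile (logWire m d N) (ancWire m d N B) 0).1
    have h3 := CGate.length_compile_le (φ.compile (logWire m d N) (ancWire m d N B) 0).1.reverse
    have h1 := h1 φ
    simp only [List.length_reverse] at h3
    simp only [HOp.compile, HOp.anc, CGate.phaseGates, List.length_map, List.length_append,
      List.length_cons, List.length_nil]
    omega
  | xor φ t h =>
    have h1 := h1 φ
    simp only [HOp.compile, HOp.anc, List.length_map]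
    refine (CGate.length_compile_le _).trans ?_
    simp only [CGate.conj, List.length_append, List.length_reverse, List.length_cons,
      List.length_nil]
    omega
  | oracle X Y hY h =>
    have h2 := CGate.length_compile_le (copyX (d := d) N X)
    have h3 := CGate.length_compile_le (copyX (d := d) N X).reverse
    have h4 := CGate.length_compile_le (copyY (m := m) N Y)
    simp only [List.length_reverse, copyX, copyY, CGate.copy, List.length_map,
      List.length_finRange] at h2 h3 h4
    simp only [HOp.compile, copyX, copyY, CGate.copy, List.length_map, List.length_append,
      List.length_cons, List.length_nil]
    omega

/-- The oracle circuit that runs a list of operations on logical wires and outputs the messages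
in the registers `o₁` and `o₂`. -/
def ofOps (ops : List (HOp B m d)) (o₁ o₂ : Fin m → B) : OracleCircuit d where
  msgLen := m
  work := workSize B (ops.map HOp.anc).sum
  steps := ops.flatMap fun o => o.compile (ops.map HOp.anc).sum
  out₁ := fun j => logWire m d _ (o₁ j)
  out₂ := fun j => logWire m d _ (o₂ j)

theorem countP_map_gate {a : ℕ} (l : List (Gate (QWire m d a))) (p : Step m d a → Bool)
    (hp : ∀ g, p (.gate g) = false) : (l.map Step.gate).countP p = 0 := by
  rw [List.countP_eq_zero]
  intro s hs
  obtain ⟨g, _, rfl⟩ := List.mem_map.1 hs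
  simp [hp]

theorem queries_ofOps (ops : List (HOp B m d)) (o₁ o₂ : Fin m → B) :
    (ofOps ops o₁ o₂).queries = (ops.map HOp.queries).sum := by
  have key : ∀ (N : ℕ) (p : Step m d (workSize B N) → Bool), (∀ g, p (.gate g) = false) →
      p .query = true →
      (ops.flatMap fun o => o.compile N).countP p = (ops.map HOp.queries).sum := by
    intro N p hg hq
    induction ops with
    | nil => rfl
    | cons o l ih =>
      rw [List.flatMap_cons, List.countP_append, ih, List.map_cons, List.sum_cons]
      congr 1
      cases o with
      | had b => simp [HOp.compile, HOp.queries, hg]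
      | phase φ => exact countP_map_gate _ _ hg
      | xor φ t h => exact countP_map_gate _ _ hg
      | oracle X Y hY h =>
        simp only [HOp.compile, List.countP_append, countP_map_gate _ _ hg]
        simp [hq, HOp.queries]
  exact key _ _ (fun _ => rfl) rfl

theorem size_ofOps_le (ops : List (HOp B m d)) (o₁ o₂ : Fin m → B) (K : ℕ)
    (hK : ∀ o ∈ ops, o.anc ≤ K) :
    (ofOps ops o₁ o₂).size ≤
      (ops.length + 1) * (5 * K + 3 * (m + d + 1)) + Fintype.card B := by
  have h1 : (ops.map HOp.anc).sum ≤ ops.length * K := by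
    have := List.sum_le_card_nsmul (ops.map HOp.anc) K (by simpa using hK)
    simpa using this
  have h2 : ∀ N, (ops.flatMap fun o => o.compile N).length ≤
      ops.length * (4 * K + (2 * m + d + 3)) := by
    intro N
    rw [List.length_flatMap]
    have := List.sum_le_card_nsmul (ops.map fun o => (o.compile N).length)
      (4 * K + (2 * m + d + 3)) (by
        intro x hx
        obtain ⟨o, ho, rfl⟩ := List.mem_map.1 hx
        have := o.length_compile N
        have := hK o ho
        omega)
    simpa using this
  have h2 := h2 (ops.map HOp.anc).sum
  simp only [OracleCircuit.size, ofOps, workSize, Fintype.card_sum, Fintype.card_fin]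
  nlinarith

variable [DecidableEq B]

theorem runSteps_flatMap_compile (f : Bits m → Bits d) (ops : List (HOp B m d)) (N : ℕ)
    (hN : ∀ o ∈ ops, o.anc ≤ N) (φ : State B) :
    runSteps f (ops.flatMap fun o => o.compile N) (lift m d N φ) =
      lift m d N (HOp.run f ops φ) := by
  induction ops generalizing φ with
  | nil => rfl
  | cons o l ih =>
    rw [List.flatMap_cons, runSteps_append, o.runSteps_compile f (hN o (by simp)),
      ih (fun o ho => hN o (by simp [ho]))]
    rfl

theorem run_ofOps (ops : List (HOp B m d)) (o₁ o₂ : Fin m → B) (f : Bits m → Bits d) :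
    (ofOps ops o₁ o₂).run f =
      lift m d (ops.map HOp.anc).sum (HOp.run f ops (ket fun _ => false)) := by
  rw [← runSteps_flatMap_compile f ops _ fun o ho =>
    List.single_le_sum (by simp) _ (List.mem_map_of_mem ho)]
  have : lift m d (ops.map HOp.anc).sum (ket fun _ : B => false) = ket fun _ => false := by
    rw [lift, extend_ket _ embedBits_injective]
    congr 1
    funext w
    rcases w with w | w | w
    · rfl
    · rfl
    · obtain ⟨c, rfl⟩ := (Fintype.equivFin (B ⊕ Fin ((ops.map HOp.anc).sum + 1))).surjective w
      rcases c with c | c <;> simp only [embedBits, Sum.elim_inr, Equiv.symm_apply_apply,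
        Sum.elim_inl]
  rw [this]
  rfl

/-- The squared norm of the component of `ψ` spanned by the basis states in `P`: for normalised `ψ`,
the probability that the measurement yields an element of `P`. -/
def weight {W : Type} [Fintype W] [DecidableEq W] (ψ : State W) (P : Set (W → Bool)) : ℝ :=
  ∑ z, P.indicator (fun z => ‖ψ z‖ ^ 2) z

theorem toOuterMeasure_measure {W : Type} [Fintype W] [DecidableEq W] (ψ : State W)
    (h : normSq ψ = 1) (P : Set (W → Bool)) :
    (measure ψ h).toOuterMeasure P = ENNReal.ofReal (1 - weight ψ Pᶜ) := by
  classical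
  rw [PMF.toOuterMeasure_apply_fintype, ← h, normSq, weight, ← Finset.sum_sub_distrib,
    ENNReal.ofReal_sum_of_nonneg]
  · refine Finset.sum_congr rfl fun z _ => ?_
    by_cases hz : z ∈ P <;> simp [hz, measure]
  · intro z _
    by_cases hz : z ∈ P <;> simp [hz]

theorem toOuterMeasure_output_ofOps (ops : List (HOp B m d)) (o₁ o₂ : Fin m → B)
    (f : Bits m → Bits d) (S : Set (Bits m × Bits m)) :
    ((ofOps ops o₁ o₂).output f).toOuterMeasure S = ENNReal.ofReal
      (1 - weight (HOp.run f ops (ket fun _ => false)) {z | (z ∘ o₁, z ∘ o₂) ∉ S}) := by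
  have hn : normSq (HOp.run f ops (ket fun _ => false)) = 1 := by
    rw [← normSq_extend _ (embedBits_injective (m := m) (d := d) (N := (ops.map HOp.anc).sum))]
    have := (ofOps ops o₁ o₂).normSq_run f
    rw [run_ofOps] at this
    exact this
  have : (ofOps ops o₁ o₂).output f = (measure _ hn).map fun z => (z ∘ o₁, z ∘ o₂) := by
    unfold OracleCircuit.output
    have h1 : measure ((ofOps ops o₁ o₂).run f) ((ofOps ops o₁ o₂).normSq_run f) =
        (measure _ hn).map (embedBits m d (ops.map HOp.anc).sum) := by
      rw [← measure_extend _ embedBits_injective _ hn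
        ((normSq_extend _ embedBits_injective _).trans hn)]
      congr 1
      exact run_ofOps ops o₁ o₂ f
    rw [h1]
    refine (PMF.map_comp _ _ _).trans ?_
    congr 1
    funext z
    exact Prod.ext (funext fun i => embedBits_logWire (m := m) (d := d) z _)
      (funext fun i => embedBits_logWire (m := m) (d := d) z _)
  have h2 := PMF.toOuterMeasure_map_apply (fun z => (z ∘ o₁, z ∘ o₂)) (measure _ hn) S
  rw [toOuterMeasure_measure] at h2
  exact (congrArg (fun p => p.toOuterMeasure S) this).trans h2

end OfOps

/-! ### Replacing the oracle by an evaluation circuit -/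

section Instantiate

variable {d κ : ℕ}

/-- The basis states of an instantiated circuit with key `k` and auxiliary qubits zero. -/
def keyedBits {m a b : ℕ} (k : Bits κ) (z : QWire m d a → Bool) : FullWire κ m d a b → Bool :=
  Sum.elim k (Sum.elim (fun i => z (.inl i)) (Sum.elim (fun i => z (.inr (.inl i)))
    (Sum.elim (fun i => z (.inr (.inr i))) fun _ => false)))

theorem keyedBits_comp {m a b : ℕ} (k : Bits κ) (z : QWire m d a → Bool) :
    (keyedBits k z : FullWire κ m d a b → Bool) ∘ circuitWires κ m d a b = z := by
  funext w
  rcases w with w | w | w <;> rfl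

theorem keyedBits_injective {m a b : ℕ} (k : Bits κ) :
    Function.Injective (keyedBits k : (QWire m d a → Bool) → FullWire κ m d a b → Bool) := by
  intro z z' h
  rw [← keyedBits_comp (b := b) k z, h, keyedBits_comp]

theorem extend_circuitWires_keyedBits {m a b : ℕ} (k : Bits κ) (x z : QWire m d a → Bool) :
    Function.extend (circuitWires κ m d a b) x (keyedBits k z) = keyedBits k x := by
  funext w
  by_cases hw : ∃ v, circuitWires κ m d a b v = w
  · obtain ⟨v, rfl⟩ := hw
    rw [(circuitWires κ m d a b).injective.extend_apply]
    exact (congrFun (keyedBits_comp (b := b) k x) v).symm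
  · rw [Function.extend_apply' _ _ _ hw]
    rcases w with w | w | w | w | w
    · rfl
    · exact (hw ⟨.inl w, rfl⟩).elim
    · exact (hw ⟨.inr (.inl w), rfl⟩).elim
    · exact (hw ⟨.inr (.inr w), rfl⟩).elim
    · rfl

theorem extend_eq_sum {W W' : Type} [Fintype W] [DecidableEq W] [DecidableEq W']
    (ι : (W → Bool) → W' → Bool) (hι : Function.Injective ι) (φ : State W) (y : W' → Bool)
    [DecidableEq (W' → Bool)] :
    (Function.extend ι φ 0 : State W') y = ∑ z, if y = ι z then φ z else 0 := by
  by_cases hy : ∃ z, ι z = y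
  · obtain ⟨z, rfl⟩ := hy
    rw [hι.extend_apply]
    simp [hι.eq_iff]
  · rw [Function.extend_apply' _ _ _ hy, Finset.sum_eq_zero]
    · rfl
    · intro z _
      rw [if_neg fun h => hy ⟨z, h.symm⟩]

/-- Gates of the oracle circuit act on an instantiated circuit as they should. -/
theorem apply_map_circuitWires {m a b : ℕ} (k : Bits κ) (g : Gate (QWire m d a))
    (φ : State (QWire m d a)) :
    (g.map (circuitWires κ m d a b)).apply (Function.extend (keyedBits k) φ 0) =
      Function.extend (keyedBits k) (g.apply φ) 0 := by
  funext y
  rw [Gate.apply_map]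
  by_cases hy : ∃ z, keyedBits k z = y
  · obtain ⟨z, rfl⟩ := hy
    rw [(keyedBits_injective k).extend_apply, keyedBits_comp]
    simp only [extend_circuitWires_keyedBits, (keyedBits_injective k).extend_apply]
  · rw [Function.extend_apply' _ _ _ hy]
    have : (fun x => (Function.extend (keyedBits k) φ 0 : State (FullWire κ m d a b))
        (Function.extend (circuitWires κ m d a b) x y)) = 0 := by
      funext x
      apply Function.extend_apply'
      rintro ⟨z, hz⟩
      refine hy ⟨y ∘ circuitWires κ m d a b, ?_⟩
      rw [← extend_circuitWires_keyedBits k _ z, hz, extend_extend, extend_comp_self]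
    rw [this, g.isLinearMap_apply.map_zero]
    rfl

/-- A circuit that implements `F` acts as a query to `F k`, by linearity from its action on basis
states. -/
theorem runGates_map_evalWires {m a : ℕ} (E : EvalCircuit κ m d) (F : Bits κ → Bits m → Bits d)
    (hE : E.Implements F) (k : Bits κ) (φ : State (QWire m d a)) :
    runGates (E.gates.map (Gate.map (evalWires κ m d a E.anc)))
        (Function.extend (keyedBits k) φ 0) =
      Function.extend (keyedBits k) (fun z => φ (queryPerm (F k) z)) 0 := by
  classical
  funext y
  rw [runGates_map]
  set ε : (QWire m d a → Bool) → Fin κ ⊕ QWire m d E.anc → Bool := fun z =>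
    Sum.elim k (Sum.elim (fun i => z (.inl i)) (Sum.elim (fun i => z (.inr (.inl i)))
      fun _ => false)) with hε
  set wk : Set (QWire m d a → Bool) := {z | ∀ i : Fin a, z (.inr (.inr i)) =
    y (.inr (.inr (.inr (.inl i))))} with hwk
  -- A basis state is determined by its work qubits and the wires of the evaluation circuit.
  have hiff : ∀ (x : Fin κ ⊕ QWire m d E.anc → Bool) (z : QWire m d a → Bool),
      Function.extend (evalWires κ m d a E.anc) x y = keyedBits k z ↔ z ∈ wk ∧ x = ε z := by
    intro x z
    have hw : ∀ i : Fin a, Function.extend (evalWires κ m d a E.anc) x y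
        (.inr (.inr (.inr (.inl i)))) = y (.inr (.inr (.inr (.inl i)))) := by
      intro i
      apply Function.extend_apply'
      rintro ⟨v, hv⟩
      rcases v with v | v | v | v <;> cases hv
    have hk : (keyedBits k z : FullWire κ m d a E.anc → Bool) ∘ evalWires κ m d a E.anc = ε z := by
      funext v
      rcases v with v | v | v | v <;> rfl
    constructor
    · intro h
      refine ⟨fun i => ?_, ?_⟩
      · rw [← hw i, h]
        rfl
      · rw [← hk, ← h, extend_comp]
    · rintro ⟨hz, rfl⟩
      rw [← hk]
      funext v
      by_cases hv : ∃ u, evalWires κ m d a E.anc u = v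
      · obtain ⟨u, rfl⟩ := hv
        rw [(evalWires κ m d a E.anc).injective.extend_apply]
        rfl
      · rw [Function.extend_apply' _ _ _ hv]
        rcases v with v | v | v | v | v
        · exact (hv ⟨.inl v, rfl⟩).elim
        · exact (hv ⟨.inr (.inl v), rfl⟩).elim
        · exact (hv ⟨.inr (.inr (.inl v)), rfl⟩).elim
        · exact (hz v).symm
        · exact (hv ⟨.inr (.inr (.inr v)), rfl⟩).elim
  have hslice : (fun x => (Function.extend (keyedBits k) φ 0 : State (FullWire κ m d a E.anc))
      (Function.extend (evalWires κ m d a E.anc) x y)) =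
      ∑ z, (if z ∈ wk then φ z else 0) • ket (ε z) := by
    funext x
    rw [extend_eq_sum _ (keyedBits_injective k), Finset.sum_apply]
    refine Finset.sum_congr rfl fun z _ => ?_
    simp only [hiff, ket, Pi.smul_apply, smul_eq_mul]
    by_cases h1 : z ∈ wk <;> by_cases h2 : x = ε z <;> simp [h1, h2]
  have hQ : ∀ z, runGates E.gates (ket (ε z)) = ket (ε (queryPerm (F k) z)) := fun z =>
    hE k (fun i => z (.inl i)) (fun j => z (.inr (.inl j)))
  have hlin := isLinearMap_runGates E.gates
  have hsum : runGates E.gates (∑ z, (if z ∈ wk then φ z else 0) • ket (ε z)) =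
      ∑ z, (if z ∈ wk then φ z else 0) • ket (ε (queryPerm (F k) z)) := by
    have := map_sum (IsLinearMap.mk' _ hlin) (fun z => (if z ∈ wk then φ z else 0) • ket (ε z))
      Finset.univ
    simp only [IsLinearMap.mk'_apply] at this
    rw [this]
    exact Finset.sum_congr rfl fun z _ => by rw [hlin.map_smul, hQ]
  rw [hslice, hsum, extend_eq_sum _ (keyedBits_injective k), Finset.sum_apply,
    ← Equiv.sum_comp ((queryPerm_involutive (F k)).toPerm _)]
  refine Finset.sum_congr rfl fun z _ => ?_
  have hy : ∀ z, y = keyedBits k z ↔ z ∈ wk ∧ y ∘ evalWires κ m d a E.anc = ε z := by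
    intro z
    rw [← hiff, extend_comp_self]
  have hmem : ∀ z, queryPerm (F k) z ∈ wk ↔ z ∈ wk := fun z => Iff.rfl
  simp only [Function.Involutive.coe_toPerm, hy, ket, Pi.smul_apply, smul_eq_mul, hmem,
    queryPerm_involutive (F k) z]
  by_cases h1 : z ∈ wk <;>
    by_cases h2 : y ∘ evalWires κ m d a E.anc = ε z <;> simp [h1, h2]

/-- With a circuit that implements `F` in place of the oracle, the output is distributed as with
oracle access to `F k`. -/
theorem OracleCircuit.instOutput_eq (A : OracleCircuit d) (E : EvalCircuit κ A.msgLen d)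
    (F : Bits κ → Bits A.msgLen → Bits d) (hE : E.Implements F) (k : Bits κ) :
    A.instOutput E k = A.output (F k) := by
  have key : ∀ (l : List (Step A.msgLen d A.work)) (φ : State (QWire A.msgLen d A.work)),
      runGates (l.flatMap fun s => match s with
        | .gate g => [g.map (circuitWires κ A.msgLen d A.work E.anc)]
        | .query => E.gates.map (Gate.map (evalWires κ A.msgLen d A.work E.anc)))
        (Function.extend (keyedBits k) φ 0) =
      Function.extend (keyedBits k) (l.foldl (fun φ s => s.apply (F k) φ) φ) 0 := by
    intro l
    induction l with
    | nil => intro φ; rfl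
    | cons s l ih =>
      intro φ
      rw [List.flatMap_cons, runGates_append, List.foldl_cons, ← ih]
      congr 1
      cases s with
      | gate g => exact apply_map_circuitWires k g φ
      | query => exact runGates_map_evalWires E F hE k φ
  have hrun : runGates (A.instantiate E) (ket (Sum.elim k fun _ => false)) =
      Function.extend (keyedBits k) (A.run (F k)) 0 := by
    have := key A.steps (ket fun _ => false)
    rw [extend_ket _ (keyedBits_injective k)] at this
    rw [OracleCircuit.run, ← this, OracleCircuit.instantiate]
    congr 2
    funext w
    rcases w with w | w | w | w | w <;> rfl
  unfold OracleCircuit.instOutput OracleCircuit.output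
  have h1 : measure (runGates (A.instantiate E) (ket (Sum.elim k fun _ => false)))
      ((normSq_runGates _ _).trans (normSq_ket _)) =
      (measure (A.run (F k)) (A.normSq_run (F k))).map (keyedBits k) := by
    rw [← measure_extend _ (keyedBits_injective k) _ _
      ((normSq_extend _ (keyedBits_injective k) _).trans (A.normSq_run (F k)))]
    congr 1
  rw [h1, PMF.map_comp]
  congr 1
  funext z
  exact Prod.ext (funext fun i => congrFun (keyedBits_comp k z) _)
    (funext fun i => congrFun (keyedBits_comp k z) _)

theorem OracleCircuit.instSize_le (A : OracleCircuit d) (E : EvalCircuit κ A.msgLen d) :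
    A.instSize E ≤ A.size * (E.gates.length + 1) + κ + E.anc := by
  have : (A.instantiate E).length ≤ A.steps.length * (E.gates.length + 1) := by
    unfold OracleCircuit.instantiate
    rw [List.length_flatMap]
    have := List.sum_le_card_nsmul (A.steps.map fun s => (match s with
        | .gate g => [g.map (circuitWires κ A.msgLen d A.work E.anc)]
        | .query => E.gates.map (Gate.map (evalWires κ A.msgLen d A.work E.anc))).length)
      (E.gates.length + 1) (by
        intro x hx
        obtain ⟨s, _, rfl⟩ := List.mem_map.1 hx
        cases s <;> simp)
    simp only [List.length_map, smul_eq_mul] at this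
    exact this
  unfold OracleCircuit.instSize OracleCircuit.size
  nlinarith

end Instantiate

/-! ### Reversible evaluation of Boolean circuits -/

namespace BoolCircuit

variable {κ m d G : ℕ}

/-- The wires of an evaluation circuit with `G + 1` ancillas. -/
abbrev EvalWire (κ m d G : ℕ) : Type := Fin κ ⊕ QWire m d (G + 1)

/-- The ancilla that holds the value of the `i`-th gate. The ancilla `G` is never written. -/
def gateWire (κ m d G i : ℕ) : EvalWire κ m d G := .inr (.inr (.inr (Fin.ofNat (G + 1) i)))

/-- The wire that holds the `i`-th value of the straight-line program while gate `g` is evaluated.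
For an index that is out of range, it is the ancilla that is always zero. -/
def valueWire (κ m d G i g : ℕ) : EvalWire κ m d G :=
  if h : i < κ + m then
    Fin.addCases (fun a => .inl a) (fun b => .inr (.inl b)) (⟨i, h⟩ : Fin (κ + m))
  else if i < κ + m + g then gateWire κ m d G (i - (κ + m)) else gateWire κ m d G G

/-- Reversible NAND gates for the gates `l` of a straight-line program, the first of which has the
number `g`. -/
def nandGates (κ m d G : ℕ) : ℕ → List (ℕ × ℕ) → List (CGate (EvalWire κ m d G))
  | _, [] => []
  | g, (i, j) :: l =>
    CGate.tof (valueWire κ m d G i g) (valueWire κ m d G j g) (gateWire κ m d G g) ::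
      CGate.not (gateWire κ m d G g) :: nandGates κ m d G (g + 1) l

theorem length_nandGates (l : List (ℕ × ℕ)) (g : ℕ) :
    (nandGates κ m d G g l).length = 2 * l.length := by
  induction l generalizing g with
  | nil => rfl
  | cons p l ih =>
    simp only [nandGates, List.length_cons, ih]
    omega

/-- The basis state reached when the values `v` of the straight-line program are known. -/
def valueState (G : ℕ) (k : Bits κ) (x : Bits m) (y : Bits d) (v : List Bool) :
    EvalWire κ m d G → Bool :=
  Sum.elim k (Sum.elim x (Sum.elim y fun i => v.getD (κ + m + i) false))

/-- One step of a straight-line program. -/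
def nandStep (v : List Bool) (g : ℕ × ℕ) : List Bool :=
  v ++ [!(v.getD g.1 false && v.getD g.2 false)]

theorem valueState_valueWire (k : Bits κ) (x : Bits m) (y : Bits d) (w : List Bool) (g i : ℕ)
    (hw : w.length = g) (hg : g ≤ G) :
    valueState G k x y (List.ofFn (Fin.append k x) ++ w) (valueWire κ m d G i g) =
      (List.ofFn (Fin.append k x) ++ w).getD i false := by
  unfold valueWire
  split_ifs with h1 h2
  · have : (List.ofFn (Fin.append k x) ++ w).getD i false = Fin.append k x ⟨i, h1⟩ := by
      rw [List.getD_append _ _ _ _ (by simpa using h1),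
        List.getD_eq_getElem _ _ (by simpa using h1), List.getElem_ofFn]
    rw [this]
    generalize (⟨i, h1⟩ : Fin (κ + m)) = j
    refine Fin.addCases (fun a => ?_) (fun b => ?_) j
    · simp [valueState]
    · simp [valueState]
  · have : (i - (κ + m)) % (G + 1) = i - (κ + m) := Nat.mod_eq_of_lt (by omega)
    have h3 : κ + m + (i - (κ + m)) = i := by omega
    simp [valueState, gateWire, this, h3]
  · rw [List.getD_eq_default _ false (n := i) (by simp; omega)]
    simp only [valueState, gateWire, Sum.elim_inr, Fin.ofNat, Nat.mod_eq_of_lt (Nat.lt_succ_self G)]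
    rw [List.getD_eq_default]
    simp; omega

theorem valueWire_ne (i g : ℕ) (hg : g < G) :
    valueWire κ m d G i g ≠ gateWire κ m d G g := by
  unfold valueWire
  have h0 : g % (G + 1) = g := Nat.mod_eq_of_lt (by omega)
  split_ifs with h1 h2
  · generalize (⟨i, h1⟩ : Fin (κ + m)) = j
    refine Fin.addCases (fun a => ?_) (fun b => ?_) j <;> simp [gateWire]
  · have : (i - (κ + m)) % (G + 1) = i - (κ + m) := Nat.mod_eq_of_lt (by omega)
    simp only [gateWire, ne_eq, Sum.inr.injEq, Fin.ext_iff, Fin.ofNat, this, h0]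
    omega
  · simp only [gateWire, ne_eq, Sum.inr.injEq, Fin.ext_iff, Fin.ofNat, h0,
      Nat.mod_eq_of_lt (Nat.lt_succ_self G)]
    omega

/-- If the values `w` of the first `g` gates are known, the reversible gates for the gates `l`
compute the values of the straight-line program after `l`. -/
theorem run_nandGates (k : Bits κ) (x : Bits m) (y : Bits d) (l : List (ℕ × ℕ)) (w : List Bool)
    (g : ℕ) (hw : w.length = g) (hg : g + l.length ≤ G) :
    ∃ w', l.foldl nandStep (List.ofFn (Fin.append k x) ++ w) =
        List.ofFn (Fin.append k x) ++ w' ∧ w'.length = g + l.length ∧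
      CGate.run (nandGates κ m d G g l) (valueState G k x y (List.ofFn (Fin.append k x) ++ w)) =
        valueState G k x y (List.ofFn (Fin.append k x) ++ w') := by
  induction l generalizing w g with
  | nil => exact ⟨w, rfl, hw, rfl⟩
  | cons p l ih =>
    obtain ⟨i, j⟩ := p
    simp only [List.length_cons] at hg
    set u := List.ofFn (Fin.append k x) with hu
    have hul : u.length = κ + m := by simp [hu]
    set b := !((u ++ w).getD i false && (u ++ w).getD j false) with hb
    obtain ⟨w', h1, h2, h3⟩ := ih (w ++ [b]) (g + 1) (by simp [hw]) (by omega)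
    refine ⟨w', ?_, by rw [h2, List.length_cons]; omega, ?_⟩
    · rw [List.foldl_cons, ← h1, nandStep, List.append_assoc]
    · rw [← h3]
      simp only [nandGates, CGate.run_cons]
      congr 1
      have hne : valueWire κ m d G i g ≠ gateWire κ m d G g ∧
          valueWire κ m d G j g ≠ gateWire κ m d G g :=
        ⟨valueWire_ne i g (by omega), valueWire_ne j g (by omega)⟩
      have h0 : g % (G + 1) = g := Nat.mod_eq_of_lt (by omega)
      have hz : valueState G k x y (u ++ w) (gateWire κ m d G g) = false := by
        simp only [valueState, gateWire, Sum.elim_inr, Fin.ofNat, h0]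
        rw [List.getD_eq_default]
        simp [hul, hw]
      have hv : ∀ i, valueState G k x y (u ++ w) (valueWire κ m d G i g) = (u ++ w).getD i false :=
        fun i => valueState_valueWire k x y w g i hw (by omega)
      simp only [CGate.act, if_pos hne, Function.update_self, Function.update_idem, hz,
        Bool.false_xor, hv, ← hb]
      funext q
      by_cases hq : q = gateWire κ m d G g
      · subst hq
        rw [Function.update_self]
        simp only [valueState, gateWire, Sum.elim_inr, Fin.ofNat, h0]
        rw [← List.append_assoc, List.getD_append_right _ _ _ _ (by simp [hul, hw])]
        simp [hul, hw]
      · rw [Function.update_of_ne hq]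
        rcases q with q | q | q | q
        · rfl
        · rfl
        · rfl
        · simp only [valueState, Sum.elim_inr]
          have hqg : (q : ℕ) ≠ g := by
            intro h
            apply hq
            simp only [gateWire, Sum.inr.injEq, Fin.ext_iff, Fin.ofNat, h0, h]
          rw [← List.append_assoc]
          rcases lt_or_gt_of_ne hqg with h | h
          · rw [List.getD_append _ [b] _ _ (by simp [hul, hw]; omega)]
          · rw [List.getD_eq_default _ _ (by simp [hul, hw]; omega),
              List.getD_eq_default _ _ (by simp [hul, hw]; omega)]

/-- Evaluate the gates of a Boolean circuit, copy the result, and uncompute. -/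
def toEvalCircuit (C : BoolCircuit (κ + m) d) : EvalCircuit κ m d where
  anc := C.gates.length + 1
  gates := CGate.compile (CGate.conj (nandGates κ m d C.gates.length 0 C.gates)
    (CGate.copy (fun o => valueWire κ m d C.gates.length (C.out o) C.gates.length)
      (fun o => .inr (.inr (.inl o))) (List.finRange d)))

theorem length_gates_toEvalCircuit (C : BoolCircuit (κ + m) d) :
    C.toEvalCircuit.gates.length ≤ 4 * C.gates.length + d := by
  refine (CGate.length_compile_le _).trans ?_
  simp only [CGate.conj, List.length_append, List.length_reverse, length_nandGates, CGate.copy,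
    List.length_map, List.length_finRange]
  omega

theorem toEvalCircuit_implements (C : BoolCircuit (κ + m) d) (F : Bits κ → Bits m → Bits d)
    (hF : ∀ k x, C.eval (Fin.append k x) = F k x) : C.toEvalCircuit.Implements F := by
  intro k x y
  set G := C.gates.length with hG
  obtain ⟨w, h1, h2, h3⟩ := run_nandGates (G := G) k x y C.gates [] 0 rfl (by omega)
  obtain ⟨w', h1', -, h3'⟩ := run_nandGates (G := G) k x
    (fun j => xor (y j) (F k x j)) C.gates [] 0 rfl (by omega)
  have hww : w' = w := List.append_cancel_left (h1'.symm.trans h1)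
  subst hww
  rw [List.append_nil] at h1 h3 h3'
  have hstart : ∀ y : Bits d, valueState G k x y (List.ofFn (Fin.append k x)) =
      Sum.elim k (Sum.elim x (Sum.elim y fun _ => false)) := by
    intro y
    funext q
    rcases q with q | q | q | q
    · rfl
    · rfl
    · rfl
    · simp only [valueState, Sum.elim_inr]
      rw [List.getD_eq_default]
      simp
  rw [hstart] at h3 h3'
  have heval : ∀ o, (List.ofFn (Fin.append k x) ++ w').getD (C.out o) false = F k x o := by
    intro o
    rw [← hF, ← h1]
    rfl
  have hval := fun i => valueState_valueWire (G := G) k x y w' G i (by omega) le_rfl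
  have hcopy : CGate.run (CGate.copy (fun o => valueWire κ m d G (C.out o) G)
      (fun o => (.inr (.inr (.inl o)) : EvalWire κ m d G)) (List.finRange d))
      (valueState G k x y (List.ofFn (Fin.append k x) ++ w')) =
      valueState G k x (fun j => xor (y j) (F k x j)) (List.ofFn (Fin.append k x) ++ w') := by
    have hinj : Function.Injective fun o => (.inr (.inr (.inl o)) : EvalWire κ m d G) := by
      intro a b h
      simpa using h
    rw [CGate.run_copy_finRange _ _ hinj]
    · funext q
      by_cases hq : ∃ o, (.inr (.inr (.inl o)) : EvalWire κ m d G) = q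
      · obtain ⟨o, rfl⟩ := hq
        rw [hinj.extend_apply (g := fun j => _), hval, heval]
        rfl
      · rw [Function.extend_apply' _ _ _ hq]
        rcases q with q | q | q | q
        · rfl
        · rfl
        · exact (hq ⟨q, rfl⟩).elim
        · rfl
    · intro i j
      unfold valueWire
      split_ifs with h1 h2
      · generalize (⟨C.out i, h1⟩ : Fin (κ + m)) = j
        refine Fin.addCases (fun a => ?_) (fun b => ?_) j <;> simp
      · simp [gateWire]
      · simp [gateWire]
  refine (CGate.runGates_compile_ket _ _).trans ?_
  congr 1
  refine (CGate.run_conj _ _ _).trans ?_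
  refine (congrArg _ (congrArg _ h3)).trans ?_
  refine (congrArg _ hcopy).trans ?_
  rw [← h3']
  exact CGate.run_reverse_run _ _

end BoolCircuit

/-! ### The collision stage -/

section Protocol

theorem PMF_tsum_bind_mul {α β : Type} (p : PMF α) (f : α → PMF β) (g : β → ℝ≥0∞) :
    ∑' b, (p.bind f) b * g b = ∑' a, p a * ∑' b, f a b * g b := by
  simp only [PMF.bind_apply, ← ENNReal.tsum_mul_right, ← ENNReal.tsum_mul_left]
  rw [ENNReal.tsum_comm]
  simp only [mul_assoc]

theorem PMF_tsum_map_mul {α β : Type} (p : PMF α) (f : α → β) (g : β → ℝ≥0∞) :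
    ∑' b, (p.map f) b * g b = ∑' a, p a * g (f a) := by
  rw [PMF.map, PMF_tsum_bind_mul]
  refine tsum_congr fun a => ?_
  congr 1
  rw [tsum_eq_single (f a)]
  · simp
  · intro b hb
    simp [hb]

theorem collCount_append {κ n : ℕ} (eval : Bits κ → Str → Bits n) (ℓ : ℕ) (t : CollTranscript κ)
    (e : Bits κ × Reply) [Decidable (RoundWon eval ℓ e)] :
    collCount eval ℓ (t ++ [e]) = collCount eval ℓ t + if RoundWon eval ℓ e then 1 else 0 := by
  unfold collCount
  rw [List.countP_append]
  congr 1
  by_cases h : RoundWon eval ℓ e <;> simp [h]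

/-- The expectation of `c ^ [a ∈ S]`, for `c ≤ 1` and an event `S` of probability above `1 / 2`. -/
theorem tsum_mul_ite_le_of_half_lt {α : Type} (p : PMF α) (S : Set α) [DecidablePred (· ∈ S)]
    (hp : 1 / 2 < p.toOuterMeasure S) (c : ℝ≥0∞) (hc : c ≤ 1) :
    ∑' a, p a * (if a ∈ S then c else 1) ≤ (1 + c) / 2 := by
  have h1 : ∑' a, p a * (if a ∈ S then c else 1) =
      p.toOuterMeasure S * c + p.toOuterMeasure Sᶜ := by
    rw [PMF.toOuterMeasure_apply, PMF.toOuterMeasure_apply, ← ENNReal.tsum_mul_right,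
      ← ENNReal.tsum_add]
    refine tsum_congr fun a => ?_
    by_cases ha : a ∈ S <;> simp [ha]
  have h2 : p.toOuterMeasure S + p.toOuterMeasure Sᶜ = 1 := by
    rw [PMF.toOuterMeasure_apply, PMF.toOuterMeasure_apply, ← ENNReal.tsum_add, ← p.tsum_coe]
    refine tsum_congr fun a => ?_
    by_cases ha : a ∈ S <;> simp [ha]
  obtain ⟨δ, hδ⟩ := exists_add_of_le hp.le
  rw [h1, hδ]
  rw [hδ] at h2
  have h3 : δ + p.toOuterMeasure Sᶜ = 1 / 2 := by
    have h4 : (1 / 2 : ℝ≥0∞) + (δ + p.toOuterMeasure Sᶜ) = 1 / 2 + 1 / 2 := by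
      rw [← add_assoc, h2, ENNReal.add_halves]
    exact (ENNReal.add_right_inj (by simp)).1 h4
  calc (1 / 2 + δ) * c + p.toOuterMeasure Sᶜ ≤ (1 / 2 * c + δ * 1) + p.toOuterMeasure Sᶜ := by
        rw [add_mul]
        gcongr
    _ = (1 + c) / 2 := by
        rw [mul_one, add_assoc, h3, ENNReal.add_div, add_comm, ENNReal.div_eq_inv_mul (a := c),
          one_div]

variable {κ m n : ℕ} (ℓ : ℕ) (kgen : PMF (Bits κ)) (eval : Bits κ → Str → Bits n) (α : ℝ) (q : ℕ)
  (out : Bits κ → PMF (Bits m × Bits m))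

/-- Bound for the expectation of `c ^ w`, where `w` is the number of rounds won. The bound for a
single round holds for every key and every past, so that it can be applied round by round. -/
theorem tsum_collisionStage_le (hq : (q : ℝ) / α ≤ deadline ℓ)
    (hout : ∀ k, 1 / 2 < (out k).toOuterMeasure
      {M | NearCollision (eval k) ℓ (List.ofFn M.1) (List.ofFn M.2)})
    (c : ℝ≥0∞) (hc : c ≤ 1) (pk : Str) (j : ℕ) (t : CollTranscript κ) :
    ∑' t', collisionStage kgen (impersonator α q out pk) j t t' * c ^ collCount eval ℓ t' ≤
      ((1 + c) / 2) ^ j * c ^ collCount eval ℓ t := by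
  classical
  induction j generalizing t with
  | zero =>
    rw [tsum_eq_single t]
    · simp [collisionStage]
    · intro t' ht'
      simp [collisionStage, ht']
  | succ j ih =>
    simp only [collisionStage]
    rw [PMF_tsum_bind_mul]
    have hk : ∀ k, ∑' t', (((impersonator α q out pk).collide t k).bind fun a =>
        collisionStage kgen (impersonator α q out pk) j (t ++ [(k, a)])) t' *
          c ^ collCount eval ℓ t' ≤ ((1 + c) / 2) ^ (j + 1) * c ^ collCount eval ℓ t := by
      intro k
      rw [PMF_tsum_bind_mul]
      refine (ENNReal.tsum_le_tsum fun a => mul_le_mul_right (ih _) _).trans ?_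
      simp only [impersonator]
      rw [PMF_tsum_map_mul]
      have hM : ∀ M : Bits m × Bits m, c ^ collCount eval ℓ
          (t ++ [(k, (⟨List.ofFn M.1, List.ofFn M.2, q / α⟩ : Reply))]) =
          (if M ∈ {M : Bits m × Bits m |
            NearCollision (eval k) ℓ (List.ofFn M.1) (List.ofFn M.2)} then c else 1) *
            c ^ collCount eval ℓ t := by
        intro M
        rw [collCount_append, pow_add, mul_comm]
        congr 1
        simp only [RoundWon, hq, true_and, Set.mem_ofPred_eq]
        split <;> simp
      simp only [hM]
      have := tsum_mul_ite_le_of_half_lt (out k) _ (hout k) c hc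
      calc _ = ((1 + c) / 2) ^ j * c ^ collCount eval ℓ t * ∑' M, out k M *
            (if M ∈ {M : Bits m × Bits m |
              NearCollision (eval k) ℓ (List.ofFn M.1) (List.ofFn M.2)} then c else 1) := by
            rw [← ENNReal.tsum_mul_left]
            refine tsum_congr fun M => ?_
            ring
        _ ≤ ((1 + c) / 2) ^ j * c ^ collCount eval ℓ t * ((1 + c) / 2) := by gcongr
        _ = _ := by ring
    calc _ ≤ ∑' k, kgen k * (((1 + c) / 2) ^ (j + 1) * c ^ collCount eval ℓ t) :=
          ENNReal.tsum_le_tsum fun k => mul_le_mul_right (hk k) _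
      _ = _ := by rw [ENNReal.tsum_mul_right, kgen.tsum_coe, one_mul]

/-- Chernoff bound: an impersonator that wins every round with probability more than `1 / 2` wins
more than a quarter of the rounds, except with probability at most `exp (-r / 16)`. -/
theorem le_impersonationProb (hq : (q : ℝ) / α ≤ deadline ℓ)
    (hout : ∀ k, 1 / 2 < (out k).toOuterMeasure
      {M | NearCollision (eval k) ℓ (List.ofFn M.1) (List.ofFn M.2)})
    (IS : IdentScheme) (r : ℕ) :
    ENNReal.ofReal (1 - Real.exp (-(r : ℝ) / 16)) ≤
      impersonationProb IS n ℓ r kgen eval (impersonator α q out) := by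
  -- With `c = exp (-1)`, the moment is at most `exp (-5 / 16) ^ r`, and losing costs
  -- `exp (r / 4)`.
  set c : ℝ≥0∞ := ENNReal.ofReal (Real.exp (-1)) with hcdef
  have hc : c ≤ 1 := by
    rw [hcdef, ENNReal.ofReal_le_one, Real.exp_le_one_iff]
    norm_num
  set ε : ℝ≥0∞ := ENNReal.ofReal (Real.exp (-(r : ℝ) / 16)) with hε
  have hρ : (1 + c) / 2 ≤ ENNReal.ofReal (Real.exp (-(5 / 16))) := by
    have h1 : (1 + c) / 2 = ENNReal.ofReal ((1 + Real.exp (-1)) / 2) := by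
      rw [ENNReal.ofReal_div_of_pos (by norm_num), ENNReal.ofReal_add (by norm_num) (by positivity)]
      simp [hcdef]
    rw [h1]
    apply ENNReal.ofReal_le_ofReal
    have h2 : Real.exp (-1) ≤ 0.37 := by
      rw [Real.exp_neg, inv_le_comm₀ (Real.exp_pos 1) (by norm_num)]
      have := Real.exp_one_gt_d9
      norm_num at this ⊢
      linarith
    have h3 := Real.add_one_le_exp (-(5 / 16) : ℝ)
    linarith
  have hfalse : ∀ pk, verifierOutput IS n ℓ r kgen eval pk (impersonator α q out pk) false ≤ ε := by
    intro pk
    unfold verifierOutput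
    rw [PMF.bind_apply]
    calc _ ≤ ∑' t, collisionStage kgen (impersonator α q out pk) r [] t *
            (c ^ collCount eval ℓ t * ENNReal.ofReal (Real.exp ((r : ℝ) / 4))) := by
          refine ENNReal.tsum_le_tsum fun t => mul_le_mul_right ?_ _
          by_cases ht : r < 4 * collCount eval ℓ t
          · refine le_of_eq_of_le ?_ zero_le
            simp [PMF.bind_apply, ht]
          · refine (PMF.coe_le_one _ _).trans ?_
            rw [hcdef, ← ENNReal.ofReal_pow (Real.exp_pos _).le, ← Real.exp_nat_mul,
              ← ENNReal.ofReal_mul (Real.exp_pos _).le, ← Real.exp_add, ENNReal.one_le_ofReal,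
              Real.one_le_exp_iff]
            have : (4 * collCount eval ℓ t : ℝ) ≤ r := by exact_mod_cast not_lt.1 ht
            linarith
      _ = (∑' t, collisionStage kgen (impersonator α q out pk) r [] t * c ^ collCount eval ℓ t) *
            ENNReal.ofReal (Real.exp ((r : ℝ) / 4)) := by
          rw [← ENNReal.tsum_mul_right]
          refine tsum_congr fun t => ?_
          ring
      _ ≤ (ENNReal.ofReal (Real.exp (-(5 / 16)))) ^ r * 1 *
            ENNReal.ofReal (Real.exp ((r : ℝ) / 4)) := by
          gcongr
          refine (tsum_collisionStage_le ℓ kgen eval α q out hq hout c hc pk r []).trans ?_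
          gcongr
          simp [collCount]
      _ = ε := by
          rw [mul_one, ← ENNReal.ofReal_pow (Real.exp_pos _).le, ← Real.exp_nat_mul,
            ← ENNReal.ofReal_mul (Real.exp_pos _).le, ← Real.exp_add, hε]
          congr 2
          ring
  have hF : ((IS.keyGen n).bind fun key =>
      verifierOutput IS n ℓ r kgen eval key.2 (impersonator α q out key.2)) false ≤ ε := by
    rw [PMF.bind_apply]
    calc _ ≤ ∑' key, IS.keyGen n key * ε :=
          ENNReal.tsum_le_tsum fun key => mul_le_mul_right (hfalse key.2) _
      _ = ε := by rw [ENNReal.tsum_mul_right, PMF.tsum_coe, one_mul]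
  have hsum := ((IS.keyGen n).bind fun key =>
      verifierOutput IS n ℓ r kgen eval key.2 (impersonator α q out key.2)).tsum_coe
  rw [tsum_fintype, Fintype.sum_bool] at hsum
  rw [ENNReal.ofReal_sub _ (Real.exp_pos _).le, ENNReal.ofReal_one, tsub_le_iff_right, ← hε]
  unfold impersonationProb
  rw [← hsum]
  gcongr

theorem impersonationProb_le_one (IS : IdentScheme) (r : ℕ) (P : Str → ProverStrategy κ) :
    impersonationProb IS n ℓ r kgen eval P ≤ 1 := PMF.coe_le_one _ _

end Protocol

theorem not_negligible_of_eventually_le (ε : ℕ → ℝ) (c : ℝ) (hc : 0 < c)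
    (h : ∀ᶠ n in Filter.atTop, c ≤ ε n) : ¬ Negligible ε := by
  intro hn
  have h1 := hn (Polynomial.C c⁻¹) (Filter.Eventually.of_forall fun n => by simpa using hc)
  obtain ⟨n, h2, h3⟩ := (h1.and h).exists
  simp only [Polynomial.eval_C, inv_inv] at h2
  linarith

theorem not_negligible_of_le (p : ℕ → ℝ≥0∞) (P : Params) (hp : ∀ n, p n ≤ 1)
    (h : ∀ n, 2 ^ P.ell n ≤ n →
      ENNReal.ofReal (1 - Real.exp (-(P.rounds n : ℝ) / 16)) ≤ p n) :
    ¬ Negligible fun n => (p n).toReal := by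
  have h16 : Real.exp (-1 / 16) < 1 := by
    rw [Real.exp_lt_one_iff]
    norm_num
  refine not_negligible_of_eventually_le _ (1 - Real.exp (-1 / 16)) (by linarith) ?_
  filter_upwards [P.ell_le, P.rounds_pos] with n h1 h2
  have h3 := h n h1
  have h4 : Real.exp (-(P.rounds n : ℝ) / 16) ≤ Real.exp (-1 / 16) := by
    apply Real.exp_le_exp.2
    have : (1 : ℝ) ≤ P.rounds n := by exact_mod_cast h2
    linarith
  have h5 := (ENNReal.ofReal_le_iff_le_toReal ((hp n).trans_lt ENNReal.one_lt_top).ne).1 h3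
  linarith

/-! ### Collision finding with classical queries -/

namespace QueryAlg

variable {X Y R : Type}

/-- The points queried when the oracle is `h`. -/
def queried [DecidableEq X] (h : X → Y) : QueryAlg X Y R → Finset X
  | done _ => ∅
  | query x next => insert x (queried h (next (h x)))

/-- The algorithm that also queries the two points that it outputs. -/
def queryOutput : QueryAlg X Y (X × X) → QueryAlg X Y (X × X)
  | done a => query a.1 fun _ => query a.2 fun _ => done a
  | query x next => query x fun y => queryOutput (next y)

theorem queriesAtMost_queryOutput (A : QueryAlg X Y (X × X)) (q : ℕ) (h : A.QueriesAtMost q) :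
    A.queryOutput.QueriesAtMost (q + 2) := by
  induction A generalizing q with
  | done a => exact fun _ _ => by cases q <;> trivial
  | query x next ih =>
    cases q with
    | zero => exact h.elim
    | succ q => exact fun y => ih y q (h y)

theorem run_mem_queried [DecidableEq X] (A : QueryAlg X Y (X × X)) (h : X → Y) :
    (A.run h).1 ∈ A.queryOutput.queried h ∧ (A.run h).2 ∈ A.queryOutput.queried h := by
  induction A with
  | done a => simp [run, queryOutput, queried]
  | query x next ih =>
    simp only [run, queryOutput, queried]
    exact ⟨Finset.mem_insert_of_mem (ih (h x)).1, Finset.mem_insert_of_mem (ih (h x)).2⟩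

end QueryAlg

section Birthday

variable {X : Type} [Fintype X] [DecidableEq X] {n : ℕ}

/-- Some two elements of `S` form a near-collision. -/
def CollidesOn (ω : X → Bits n) (ℓ : ℕ) (S : Finset X) : Prop :=
  ∃ a ∈ S, ∃ b ∈ S, NearCollision ω ℓ a b

/-- The functions that agree with `v` on `S`. -/
def agreeing (S : Finset X) (v : X → Bits n) : Finset (X → Bits n) :=
  Finset.univ.filter fun ω => ∀ x ∈ S, ω x = v x

/-- At most a fraction `2 ^ (-ℓ)` of the strings has a given prefix of length `ℓ`. -/
theorem card_filter_prefix_mul_le (ℓ : ℕ) (hℓ : ℓ ≤ n) (w : Bits n) :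
    (Finset.univ.filter fun y : Bits n => ∀ i : Fin n, (i : ℕ) < ℓ → y i = w i).card * 2 ^ ℓ ≤
      2 ^ n := by
  classical
  set T := Finset.univ.filter fun y : Bits n => ∀ i : Fin n, (i : ℕ) < ℓ → y i = w i with hT
  have h1 : (T ×ˢ (Finset.univ : Finset (Fin ℓ → Bool))).card = T.card * 2 ^ ℓ := by
    simp [Finset.card_product]
  have h2 : (Finset.univ : Finset (Bits n)).card = 2 ^ n := by simp
  rw [← h1, ← h2]
  refine Finset.card_le_card_of_injOn
    (fun p i => if h : (i : ℕ) < ℓ then p.2 ⟨i, h⟩ else p.1 i) (fun _ _ => Finset.mem_univ _) ?_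
  rintro ⟨y, u⟩ hy ⟨y', u'⟩ hy' h
  simp only [Finset.coe_product, Set.mem_prod, Finset.mem_coe, hT, Finset.mem_filter,
    Finset.mem_univ, true_and] at hy hy'
  ext i
  · have := congrFun h i
    by_cases hi : (i : ℕ) < ℓ
    · simp [hy.1 i hi, hy'.1 i hi]
    · simp only [hi, dite_false] at this
      simp [this]
  · have := congrFun h ⟨i, by omega⟩
    simp only [i.2, dite_true] at this
    simp [this]

theorem agreeing_insert (S : Finset X) (v : X → Bits n) (x : X) (hx : x ∉ S) (y : Bits n) :
    agreeing (insert x S) (Function.update v x y) = (agreeing S v).filter fun ω => ω x = y := by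
  ext ω
  simp only [agreeing, Finset.mem_filter, Finset.mem_univ, true_and, Finset.mem_insert,
    forall_eq_or_imp, Function.update_self]
  have : (∀ z ∈ S, ω z = Function.update v x y z) ↔ ∀ z ∈ S, ω z = v z := by
    refine forall₂_congr fun z hz => ?_
    rw [Function.update_of_ne (ne_of_mem_of_not_mem hz hx)]
  rw [this]
  tauto

theorem card_agreeing_insert (S : Finset X) (v : X → Bits n) (x : X) (hx : x ∉ S) (y y' : Bits n) :
    (agreeing (insert x S) (Function.update v x y)).card =
      (agreeing (insert x S) (Function.update v x y')).card := by
  rw [agreeing_insert S v x hx, agreeing_insert S v x hx]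
  have h : ∀ y y' : Bits n, ∀ ω ∈ (agreeing S v).filter fun ω => ω x = y,
      Function.update ω x y' ∈ (agreeing S v).filter fun ω => ω x = y' := by
    intro y y' ω hω
    simp only [agreeing, Finset.mem_filter, Finset.mem_univ, true_and, Function.update_self,
      and_true] at hω ⊢
    intro z hz
    rw [Function.update_of_ne (ne_of_mem_of_not_mem hz hx), hω.1 z hz]
  refine Finset.card_bij' (fun ω _ => Function.update ω x y') (fun ω _ => Function.update ω x y)
    (h y y') (h y' y) ?_ ?_
  · intro ω hω
    rw [Function.update_idem, ← (Finset.mem_filter.1 hω).2, Function.update_eq_self]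
  · intro ω hω
    rw [Function.update_idem, ← (Finset.mem_filter.1 hω).2, Function.update_eq_self]

/-- Birthday bound, by lazy sampling: if the values on `S` are known and do not collide, each of
the `q` queries creates a near-collision with probability at most `(|S| + q) / 2 ^ ℓ`. -/
theorem card_filter_collidesOn_mul_le {R : Type} (ℓ : ℕ) (hℓ : ℓ ≤ n)
    (A : QueryAlg X (Bits n) R) (q : ℕ) (hA : A.QueriesAtMost q) (S : Finset X) (v : X → Bits n)
    (hv : ¬ CollidesOn v ℓ S) [DecidablePred fun ω => CollidesOn ω ℓ (S ∪ A.queried ω)] :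
    ((agreeing S v).filter fun ω => CollidesOn ω ℓ (S ∪ A.queried ω)).card * 2 ^ ℓ ≤
      (agreeing S v).card * (q * (S.card + q)) := by
  classical
  induction A generalizing q S v with
  | done a =>
    rw [Finset.filter_eq_empty_iff.2]
    · simp
    · intro ω hω
      simp only [QueryAlg.queried, Finset.union_empty]
      rintro ⟨a, ha, b, hb, hne, hab⟩
      simp only [agreeing, Finset.mem_filter, Finset.mem_univ, true_and] at hω
      exact hv ⟨a, ha, b, hb, hne, fun i hi => by rw [← hω a ha, ← hω b hb]; exact hab i hi⟩
  | query x next ih =>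
    cases q with
    | zero => exact hA.elim
    | succ q =>
      by_cases hx : x ∈ S
      · have h1 : ((agreeing S v).filter fun ω =>
            CollidesOn ω ℓ (S ∪ (QueryAlg.query x next).queried ω)) =
            (agreeing S v).filter fun ω => CollidesOn ω ℓ (S ∪ (next (v x)).queried ω) := by
          refine Finset.filter_congr fun ω hω => ?_
          simp only [agreeing, Finset.mem_filter, Finset.mem_univ, true_and] at hω
          simp only [QueryAlg.queried, Finset.union_insert, hω x hx]
          rw [Finset.insert_eq_of_mem (Finset.mem_union_left _ hx)]
        rw [h1]
        refine (ih (v x) q (hA (v x)) S v hv).trans (Nat.mul_le_mul_left _ ?_)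
        nlinarith
      · set C := (agreeing (insert x S) (Function.update v x (v x))).card with hC
        have hCy : ∀ y, (agreeing (insert x S) (Function.update v x y)).card = C :=
          fun y => card_agreeing_insert S v x hx y (v x)
        have htot : (agreeing S v).card = 2 ^ n * C := by
          rw [Finset.card_eq_sum_card_fiberwise (f := fun ω => ω x) (t := Finset.univ)
            (fun _ _ => Finset.mem_coe.2 (Finset.mem_univ _))]
          simp only [← agreeing_insert S v x hx, hCy]
          simp
        set bad := Finset.univ.filter fun y : Bits n =>
          ∃ z ∈ S, ∀ i : Fin n, (i : ℕ) < ℓ → y i = v z i with hbad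
        have hbadcard : bad.card * 2 ^ ℓ ≤ S.card * 2 ^ n := by
          have : bad ⊆ S.biUnion fun z => Finset.univ.filter fun y : Bits n =>
              ∀ i : Fin n, (i : ℕ) < ℓ → y i = v z i := by
            intro y hy
            simpa [hbad] using hy
          refine (Nat.mul_le_mul_right _ ((Finset.card_le_card this).trans
            Finset.card_biUnion_le)).trans ?_
          rw [Finset.sum_mul, ← smul_eq_mul]
          exact Finset.sum_le_card_nsmul _ _ _ fun z _ => card_filter_prefix_mul_le ℓ hℓ (v z)
        have hstep : ∀ y, (((agreeing S v).filter fun ω => CollidesOn ω ℓ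
            (S ∪ (QueryAlg.query x next).queried ω)).filter fun ω => ω x = y).card * 2 ^ ℓ ≤
            C * ((if y ∈ bad then 2 ^ ℓ else 0) + q * (S.card + 1 + q)) := by
          intro y
          have hsub : (((agreeing S v).filter fun ω => CollidesOn ω ℓ
              (S ∪ (QueryAlg.query x next).queried ω)).filter fun ω => ω x = y) ⊆
              (agreeing (insert x S) (Function.update v x y)).filter fun ω =>
                CollidesOn ω ℓ (insert x S ∪ (next y).queried ω) := by
            intro ω hω
            rw [agreeing_insert S v x hx]
            rw [Finset.mem_filter, Finset.mem_filter] at hω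
            rw [Finset.mem_filter, Finset.mem_filter]
            refine ⟨⟨hω.1.1, hω.2⟩, ?_⟩
            have := hω.1.2
            rwa [QueryAlg.queried, hω.2, Finset.union_insert, ← Finset.insert_union] at this
          by_cases hy : y ∈ bad
          · rw [if_pos hy, mul_add]
            refine (Nat.mul_le_mul_right _ ((Finset.card_le_card hsub).trans
              (Finset.card_filter_le _ _))).trans ?_
            rw [hCy]
            exact Nat.le_add_right _ _
          · rw [if_neg hy, zero_add]
            have hv' : ¬ CollidesOn (Function.update v x y) ℓ (insert x S) := by
              rintro ⟨a, ha, b, hb, hne, hab⟩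
              have hSx : ∀ z ∈ S, Function.update v x y z = v z := fun z hz =>
                Function.update_of_ne (ne_of_mem_of_not_mem hz hx) _ _
              rcases Finset.mem_insert.1 ha with rfl | ha' <;>
                rcases Finset.mem_insert.1 hb with rfl | hb'
              · exact hne rfl
              · refine hy (Finset.mem_filter.2 ⟨Finset.mem_univ _, b, hb', fun i hi => ?_⟩)
                have := hab i hi
                rwa [Function.update_self, hSx b hb'] at this
              · refine hy (Finset.mem_filter.2 ⟨Finset.mem_univ _, a, ha', fun i hi => ?_⟩)
                have := hab i hi
                rw [Function.update_self, hSx a ha'] at this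
                exact this.symm
              · refine hv ⟨a, ha', b, hb', hne, fun i hi => ?_⟩
                rw [← hSx a ha', ← hSx b hb']
                exact hab i hi
            refine (Nat.mul_le_mul_right _ (Finset.card_le_card hsub)).trans ?_
            refine (ih y q (hA y) (insert x S) _ hv').trans ?_
            rw [hCy, Finset.card_insert_of_notMem hx]
        rw [Finset.card_eq_sum_card_fiberwise (f := fun ω => ω x) (t := Finset.univ)
            (fun _ _ => Finset.mem_coe.2 (Finset.mem_univ _)), Finset.sum_mul]
        refine (Finset.sum_le_sum fun y _ => hstep y).trans ?_
        rw [← Finset.mul_sum, Finset.sum_add_distrib, htot, ← Finset.sum_filter,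
          Finset.sum_const, Finset.sum_const, Finset.filter_mem_eq_inter, Finset.univ_inter,
          smul_eq_mul, smul_eq_mul, Finset.card_univ, Fintype.card_fun, Fintype.card_bool,
          Fintype.card_fin, mul_comm (2 ^ n) C, mul_assoc]
        refine Nat.mul_le_mul_left _ ?_
        refine (Nat.add_le_add_right hbadcard _).trans ?_
        rw [mul_comm S.card, ← mul_add]
        refine Nat.mul_le_mul_left _ ?_
        nlinarith

/-- An algorithm with `q` queries finds a near-collision with probability at most
`(q + 2) ^ 2 / 2 ^ ℓ`: its output may be assumed to consist of points that were queried. -/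
theorem card_filter_nearCollision_mul_le (ℓ : ℕ) (hℓ : ℓ ≤ n)
    (A : QueryAlg X (Bits n) (X × X)) (q : ℕ) (hA : A.QueriesAtMost q)
    [DecidablePred fun ω => NearCollision ω ℓ (A.run ω).1 (A.run ω).2] :
    (Finset.univ.filter fun ω => NearCollision ω ℓ (A.run ω).1 (A.run ω).2).card * 2 ^ ℓ ≤
      Fintype.card (X → Bits n) * (q + 2) ^ 2 := by
  classical
  have h := card_filter_collidesOn_mul_le ℓ hℓ A.queryOutput (q + 2)
    (A.queriesAtMost_queryOutput q hA) ∅ (fun _ _ => false) (by simp [CollidesOn])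
  have hag : agreeing ∅ (fun _ _ => false : X → Bits n) = Finset.univ := by simp [agreeing]
  rw [hag, Finset.card_empty, zero_add, ← pow_two, Finset.card_univ] at h
  refine le_trans (Nat.mul_le_mul_right _ (Finset.card_le_card ?_)) h
  intro ω hω
  rw [Finset.mem_filter] at hω ⊢
  refine ⟨Finset.mem_univ _, _, ?_, _, ?_, hω.2⟩
  · rw [Finset.empty_union]
    exact (A.run_mem_queried ω).1
  · rw [Finset.empty_union]
    exact (A.run_mem_queried ω).2

end Birthday

section Rounds

variable {X : Type} {n : ℕ}

theorem classicalCollCount_succ {r : ℕ} (ℓ : ℕ)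
    (B : List (X → Bits n) → QueryAlg X (Bits n) (X × X)) (h : Fin r → X → Bits n)
    (ω : X → Bits n) (H : Fin (r + 1) → X → Bits n) (hH : ∀ i : Fin r, H i.castSucc = h i)
    (hω : H (Fin.last r) = ω)
    [Decidable (NearCollision ω ℓ ((B (List.ofFn h)).run ω).1 ((B (List.ofFn h)).run ω).2)] :
    classicalCollCount ℓ B H = classicalCollCount ℓ B h +
      if NearCollision ω ℓ ((B (List.ofFn h)).run ω).1 ((B (List.ofFn h)).run ω).2
        then 1 else 0 := by
  have hlist : List.ofFn H = List.ofFn h ++ [ω] := by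
    rw [List.ofFn_succ', List.concat_eq_append]
    simp only [hH, hω]
  have hinit : ∀ i : Fin r, (List.ofFn H).take i = (List.ofFn h).take i := by
    intro i
    rw [hlist, List.take_append_of_le_length (by simp [i.2.le])]
  have hlast : (List.ofFn H).take r = List.ofFn h := by
    rw [hlist, List.take_append_of_le_length (by simp), List.take_of_length_le (by simp)]
  unfold classicalCollCount
  simp only [Finset.card_filter]
  rw [Fin.sum_univ_castSucc]
  simp only [Fin.val_castSucc, Fin.val_last, hlast, hω]
  congr 1
  refine Finset.sum_congr rfl fun i _ => ?_
  classical
  refine if_congr ?_ rfl rfl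
  rw [hH i, hinit i]

variable [Fintype X] [DecidableEq X]

/-- The exponential moment of the number of rounds won. For given oracles of the earlier rounds, the
oracle of the last round is uniform, and the birthday bound applies to it. -/
theorem sum_exp_classicalCollCount_le (ℓ q : ℕ) (hℓ : ℓ ≤ n)
    (B : List (X → Bits n) → QueryAlg X (Bits n) (X × X)) (hB : ∀ past, (B past).QueriesAtMost q)
    (δ : ℝ) (hδ : ((q : ℝ) + 2) ^ 2 / 2 ^ ℓ ≤ δ) (r : ℕ) :
    ∑ h : Fin r → X → Bits n, Real.exp (classicalCollCount ℓ B h) ≤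
      (Fintype.card (X → Bits n) * (1 + δ * (Real.exp 1 - 1))) ^ r := by
  classical
  have he : 0 ≤ Real.exp 1 - 1 := by
    have := Real.add_one_le_exp (1 : ℝ)
    linarith
  have hδ0 : 0 ≤ δ := le_trans (by positivity) hδ
  induction r with
  | zero => simp [classicalCollCount]
  | succ r ih =>
    rw [← Equiv.sum_comp (Fin.snocEquiv fun _ => X → Bits n), Fintype.sum_prod_type_right]
    have hin : ∀ h : Fin r → X → Bits n, ∑ ω : X → Bits n, Real.exp (classicalCollCount ℓ B
        (Fin.snocEquiv (fun _ => X → Bits n) (ω, h))) ≤ Real.exp (classicalCollCount ℓ B h) *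
          (Fintype.card (X → Bits n) * (1 + δ * (Real.exp 1 - 1))) := by
      intro h
      have h1 : ∀ ω : X → Bits n, Real.exp (classicalCollCount ℓ B
          (Fin.snocEquiv (fun _ => X → Bits n) (ω, h))) = Real.exp (classicalCollCount ℓ B h) *
          (1 + if NearCollision ω ℓ ((B (List.ofFn h)).run ω).1 ((B (List.ofFn h)).run ω).2
            then Real.exp 1 - 1 else 0) := by
        intro ω
        rw [classicalCollCount_succ ℓ B h ω _ (fun i => by simp) (by simp), Nat.cast_add,
          Real.exp_add]
        congr 1
        split <;> simp
      simp only [h1]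
      rw [← Finset.mul_sum, Finset.sum_add_distrib, ← Finset.sum_filter]
      refine mul_le_mul_of_nonneg_left ?_ (Real.exp_pos _).le
      have h2 := card_filter_nearCollision_mul_le ℓ hℓ (B (List.ofFn h)) q (hB _)
      have h3 : ((Finset.univ.filter fun ω => NearCollision ω ℓ ((B (List.ofFn h)).run ω).1
          ((B (List.ofFn h)).run ω).2).card : ℝ) ≤ Fintype.card (X → Bits n) * δ := by
        refine le_trans ?_ (mul_le_mul_of_nonneg_left hδ (by positivity))
        rw [mul_div_assoc', le_div_iff₀ (by positivity)]
        exact_mod_cast h2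
      rw [Finset.sum_const, Finset.sum_const, nsmul_eq_mul, nsmul_eq_mul, Finset.card_univ]
      nlinarith
    refine (Finset.sum_le_sum fun h _ => hin h).trans ?_
    rw [← Finset.sum_mul, pow_succ]
    refine mul_le_mul_of_nonneg_right ih ?_
    positivity

/-- If a round is won with probability at most `3/32`, more than a quarter of the rounds are won
with exponentially small probability only. -/
theorem toOuterMeasure_classicalCollCount_le (ℓ q : ℕ) (hℓ : ℓ ≤ n)
    (B : List (X → Bits n) → QueryAlg X (Bits n) (X × X)) (hB : ∀ past, (B past).QueriesAtMost q)
    (hδ : ((q : ℝ) + 2) ^ 2 / 2 ^ ℓ ≤ 3 / 32) (r : ℕ) :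
    (PMF.uniformOfFintype (Fin r → X → Bits n)).toOuterMeasure
        {h | r < 4 * classicalCollCount ℓ B h} ≤
      ENNReal.ofReal (Real.exp (-(r : ℝ) / 16)) := by
  classical
  have hsum := sum_exp_classicalCollCount_le ℓ q hℓ B hB _ hδ r
  set N := Fintype.card (X → Bits n) with hN
  have hNpos : 0 < N := Fintype.card_pos
  set T := Finset.univ.filter fun h : Fin r → X → Bits n =>
    r < 4 * classicalCollCount ℓ B h with hT
  have hcard : (T.card : ℝ) ≤ Real.exp (-(r : ℝ) / 16) * (N : ℝ) ^ r := by
    have h1 : (T.card : ℝ) * Real.exp ((r : ℝ) / 4) ≤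
        ∑ h : Fin r → X → Bits n, Real.exp (classicalCollCount ℓ B h) := by
      rw [← nsmul_eq_mul]
      refine (Finset.card_nsmul_le_sum T _ _ fun h hh => ?_).trans
        (Finset.sum_le_sum_of_subset_of_nonneg (Finset.subset_univ T)
          fun h _ _ => (Real.exp_pos (classicalCollCount ℓ B h)).le)
      rw [Real.exp_le_exp]
      have : (r : ℝ) < 4 * classicalCollCount ℓ B h := by exact_mod_cast (Finset.mem_filter.1 hh).2
      linarith
    have h2 : (1 + 3 / 32 * (Real.exp 1 - 1)) ≤ Real.exp (3 / 16) := by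
      have h3 := Real.exp_one_lt_d9
      have h4 := Real.add_one_le_exp (3 / 16 : ℝ)
      norm_num at h3
      linarith
    have h3 : (T.card : ℝ) * Real.exp ((r : ℝ) / 4) ≤ (N : ℝ) ^ r * Real.exp (3 / 16) ^ r := by
      refine h1.trans (hsum.trans ?_)
      rw [← mul_pow]
      refine pow_le_pow_left₀ ?_ (mul_le_mul_of_nonneg_left h2 (by positivity)) _
      have := Real.add_one_le_exp (1 : ℝ)
      have : 0 ≤ Real.exp 1 - 1 := by linarith
      positivity
    rw [← Real.exp_nat_mul] at h3
    have h4 : Real.exp (-(r : ℝ) / 16) * (N : ℝ) ^ r * Real.exp ((r : ℝ) / 4) =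
        (N : ℝ) ^ r * Real.exp (r * (3 / 16)) := by
      rw [mul_right_comm, ← Real.exp_add, mul_comm]
      congr 2
      ring
    rw [← h4] at h3
    exact le_of_mul_le_mul_right h3 (Real.exp_pos _)
  rw [PMF.toOuterMeasure_uniformOfFintype_apply]
  have hc : Fintype.card {h : Fin r → X → Bits n | r < 4 * classicalCollCount ℓ B h} = T.card := by
    rw [hT, ← Set.toFinset_card]
    congr 1
    ext h
    simp
  have hc2 : Fintype.card (Fin r → X → Bits n) = N ^ r := by
    rw [Fintype.card_fun, Fintype.card_fin]
  rw [hc, hc2]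
  refine ENNReal.div_le_of_le_mul ?_
  rw [← ENNReal.ofReal_natCast, ← ENNReal.ofReal_natCast,
    ← ENNReal.ofReal_mul (Real.exp_pos _).le]
  apply ENNReal.ofReal_le_ofReal
  push_cast
  exact hcard

end Rounds

/-- For large `ℓ`, the birthday bound for `O(∛(2 ^ ℓ))` queries is at most `3 / 32`. -/
theorem exists_forall_sq_div_two_pow_le (α : ℝ) (hα : 1 ≤ α) :
    ∃ ℓ₀ : ℕ, ∀ ℓ q : ℕ, ℓ₀ ≤ ℓ → (q : ℝ) ≤ α * deadline ℓ →
      ((q : ℝ) + 2) ^ 2 / 2 ^ ℓ ≤ 3 / 32 := by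
  have ht : Filter.Tendsto (fun ℓ : ℕ => ((2 : ℝ) ^ ℓ) ^ ((1 : ℝ) / 3)) Filter.atTop
      Filter.atTop :=
    (tendsto_rpow_atTop (by norm_num)).comp (tendsto_pow_atTop_atTop_of_one_lt (by norm_num))
  obtain ⟨ℓ₀, h₀⟩ := Filter.eventually_atTop.1
    (ht.eventually_ge_atTop (32 / 3 * (2 * α + 2) ^ 2))
  refine ⟨ℓ₀, fun ℓ q hℓ hq => ?_⟩
  have h1 := h₀ ℓ hℓ
  set t := ((2 : ℝ) ^ ℓ) ^ ((1 : ℝ) / 3) with htdef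
  have ht1 : 1 ≤ t := Real.one_le_rpow (one_le_pow₀ (by norm_num)) (by norm_num)
  have ht3 : t ^ 3 = 2 ^ ℓ := by
    rw [htdef, ← Real.rpow_natCast, ← Real.rpow_mul (by positivity)]
    norm_num
  have hd : (deadline ℓ : ℝ) ≤ t + 1 := (Nat.ceil_lt_add_one (by positivity)).le
  have hq2 : (q : ℝ) + 2 ≤ (2 * α + 2) * t := by
    have : α * deadline ℓ ≤ α * (t + 1) := mul_le_mul_of_nonneg_left hd (by linarith)
    nlinarith
  rw [← ht3, div_le_iff₀ (by positivity)]
  calc ((q : ℝ) + 2) ^ 2 ≤ ((2 * α + 2) * t) ^ 2 := pow_le_pow_left₀ (by positivity) hq2 2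
    _ = (32 / 3 * (2 * α + 2) ^ 2) * (3 / 32 * t ^ 2) := by ring
    _ ≤ t * (3 / 32 * t ^ 2) := mul_le_mul_of_nonneg_right h1 (by positivity)
    _ = 3 / 32 * t ^ 3 := by ring

/-! ### Logical circuits: linearity, classical operations and disjoint supports -/

namespace HOp

variable {B : Type} [DecidableEq B] {m d : ℕ} (f : Bits m → Bits d)

theorem isLinearMap_eff (o : HOp B m d) : IsLinearMap ℂ (o.eff f) := by
  cases o with
  | had b => exact (Gate.had b).isLinearMap_apply
  | phase φ =>
    constructor
    · intro ψ χ
      funext z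
      simp only [eff, Pi.add_apply]
      ring
    · intro c ψ
      funext z
      simp only [eff, Pi.smul_apply, smul_eq_mul]
      ring
  | xor φ t h => exact ⟨fun _ _ => rfl, fun _ _ => rfl⟩
  | oracle X Y hY h => exact ⟨fun _ _ => rfl, fun _ _ => rfl⟩

theorem run_cons (o : HOp B m d) (l : List (HOp B m d)) (ψ : State B) :
    run f (o :: l) ψ = run f l (o.eff f ψ) := rfl

theorem run_append (l l' : List (HOp B m d)) (ψ : State B) :
    run f (l ++ l') ψ = run f l' (run f l ψ) := by
  simp [run, List.foldl_append]

theorem isLinearMap_run (l : List (HOp B m d)) : IsLinearMap ℂ (run f l) := by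
  induction l with
  | nil => exact ⟨fun _ _ => rfl, fun _ _ => rfl⟩
  | cons o l ih =>
    constructor
    · intro φ ψ
      simp only [run_cons, (o.isLinearMap_eff f).map_add, ih.map_add]
    · intro c φ
      simp only [run_cons, (o.isLinearMap_eff f).map_smul, ih.map_smul]

theorem run_sum_smul {ι : Type} [Fintype ι] (l : List (HOp B m d)) (a : ι → ℂ) (φ : ι → State B) :
    run f l (∑ i, a i • φ i) = ∑ i, a i • run f l (φ i) := by
  have := map_sum (IsLinearMap.mk' _ (isLinearMap_run f l)) (fun i => a i • φ i) Finset.univ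
  simp only [IsLinearMap.mk'_apply] at this
  rw [this]
  exact Finset.sum_congr rfl fun i _ => (isLinearMap_run f l).map_smul _ _

/-- The operation does not change the value of the wire `b`. -/
def Avoids (b : B) : HOp B m d → Prop
  | had b' => b' ≠ b
  | phase _ => True
  | xor _ t _ => t ≠ b
  | oracle _ Y _ _ => ∀ i, Y i ≠ b

/-- If a wire has the value `v` throughout the superposition, it keeps it under operations that do
not write to it. -/
theorem apply_eq_of_avoids (l : List (HOp B m d)) (b : B) (hl : ∀ o ∈ l, o.Avoids b) (v : Bool)
    (φ : State B) (hφ : ∀ z, φ z ≠ 0 → z b = v) : ∀ z, run f l φ z ≠ 0 → z b = v := by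
  induction l generalizing φ with
  | nil => exact hφ
  | cons o l ih =>
    rw [run_cons]
    refine ih (fun o ho => hl o (by simp [ho])) _ ?_
    have ho := hl o (by simp)
    intro z hz
    cases o with
    | had b' =>
      have hu : ∀ v, Function.update z b' v b = z b := fun v =>
        Function.update_of_ne (Ne.symm ho) _ _
      by_contra hne
      have h0 : ∀ v', φ (Function.update z b' v') = 0 := by
        intro v'
        by_contra h
        exact hne ((hu v').symm.trans (hφ _ h))
      simp [eff, Gate.apply, h0] at hz
    | phase χ => exact hφ z (right_ne_zero_of_mul hz)
    | xor χ t h =>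
      have := hφ _ hz
      rwa [Function.update_of_ne (Ne.symm ho)] at this
    | oracle X Y hY h =>
      have := hφ _ hz
      rwa [xorReg, Function.extend_apply' _ _ _ (fun ⟨i, hi⟩ => ho i hi)] at this

variable [Fintype B]

theorem eff_xor_ket (φ : Form B) (t : B) (h : φ.Avoids t) (z : B → Bool) :
    (xor φ t h : HOp B m d).eff f (ket z) =
      ket (Function.update z t (Bool.xor (z t) (φ.eval z))) := by
  funext y
  have hinv := update_xor_involutive φ t h
  have : Function.update y t (Bool.xor (y t) (φ.eval y)) = z ↔
      y = Function.update z t (Bool.xor (z t) (φ.eval z)) :=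
    ⟨fun e => by rw [← e]; exact (hinv y).symm, fun e => by rw [e]; exact hinv z⟩
  simp only [eff, ket, this]

theorem eff_oracle_ket (X : Fin m → B) (Y : Fin d → B) (hY : Function.Injective Y)
    (h : ∀ i j, X i ≠ Y j) (z : B → Bool) :
    (oracle X Y hY h : HOp B m d).eff f (ket z) = ket (xorReg Y (f (z ∘ X)) z) := by
  funext y
  have hinv : ∀ y, xorReg Y (f (xorReg Y (f (y ∘ X)) y ∘ X)) (xorReg Y (f (y ∘ X)) y) = y := by
    intro y
    rw [xorReg_comp X Y h, xorReg_xorReg Y hY]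
  have : xorReg Y (f (y ∘ X)) y = z ↔ y = xorReg Y (f (z ∘ X)) z :=
    ⟨fun e => by rw [← e]; exact (hinv y).symm, fun e => by rw [e]; exact hinv z⟩
  simp only [eff, ket, this]

/-- A list of bit flips with distinct targets that do not occur in the controlling formulas. -/
theorem run_xor_ket {J : Type} (F : J → Form B) (tgt : J → B) (ht : Function.Injective tgt)
    (hF : ∀ i j, (F i).Avoids (tgt j)) (l : List J) (hl : l.Nodup) (z : B → Bool) :
    ∃ z', run f (l.map fun j => (xor (F j) (tgt j) (hF j j) : HOp B m d)) (ket z) = ket z' ∧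
      (∀ j ∈ l, z' (tgt j) = Bool.xor (z (tgt j)) ((F j).eval z)) ∧
      ∀ b, (∀ j ∈ l, tgt j ≠ b) → z' b = z b := by
  induction l generalizing z with
  | nil => exact ⟨z, rfl, by simp, by simp⟩
  | cons a l ih =>
    obtain ⟨hal, hl⟩ := List.nodup_cons.1 hl
    obtain ⟨z', h1, h2, h3⟩ := ih hl (Function.update z (tgt a)
      (Bool.xor (z (tgt a)) ((F a).eval z)))
    refine ⟨z', ?_, ?_, ?_⟩
    · rw [List.map_cons, run_cons, eff_xor_ket, h1]
    · intro j hj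
      rcases List.mem_cons.1 hj with rfl | hj
      · rw [h3 _ (fun i hi h => hal (by rwa [← ht h])), Function.update_self]
      · have : j ≠ a := fun h => hal (h ▸ hj)
        rw [h2 j hj, Function.update_of_ne (ht.ne this), Form.eval_update_of_avoids _ _ (hF j a)]
    · intro b hb
      rw [h3 b (fun j hj => hb j (by simp [hj])), Function.update_of_ne (hb a (by simp)).symm]

/-- A list of oracle calls on disjoint registers. -/
theorem run_oracle_ket {J : Type} (X : J → Fin m → B) (Y : J → Fin d → B)
    (hY : ∀ j, Function.Injective (Y j)) (hYY : ∀ i j, i ≠ j → ∀ a b, Y i a ≠ Y j b)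
    (hXY : ∀ i j a b, X i a ≠ Y j b) (l : List J) (hl : l.Nodup) (z : B → Bool) :
    ∃ z', run f (l.map fun j => (oracle (X j) (Y j) (hY j) (hXY j j) : HOp B m d)) (ket z) =
        ket z' ∧
      (∀ j ∈ l, ∀ i, z' (Y j i) = Bool.xor (z (Y j i)) (f (z ∘ X j) i)) ∧
      ∀ b, (∀ j ∈ l, ∀ i, Y j i ≠ b) → z' b = z b := by
  induction l generalizing z with
  | nil => exact ⟨z, rfl, by simp, by simp⟩
  | cons a l ih =>
    obtain ⟨hal, hl⟩ := List.nodup_cons.1 hl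
    obtain ⟨z', h1, h2, h3⟩ := ih hl (xorReg (Y a) (f (z ∘ X a)) z)
    refine ⟨z', ?_, ?_, ?_⟩
    · rw [List.map_cons, run_cons, eff_oracle_ket, h1]
    · intro j hj i
      rcases List.mem_cons.1 hj with rfl | hj
      · rw [h3 _ (fun i hi _ h => hYY i j (fun e => hal (e ▸ hi)) _ _ h), xorReg,
          (hY j).extend_apply]
      · have : j ≠ a := fun h => hal (h ▸ hj)
        rw [h2 j hj, xorReg_comp _ _ (hXY j a), xorReg,
          Function.extend_apply' _ _ _ (fun ⟨i', h⟩ => hYY a j (Ne.symm this) _ _ h)]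
    · intro b hb
      rw [h3 b (fun j hj => hb j (by simp [hj])), xorReg,
        Function.extend_apply' _ _ _ (fun ⟨i', h⟩ => hb a (by simp) i' h)]

end HOp

section Weight

variable {B : Type} [Fintype B] [DecidableEq B]

/-- States with disjoint supports do not interfere. -/
theorem weight_sum_smul {ι : Type} [Fintype ι] (a : ι → ℂ) (φ : ι → State B)
    (h : ∀ i j z, φ i z ≠ 0 → φ j z ≠ 0 → i = j) (P : Set (B → Bool)) :
    weight (∑ i, a i • φ i) P = ∑ i, ‖a i‖ ^ 2 * weight (φ i) P := by
  classical
  unfold weight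
  simp only [Finset.mul_sum]
  rw [Finset.sum_comm]
  refine Finset.sum_congr rfl fun z _ => ?_
  by_cases hz : z ∈ P
  · simp only [Set.indicator_of_mem hz, Finset.sum_apply, Pi.smul_apply, smul_eq_mul]
    by_cases h0 : ∃ i, φ i z ≠ 0
    · obtain ⟨i, hi⟩ := h0
      have hj : ∀ j, j ≠ i → φ j z = 0 := fun j hj => by
        by_contra hne
        exact hj (h j i z hne hi)
      rw [Finset.sum_eq_single i (fun j _ hji => by rw [hj j hji, mul_zero]) (by simp),
        Finset.sum_eq_single i (fun j _ hji => by rw [hj j hji]; simp) (by simp), norm_mul, mul_pow]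
    · push Not at h0
      simp [h0]
  · simp [Set.indicator_of_notMem hz]

theorem weight_ket (z : B → Bool) (P : Set (B → Bool)) [Decidable (z ∈ P)] :
    weight (ket z) P = if z ∈ P then 1 else 0 := by
  unfold weight
  rw [Finset.sum_eq_single z]
  · by_cases hz : z ∈ P <;> simp [hz, ket]
  · intro y _ hy
    by_cases hy' : y ∈ P <;> simp [hy', ket, hy]
  · simp

end Weight

/-! ### Layers of Hadamard gates and Grover iterations -/

section Grover

variable {B : Type} {m : ℕ}

/-- Overwrite the register `X` by `x`. -/
def setReg (X : Fin m → B) (x : Bits m) (z : B → Bool) : B → Bool := Function.extend X x z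

variable {X : Fin m → B} (hX : Function.Injective X)

include hX in
theorem setReg_comp (x : Bits m) (z : B → Bool) : setReg X x z ∘ X = x := by
  funext i
  exact hX.extend_apply _ _ _

theorem setReg_of_ne (x : Bits m) (z : B → Bool) (b : B) (h : ∀ i, X i ≠ b) :
    setReg X x z b = z b := Function.extend_apply' _ _ _ (fun ⟨i, hi⟩ => h i hi)

include hX in
theorem setReg_setReg (x y : Bits m) (z : B → Bool) : setReg X y (setReg X x z) = setReg X y z := by
  funext b
  by_cases h : ∃ i, X i = b
  · obtain ⟨i, rfl⟩ := h
    simp only [setReg, hX.extend_apply]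
  · simp only [setReg, Function.extend_apply' _ _ _ h]

include hX in
theorem setReg_self (z : B → Bool) : setReg X (z ∘ X) z = z := by
  funext b
  by_cases h : ∃ i, X i = b
  · obtain ⟨i, rfl⟩ := h
    simp only [setReg, hX.extend_apply, Function.comp]
  · simp only [setReg, Function.extend_apply' _ _ _ h]

variable [DecidableEq B]

theorem update_setReg_cons {X : Fin (m + 1) → B} (hX : Function.Injective X) (x : Bits m)
    (v : Bool) (z : B → Bool) :
    Function.update (setReg (fun i => X i.succ) x z) (X 0) v =
      setReg X (Fin.cons v x : Fin (m + 1) → Bool) z := by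
  have hX' : Function.Injective fun i : Fin m => X i.succ := hX.comp (Fin.succ_injective m)
  funext b
  by_cases h : ∃ i, X i = b
  · obtain ⟨i, rfl⟩ := h
    rw [setReg, setReg, hX.extend_apply]
    refine Fin.cases ?_ (fun i => ?_) i
    · simp
    · rw [Function.update_of_ne (hX.ne (Fin.succ_ne_zero i)), Fin.cons_succ]
      exact hX'.extend_apply x z i
  · have h0 : X 0 ≠ b := fun e => h ⟨0, e⟩
    rw [Function.update_of_ne h0.symm, setReg_of_ne _ _ _ (fun i e => h ⟨i, e⟩),
      setReg_of_ne _ _ _ (fun i e => h ⟨i.succ, e⟩)]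

/-- A Hadamard gate on every wire of the register `X`. -/
def hadLayer (d : ℕ) {M : ℕ} (X : Fin m → B) : List (HOp B M d) := (List.ofFn X).map HOp.had

variable {M d : ℕ} (f : Bits M → Bits d)

theorem hadLayer_reverse_run (X : Fin m → B) (φ : State B) :
    HOp.run f (hadLayer d X).reverse (HOp.run f (hadLayer d X) φ) = φ := by
  have hs : (1 / (Real.sqrt 2 : ℂ)) * (1 / (Real.sqrt 2 : ℂ)) = 1 / 2 := by
    rw [div_mul_div_comm, one_mul, ← Complex.ofReal_mul, Real.mul_self_sqrt (by norm_num)]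
    norm_num
  have h : ∀ (l : List B) (φ : State B), HOp.run f (l.map (HOp.had : B → HOp B M d)).reverse
      (HOp.run f (l.map HOp.had) φ) = φ := by
    intro l
    induction l with
    | nil => intro φ; rfl
    | cons b l ih =>
      intro φ
      rw [List.map_cons, List.reverse_cons, HOp.run_append,
        HOp.run_cons f (HOp.had b) (l.map HOp.had) φ,
        ih]
      funext z
      simp only [HOp.run, List.foldl_cons, List.foldl_nil, HOp.eff, Gate.apply,
        Function.update_self, Function.update_idem]
      rcases hb : z b with _ | _
      · have : Function.update z b false = z := by rw [← hb, Function.update_eq_self]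
        simp only [this]
        simp
        linear_combination (2 * φ z) * hs
      · have : Function.update z b true = z := by rw [← hb, Function.update_eq_self]
        simp only [this]
        simp
        linear_combination (2 * φ z) * hs
  exact h _ φ

include hX in
/-- The amplitude of the zero string after a layer of Hadamard gates. -/
theorem run_hadLayer_apply (φ : State B) (z : B → Bool) (hz : ∀ i, z (X i) = false) :
    HOp.run f (hadLayer d X) φ z = (1 / (Real.sqrt 2 : ℂ)) ^ m * ∑ x, φ (setReg X x z) := by
  induction m generalizing φ with
  | zero =>
    have : ∀ x, setReg X x z = z := fun x => by
      funext b
      exact setReg_of_ne _ _ _ fun i => i.elim0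
    simp only [pow_zero, one_mul, Fintype.sum_unique, this]
    rfl
  | succ m ih =>
    have hX' : Function.Injective fun i : Fin m => X i.succ := hX.comp (Fin.succ_injective m)
    have hl : (hadLayer d X : List (HOp B M d)) =
        HOp.had (X 0) :: hadLayer d fun i : Fin m => X i.succ := by
      simp [hadLayer, List.ofFn_succ]
    rw [hl, HOp.run_cons, ih hX' _ (fun i => hz _), pow_succ, mul_assoc]
    congr 1
    rw [← Equiv.sum_comp (Fin.consEquiv fun _ : Fin (m + 1) => Bool), Fintype.sum_prod_type_right,
      Finset.mul_sum]
    refine Finset.sum_congr rfl fun x _ => ?_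
    have h0 : setReg (fun i : Fin m => X i.succ) x z (X 0) = false := by
      rw [setReg_of_ne _ _ _ (fun i => hX.ne (Fin.succ_ne_zero i)), hz]
    simp only [HOp.eff, Gate.apply, h0, update_setReg_cons hX, Fintype.sum_bool]
    simp only [Bool.false_eq_true, if_false, one_mul]
    rw [add_comm]
    rfl

include hX in
/-- A layer of Hadamard gates applied to a state in which the register is zero. -/
theorem run_hadLayer_reverse_apply (φ : State B) (hφ : ∀ z, φ z ≠ 0 → ∀ i, z (X i) = false)
    (z : B → Bool) :
    HOp.run f (hadLayer d X).reverse φ z =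
      (1 / (Real.sqrt 2 : ℂ)) ^ m * φ (setReg X (fun _ => false) z) := by
  induction m generalizing z with
  | zero =>
    have : setReg X (fun _ => false) z = z := by
      funext b
      exact setReg_of_ne _ _ _ fun i => i.elim0
    rw [this, pow_zero, one_mul]
    rfl
  | succ m ih =>
    have hX' : Function.Injective fun i : Fin m => X i.succ := hX.comp (Fin.succ_injective m)
    have hl : (hadLayer d X : List (HOp B M d)) =
        HOp.had (X 0) :: hadLayer d fun i : Fin m => X i.succ := by
      simp [hadLayer, List.ofFn_succ]
    have hu : ∀ v, setReg (fun i : Fin m => X i.succ) (fun _ => false)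
        (Function.update z (X 0) v) =
        setReg X (Fin.cons v fun _ => false : Fin (m + 1) → Bool) z := by
      intro v
      rw [← update_setReg_cons hX]
      funext b
      by_cases h : ∃ i : Fin m, X i.succ = b
      · obtain ⟨i, rfl⟩ := h
        rw [Function.update_of_ne (hX.ne (Fin.succ_ne_zero i)), setReg, setReg,
          hX'.extend_apply (g := fun _ => false) (e' := _),
          hX'.extend_apply (g := fun _ => false) (e' := _)]
      · rw [setReg_of_ne _ _ _ (fun i e => h ⟨i, e⟩)]
        by_cases hb : b = X 0
        · subst hb; simp
        · rw [Function.update_of_ne hb, Function.update_of_ne hb,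
            setReg_of_ne _ _ _ (fun i e => h ⟨i, e⟩)]
    have h1 : φ (setReg X (Fin.cons true fun _ => false : Fin (m + 1) → Bool) z) = 0 := by
      by_contra hne
      have := hφ _ hne 0
      rw [setReg, hX.extend_apply] at this
      simp at this
    have h2 : (Fin.cons false fun _ => false : Fin (m + 1) → Bool) = fun _ => false := by
      funext i
      refine Fin.cases rfl (fun i => rfl) i
    rw [hl, List.reverse_cons, HOp.run_append]
    have ih' := ih hX' (fun z hz i => hφ z hz i.succ)
    simp only [HOp.run_cons _ (HOp.had (X 0)), HOp.eff, Gate.apply, ih']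
    simp only [HOp.run, List.foldl_nil, hu, h1, h2]
    ring

end Grover

/-! ### Derived connectives -/

namespace Form

variable {B : Type}

/-- Negation. -/
def neg (φ : Form B) : Form B := nand φ tru

/-- Conjunction. -/
def conj (φ ψ : Form B) : Form B := neg (nand φ ψ)

/-- Disjunction. -/
def disj (φ ψ : Form B) : Form B := nand (neg φ) (neg ψ)

/-- The variables `a` and `b` have the same value. -/
def eqv (a b : B) : Form B := disj (conj (var a) (var b)) (conj (neg (var a)) (neg (var b)))

/-- Conjunction of a list. -/
def bigConj (l : List (Form B)) : Form B := l.foldr conj tru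

/-- Disjunction of a list. -/
def bigDisj (l : List (Form B)) : Form B := l.foldr disj (neg tru)

@[simp] theorem eval_neg (z : B → Bool) (φ : Form B) : (neg φ).eval z = !φ.eval z := by
  simp [neg, eval]

@[simp] theorem eval_conj (z : B → Bool) (φ ψ : Form B) :
    (conj φ ψ).eval z = (φ.eval z && ψ.eval z) := by
  simp [conj, eval]

@[simp] theorem eval_disj (z : B → Bool) (φ ψ : Form B) :
    (disj φ ψ).eval z = (φ.eval z || ψ.eval z) := by
  simp [disj, eval]

theorem eval_eqv (z : B → Bool) (a b : B) : (eqv a b).eval z = true ↔ z a = z b := by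
  simp only [eqv, eval_disj, eval_conj, eval_neg, eval]
  cases z a <;> cases z b <;> simp

theorem eval_bigConj (z : B → Bool) (l : List (Form B)) :
    (bigConj l).eval z = true ↔ ∀ φ ∈ l, φ.eval z = true := by
  induction l with
  | nil => simp [bigConj, eval]
  | cons φ l ih =>
    rw [bigConj] at ih
    simp [bigConj, ih]

theorem eval_bigDisj (z : B → Bool) (l : List (Form B)) :
    (bigDisj l).eval z = true ↔ ∃ φ ∈ l, φ.eval z = true := by
  induction l with
  | nil => simp [bigDisj, eval]
  | cons φ l ih =>
    rw [bigDisj] at ih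
    simp [bigDisj, ih]

theorem size_neg (φ : Form B) : (neg φ).size = φ.size + 2 := rfl

theorem size_conj (φ ψ : Form B) : (conj φ ψ).size = φ.size + ψ.size + 3 := rfl

theorem size_disj (φ ψ : Form B) : (disj φ ψ).size = φ.size + ψ.size + 5 := by
  simp only [disj, size, size_neg]
  omega

theorem size_bigConj_le (l : List (Form B)) (K : ℕ) (h : ∀ φ ∈ l, φ.size ≤ K) :
    (bigConj l).size ≤ l.length * (K + 3) + 1 := by
  induction l with
  | nil => simp [bigConj, size]
  | cons φ l ih =>
    have h1 := ih fun φ hφ => h φ (by simp [hφ])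
    have h2 := h φ (by simp)
    rw [bigConj] at h1
    simp only [bigConj, List.foldr_cons, size_conj, List.length_cons] at h1 ⊢
    nlinarith

theorem size_bigDisj_le (l : List (Form B)) (K : ℕ) (h : ∀ φ ∈ l, φ.size ≤ K) :
    (bigDisj l).size ≤ l.length * (K + 5) + 3 := by
  induction l with
  | nil => simp [bigDisj, size, size_neg]
  | cons φ l ih =>
    have h1 := ih fun φ hφ => h φ (by simp [hφ])
    have h2 := h φ (by simp)
    rw [bigDisj] at h1
    simp only [bigDisj, List.foldr_cons, size_disj, List.length_cons] at h1 ⊢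
    nlinarith

theorem avoids_neg {t : B} {φ : Form B} (h : φ.Avoids t) : (neg φ).Avoids t := ⟨h, trivial⟩

theorem avoids_conj {t : B} {φ ψ : Form B} (h : φ.Avoids t) (h' : ψ.Avoids t) :
    (conj φ ψ).Avoids t := ⟨⟨h, h'⟩, trivial⟩

theorem avoids_disj {t : B} {φ ψ : Form B} (h : φ.Avoids t) (h' : ψ.Avoids t) :
    (disj φ ψ).Avoids t := ⟨⟨h, trivial⟩, ⟨h', trivial⟩⟩

theorem avoids_eqv {t a b : B} (ha : a ≠ t) (hb : b ≠ t) : (eqv a b).Avoids t :=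
  avoids_disj (avoids_conj ha hb) (avoids_conj (avoids_neg ha) (avoids_neg hb))

theorem avoids_bigConj {t : B} (l : List (Form B)) (h : ∀ φ ∈ l, φ.Avoids t) :
    (bigConj l).Avoids t := by
  induction l with
  | nil => trivial
  | cons φ l ih => exact avoids_conj (h φ (by simp)) (ih fun φ hφ => h φ (by simp [hφ]))

/-- Some wire of the register `X` is set. -/
def anyOf {m : ℕ} (X : Fin m → B) : Form B := bigDisj ((List.ofFn X).map var)

theorem eval_anyOf {m : ℕ} (X : Fin m → B) (z : B → Bool) :
    (anyOf X).eval z = true ↔ ∃ i, z (X i) = true := by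
  simp [anyOf, eval_bigDisj, eval]

theorem size_anyOf_le {m : ℕ} (X : Fin m → B) : (anyOf X).size ≤ 5 * m + 3 := by
  have := size_bigDisj_le ((List.ofFn X).map var) 0 (by
    intro φ hφ
    obtain ⟨b, _, rfl⟩ := List.mem_map.1 hφ
    exact le_rfl)
  simp only [List.length_map, List.length_ofFn] at this
  rw [anyOf]
  omega

end Form

/-! ### Grover search -/

theorem xorReg_eq_setReg {B : Type} {d : ℕ} {Y : Fin d → B} (y : Bits d)
    (z : B → Bool) (hz : ∀ i, z (Y i) = false) :
    xorReg Y y z = setReg Y y z := by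
  unfold xorReg setReg
  congr 1
  funext i
  rw [hz, Bool.false_xor]

section Grover

variable {B : Type} [DecidableEq B] {m d : ℕ} {X : Fin m → B} (hX : Function.Injective X)
  (f : Bits m → Bits d)

/-- Reflection about the uniform superposition of the register `X`. -/
def diffusion (d : ℕ) {M : ℕ} (X : Fin m → B) : List (HOp B M d) :=
  hadLayer d X ++ (HOp.phase (Form.anyOf X) :: (hadLayer d X).reverse)

include hX in
theorem run_diffusion (φ : State B) (z : B → Bool) :
    HOp.run f (diffusion d X) φ z = 2 * (1 / 2) ^ m * ∑ x, φ (setReg X x z) - φ z := by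
  classical
  set ψ := HOp.run f (hadLayer d X) φ with hψ
  set P : State B := fun z => if ∀ i, z (X i) = false then ψ z else 0 with hP
  have h1 : (HOp.phase (Form.anyOf X) : HOp B m d).eff f ψ = (2 : ℂ) • P + (-1 : ℂ) • ψ := by
    funext y
    simp only [HOp.eff, Pi.add_apply, Pi.smul_apply, smul_eq_mul, hP]
    have := Form.eval_anyOf X y
    by_cases h : ∀ i, y (X i) = false
    · have h' : (Form.anyOf X).eval y = false := by
        rw [Bool.eq_false_iff, ne_eq, this]
        simp [h]
      simp only [h', if_pos h]
      simp
      ring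
    · have h' : (Form.anyOf X).eval y = true := by
        rw [this]
        simpa using h
      simp only [h', if_neg h]
      simp
  have hlin := HOp.isLinearMap_run f (hadLayer d X).reverse
  have hs : (1 / (Real.sqrt 2 : ℂ)) * (1 / (Real.sqrt 2 : ℂ)) = 1 / 2 := by
    rw [div_mul_div_comm, one_mul, ← Complex.ofReal_mul, Real.mul_self_sqrt (by norm_num)]
    norm_num
  have h0 : ∀ i, setReg X (fun _ => false) z (X i) = false := fun i => hX.extend_apply _ _ _
  rw [diffusion, HOp.run_append, HOp.run_cons, ← hψ, h1, hlin.map_add, hlin.map_smul,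
    hlin.map_smul, hψ, hadLayer_reverse_run, Pi.add_apply, Pi.smul_apply, Pi.smul_apply,
    run_hadLayer_reverse_apply hX f P, hP]
  · simp only [if_pos h0, hψ, run_hadLayer_apply hX f φ _ h0, setReg_setReg hX, smul_eq_mul]
    rw [← hs, mul_pow]
    ring
  · intro z hz
    by_contra hne
    simp [hP, hne] at hz

/-- The superposition with amplitudes `a` of the basis states that differ from `z₀` in the
register `X` only. -/
def spread [Fintype B] (X : Fin m → B) (z₀ : B → Bool) (a : Bits m → ℝ) : State B :=
  fun z => if z = setReg X (z ∘ X) z₀ then (a (z ∘ X) : ℂ) else 0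

/-- Effect of a Grover iteration for the set `G` on the amplitudes: a change of sign on `G`,
followed by inversion about the mean. -/
def groverStep (G : Bits m → Bool) (a : Bits m → ℝ) (x : Bits m) : ℝ :=
  2 * (1 / 2) ^ m * (∑ y, (if G y then -1 else 1) * a y) - (if G x then -1 else 1) * a x

/-- The amplitudes after a number of Grover iterations. -/
def groverAmp (G : Bits m → Bool) : ℕ → Bits m → ℝ
  | 0 => fun _ => (1 / Real.sqrt 2) ^ m
  | j + 1 => groverStep G (groverAmp G j)

variable {Y : Fin d → B} (hY : Function.Injective Y) (h : ∀ i j, X i ≠ Y j) (marked : Form B)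

/-- A Grover iteration on the register `X`; the formula `marked` may use the digest of `X`, which is
held by the register `Y` meanwhile. -/
def groverIter (X : Fin m → B) (Y : Fin d → B) (hY : Function.Injective Y)
    (h : ∀ i j, X i ≠ Y j) (marked : Form B) : List (HOp B m d) :=
  HOp.oracle X Y hY h :: HOp.phase marked :: HOp.oracle X Y hY h :: diffusion d X

/-- Grover search with `J` iterations, after which the digest is computed once more. -/
def groverSearch (X : Fin m → B) (Y : Fin d → B) (hY : Function.Injective Y)
    (h : ∀ i j, X i ≠ Y j) (marked : Form B) (J : ℕ) : List (HOp B m d) :=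
  (hadLayer d X).reverse ++ ((List.replicate J (groverIter X Y hY h marked)).flatten ++
    [HOp.oracle X Y hY h])

variable [Fintype B] (z₀ : B → Bool) (G : Bits m → Bool)

include hX in
theorem run_groverIter (hzY : ∀ i, z₀ (Y i) = false)
    (hG : ∀ x, marked.eval (setReg Y (f x) (setReg X x z₀)) = G x) (a : Bits m → ℝ) :
    HOp.run f (groverIter X Y hY h marked) (spread X z₀ a) = spread X z₀ (groverStep G a) := by
  have h1 : (HOp.oracle X Y hY h).eff f ((HOp.phase marked : HOp B m d).eff f
      ((HOp.oracle X Y hY h).eff f (spread X z₀ a))) =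
      spread X z₀ (fun x => (if G x then -1 else 1) * a x) := by
    funext z
    simp only [HOp.eff]
    rw [xorReg_comp X Y h, xorReg_xorReg Y hY]
    simp only [spread]
    split_ifs with hm hz hg hg
    · simp
    · exfalso
      rw [hz, setReg_comp hX] at hm
      rw [xorReg_eq_setReg _ _ (fun i => by rw [setReg_of_ne _ _ _ (fun j => h j i), hzY]),
        hG] at hm
      exact hg hm
    · simp
    · exfalso
      rw [hg, setReg_comp hX] at hm
      rw [xorReg_eq_setReg _ _ (fun i => by rw [setReg_of_ne _ _ _ (fun j => h j i), hzY]),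
        hG] at hm
      rename_i hgg
      exact hm hgg
    · simp
    · simp
  rw [groverIter, HOp.run_cons, HOp.run_cons, HOp.run_cons, h1]
  funext z
  rw [run_diffusion hX]
  by_cases hz : z = setReg X (z ∘ X) z₀
  · have h2 : ∀ x, setReg X x z = setReg X x z₀ := by
      intro x
      rw [hz, setReg_setReg hX]
    simp only [spread, h2, setReg_comp hX, if_true, if_pos hz, groverStep]
    push_cast
    rfl
  · have h2 : ∀ x, setReg X x z ≠ setReg X (setReg X x z ∘ X) z₀ := by
      intro x he
      rw [setReg_comp hX] at he
      apply hz
      rw [← setReg_setReg hX x, ← he, setReg_setReg hX, setReg_self hX]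
    simp only [spread, if_neg hz, if_neg (h2 _)]
    simp

include hX in
theorem run_hadLayer_reverse_ket (hzX : ∀ i, z₀ (X i) = false) :
    HOp.run f (hadLayer d X).reverse (ket z₀) = spread X z₀ fun _ => (1 / Real.sqrt 2) ^ m := by
  funext z
  rw [run_hadLayer_reverse_apply hX f]
  · have hiff : setReg X (fun _ => false) z = z₀ ↔ z = setReg X (z ∘ X) z₀ := by
      constructor
      · intro he
        rw [← he, setReg_setReg hX, setReg_self hX]
      · intro he
        rw [he, setReg_setReg hX]
        have : (fun _ => false) = z₀ ∘ X := funext fun i => (hzX i).symm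
        rw [this, setReg_self hX]
    simp only [ket, hiff, spread]
    split <;> simp
  · intro z hz i
    have : z = z₀ := by
      by_contra hne
      simp [ket, hne] at hz
    rw [this, hzX]

include hX in
theorem spread_eq_sum (a : Bits m → ℝ) :
    spread X z₀ a = ∑ x, (a x : ℂ) • ket (setReg X x z₀) := by
  funext z
  simp only [spread, Finset.sum_apply, Pi.smul_apply, ket, smul_eq_mul, mul_ite, mul_one, mul_zero]
  have hiff : ∀ x, z = setReg X x z₀ ↔ x = z ∘ X ∧ z = setReg X (z ∘ X) z₀ := by
    intro x
    constructor
    · intro he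
      have : z ∘ X = x := by rw [he, setReg_comp hX]
      rw [this]
      exact ⟨rfl, he⟩
    · rintro ⟨rfl, he⟩
      exact he
  rw [Finset.sum_congr rfl fun x _ => if_congr (hiff x) rfl rfl]
  by_cases hz : z = setReg X (z ∘ X) z₀
  · simp only [hz.symm, and_true]
    simp
  · simp [hz]

include hX in
/-- The state prepared by a Grover search on registers that are zero initially. -/
theorem run_groverSearch (hzX : ∀ i, z₀ (X i) = false) (hzY : ∀ i, z₀ (Y i) = false)
    (hG : ∀ x, marked.eval (setReg Y (f x) (setReg X x z₀)) = G x) (J : ℕ) :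
    HOp.run f (groverSearch X Y hY h marked J) (ket z₀) =
      ∑ x, (groverAmp G J x : ℂ) • ket (setReg Y (f x) (setReg X x z₀)) := by
  have h1 : ∀ J, HOp.run f (List.replicate J (groverIter X Y hY h marked)).flatten
      (spread X z₀ fun _ => (1 / Real.sqrt 2) ^ m) = spread X z₀ (groverAmp G J) := by
    intro J
    induction J with
    | zero => rfl
    | succ J ih =>
      rw [List.replicate_succ', List.flatten_append, HOp.run_append, ih, List.flatten_singleton,
        run_groverIter hX f hY h marked z₀ G hzY hG]
      rfl
  rw [groverSearch, HOp.run_append, HOp.run_append, run_hadLayer_reverse_ket hX f z₀ hzX, h1,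
    spread_eq_sum hX, HOp.run_sum_smul]
  refine Finset.sum_congr rfl fun x _ => ?_
  congr 1
  have : HOp.run f [HOp.oracle X Y hY h] (ket (setReg X x z₀)) =
      (HOp.oracle X Y hY h).eff f (ket (setReg X x z₀)) := rfl
  rw [this, HOp.eff_oracle_ket, setReg_comp hX,
    xorReg_eq_setReg _ _ (fun i => by rw [setReg_of_ne _ _ _ (fun j => h j i), hzY])]

end Grover

/-! ### The success probability of Grover search -/

section Angle

variable {m : ℕ} (G : Bits m → Bool)

/-- The angle of a Grover search: `sin² θ` is the fraction of marked strings. -/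
def groverAngle : ℝ :=
  Real.arcsin (Real.sqrt ((Finset.univ.filter fun x => G x).card / 2 ^ m))

theorem card_marked_le : ((Finset.univ.filter fun x => G x).card : ℝ) ≤ 2 ^ m := by
  have := Finset.card_filter_le (Finset.univ : Finset (Bits m)) fun x => G x
  rw [Finset.card_univ, Fintype.card_fun, Fintype.card_bool, Fintype.card_fin] at this
  exact_mod_cast this

theorem card_not_marked : ((Finset.univ.filter fun x => ¬ G x).card : ℝ) =
    2 ^ m - (Finset.univ.filter fun x => G x).card := by
  have := Finset.card_filter_add_card_filter_not (s := (Finset.univ : Finset (Bits m)))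
    (fun x => G x = true)
  rw [Finset.card_univ, Fintype.card_fun, Fintype.card_bool, Fintype.card_fin] at this
  have h2 : (((Finset.univ.filter fun x => G x).card +
    (Finset.univ.filter fun x => ¬ G x).card : ℕ) : ℝ) = ((2 ^ m : ℕ) : ℝ) := by rw [this]
  push_cast at h2
  linarith

theorem sin_groverAngle : Real.sin (groverAngle G) =
    Real.sqrt ((Finset.univ.filter fun x => G x).card / 2 ^ m) := by
  refine Real.sin_arcsin ?_ ?_
  · have := Real.sqrt_nonneg ((Finset.univ.filter fun x => G x).card / 2 ^ m : ℝ)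
    linarith
  · rw [Real.sqrt_le_one]
    exact div_le_one_of_le₀ (card_marked_le G) (by positivity)

theorem cos_groverAngle : Real.cos (groverAngle G) =
    Real.sqrt ((2 ^ m - (Finset.univ.filter fun x => G x).card) / 2 ^ m) := by
  rw [groverAngle, Real.cos_arcsin, Real.sq_sqrt (by positivity), sub_div, div_self (by positivity)]

theorem groverAngle_nonneg : 0 ≤ groverAngle G := Real.arcsin_nonneg.2 (Real.sqrt_nonneg _)

theorem groverAngle_le : groverAngle G ≤ Real.pi / 2 := Real.arcsin_le_pi_div_two _

/-- The amplitudes are constant on the marked and on the unmarked strings, and rotate by `2 * θ`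
with every iteration. -/
theorem groverAmp_eq (j : ℕ) : ∃ a b : ℝ, (∀ x, groverAmp G j x = if G x then a else b) ∧
    Real.sqrt ((Finset.univ.filter fun x => G x).card) * a =
      Real.sin ((2 * j + 1) * groverAngle G) ∧
    Real.sqrt (2 ^ m - (Finset.univ.filter fun x => G x).card) * b =
      Real.cos ((2 * j + 1) * groverAngle G) := by
  have hs := sin_groverAngle G
  have hc := cos_groverAngle G
  have hle := card_marked_le G
  have hcard := card_not_marked G
  set g : ℝ := ((Finset.univ.filter fun x => G x).card : ℝ) with hg
  have hg0 : 0 ≤ g := by positivity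
  have hM : Real.sqrt (2 ^ m) ≠ 0 := by positivity
  rw [Real.sqrt_div hg0, eq_div_iff hM] at hs
  rw [Real.sqrt_div (by linarith), eq_div_iff hM] at hc
  set θ := groverAngle G with hθ
  set R := Real.sqrt (2 ^ m) with hR
  have hRR : R * R = 2 ^ m := Real.mul_self_sqrt (by positivity)
  have hgg : Real.sqrt g * Real.sqrt g = g := Real.mul_self_sqrt hg0
  have hgg' : Real.sqrt (2 ^ m - g) * Real.sqrt (2 ^ m - g) = 2 ^ m - g :=
    Real.mul_self_sqrt (by linarith)
  induction j with
  | zero =>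
    have h0 : (1 / Real.sqrt 2) ^ m = 1 / R := by
      rw [one_div_pow, hR, Real.sqrt_eq_rpow, Real.sqrt_eq_rpow, ← Real.rpow_natCast,
        ← Real.rpow_natCast, ← Real.rpow_mul (by norm_num), ← Real.rpow_mul (by norm_num), mul_comm]
    refine ⟨1 / R, 1 / R, fun x => ?_, ?_, ?_⟩
    · simp only [groverAmp, h0, ite_self]
    · rw [← hs]
      field_simp
      simp
    · rw [← hc]
      field_simp
      simp
  | succ j ih =>
    obtain ⟨a, b, h1, h2, h3⟩ := ih
    have hsum : ∑ y, (if G y then (-1 : ℝ) else 1) * groverAmp G j y =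
        -(g * a) + (2 ^ m - g) * b := by
      rw [← Finset.sum_filter_add_sum_filter_not Finset.univ (fun y => G y = true)]
      have e1 : ∑ y ∈ Finset.univ.filter (fun y => G y = true),
          (if G y then (-1 : ℝ) else 1) * groverAmp G j y = -(g * a) := by
        rw [Finset.sum_congr rfl (g := fun _ => -a), Finset.sum_const, nsmul_eq_mul, ← hg]
        · ring
        · intro y hy
          have := (Finset.mem_filter.1 hy).2
          simp [h1, this]
      have e2 : ∑ y ∈ Finset.univ.filter (fun y => ¬ G y = true),
          (if G y then (-1 : ℝ) else 1) * groverAmp G j y = (2 ^ m - g) * b := by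
        rw [Finset.sum_congr rfl (g := fun _ => b), Finset.sum_const, nsmul_eq_mul, hcard]
        intro y hy
        have := (Finset.mem_filter.1 hy).2
        simp [h1, this]
      rw [e1, e2]
    set φ := (2 * (j : ℝ) + 2) * θ with hφ
    have hminus : (2 * (j : ℝ) + 1) * θ = φ - θ := by rw [hφ]; ring
    have hplus : (2 * ((j + 1 : ℕ) : ℝ) + 1) * θ = φ + θ := by rw [hφ]; push_cast; ring
    rw [hminus] at h2 h3
    have hmean : (1 / 2 : ℝ) ^ m * (-(g * a) + (2 ^ m - g) * b) = Real.cos φ / R := by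
      have e1 : g * a = R * Real.sin θ * Real.sin (φ - θ) := by
        rw [← h2, mul_comm R, hs, ← mul_assoc, hgg]
      have e2 : (2 ^ m - g) * b = R * Real.cos θ * Real.cos (φ - θ) := by
        rw [← h3, mul_comm R, hc, ← mul_assoc, hgg']
      have e3 : Real.cos φ = Real.cos (φ - θ) * Real.cos θ - Real.sin (φ - θ) * Real.sin θ := by
        rw [← Real.cos_add]
        congr 1
        ring
      rw [e1, e2, e3, one_div_pow, ← hRR]
      field_simp
      ring
    refine ⟨2 * (Real.cos φ / R) + a, 2 * (Real.cos φ / R) - b, fun x => ?_, ?_, ?_⟩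
    · simp only [groverAmp, groverStep, hsum]
      rw [mul_assoc, hmean, h1]
      split <;> ring
    · rw [mul_add, h2, hplus, ← hs, Real.sin_sub, Real.sin_add]
      field_simp
      ring
    · rw [mul_sub, h3, hplus, ← hc, Real.cos_sub, Real.cos_add]
      field_simp
      ring

/-- The probability that a Grover search fails. -/
theorem sum_groverAmp_sq (j : ℕ) : ∑ x, (if G x then 0 else groverAmp G j x ^ 2) =
    Real.cos ((2 * j + 1) * groverAngle G) ^ 2 := by
  obtain ⟨a, b, h1, -, h3⟩ := groverAmp_eq G j
  have hle := card_marked_le G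
  have hcard := card_not_marked G
  rw [← h3, mul_pow, Real.sq_sqrt (by linarith), ← hcard, ← nsmul_eq_mul, ← Finset.sum_const,
    Finset.sum_filter]
  refine Finset.sum_congr rfl fun x _ => ?_
  rw [h1]
  cases G x <;> simp

end Angle

/-- Among the angles `3 ^ i * θ` there is one at which a Grover search succeeds with probability at
least `1 / 4`: the first one that is at least `π / 6` is at most `π / 2`. -/
theorem exists_cos_sq_le (θ : ℝ) (h0 : θ ≤ Real.pi / 2) (L : ℕ)
    (hL : Real.pi / 6 ≤ 3 ^ L * θ) : ∃ i ≤ L, Real.cos (3 ^ i * θ) ^ 2 ≤ 3 / 4 := by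
  classical
  have hex : ∃ i, Real.pi / 6 ≤ 3 ^ i * θ := ⟨L, hL⟩
  refine ⟨Nat.find hex, Nat.find_min' hex hL, ?_⟩
  have h1 := Nat.find_spec hex
  have h2 : 3 ^ Nat.find hex * θ ≤ Real.pi / 2 := by
    rcases hi : Nat.find hex with _ | i
    · simpa using h0
    · have := Nat.find_min hex (m := i) (by omega)
      rw [not_le] at this
      rw [pow_succ]
      linarith
  have h3 : Real.cos (3 ^ Nat.find hex * θ) ≤ Real.cos (Real.pi / 6) :=
    Real.cos_le_cos_of_nonneg_of_le_pi (by positivity) (by linarith [Real.pi_pos]) h1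
  have h4 : 0 ≤ Real.cos (3 ^ Nat.find hex * θ) :=
    Real.cos_nonneg_of_neg_pi_div_two_le_of_le (by linarith [Real.pi_pos]) h2
  calc _ ≤ Real.cos (Real.pi / 6) ^ 2 := pow_le_pow_left₀ h4 h3 2
    _ = 3 / 4 := by
      rw [Real.cos_pi_div_six, div_pow, Real.sq_sqrt (by norm_num)]
      norm_num

/-! ### The collision finder as a logical circuit -/

section Finder

set_option synthInstance.maxSize 1000

variable {k m d : ℕ} {T : Type}

/-- Logical wires of the collision finder: a seed; a message register and a digest register for
every candidate, the candidates being the `k` table entries and the results of the searches in `T`;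
and two output registers. -/
abbrev LWire (k m d : ℕ) (T : Type) : Type :=
  Fin m ⊕ ((Fin k ⊕ T) × Fin m) ⊕ ((Fin k ⊕ T) × Fin d) ⊕ (Bool × Fin m)

/-- The wires of the seed. -/
abbrev seedW (j : Fin m) : LWire k m d T := .inl j

/-- The wires of the message of the candidate `c`. -/
abbrev msgW (c : Fin k ⊕ T) (j : Fin m) : LWire k m d T := .inr (.inl (c, j))

/-- The wires of the digest of the candidate `c`. -/
abbrev digW (c : Fin k ⊕ T) (i : Fin d) : LWire k m d T := .inr (.inr (.inl (c, i)))

/-- The wires of the output registers. -/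
abbrev outW (b : Bool) (j : Fin m) : LWire k m d T := .inr (.inr (.inr (b, j)))

theorem seedW_injective : Function.Injective (seedW : Fin m → LWire k m d T) :=
  Sum.inl_injective

theorem msgW_injective (c : Fin k ⊕ T) :
    Function.Injective (msgW c : Fin m → LWire k m d T) := by
  intro a b h
  simpa using h

theorem digW_injective (c : Fin k ⊕ T) :
    Function.Injective (digW c : Fin d → LWire k m d T) := by
  intro a b h
  simpa using h

theorem msgW_ne_digW (c c' : Fin k ⊕ T) (i : Fin m) (j : Fin d) :
    (msgW c i : LWire k m d T) ≠ digW c' j := by simp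

/-- The messages of two candidates differ and their digests agree in the first `ℓ` bits. -/
def collides (ℓ : ℕ) (c c' : Fin k ⊕ T) : Form (LWire k m d T) :=
  Form.conj
    (Form.neg (Form.bigConj ((List.finRange m).map fun j => Form.eqv (msgW c j) (msgW c' j))))
    (Form.bigConj (((List.finRange d).filter fun i : Fin d => (i : ℕ) < ℓ).map fun i =>
      Form.eqv (digW c i) (digW c' i)))

theorem eval_collides (ℓ : ℕ) (c c' : Fin k ⊕ T) (z : LWire k m d T → Bool) :
    (collides ℓ c c').eval z = true ↔
      z ∘ msgW c ≠ z ∘ msgW c' ∧ ∀ i : Fin d, (i : ℕ) < ℓ → z (digW c i) = z (digW c' i) := by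
  simp only [collides, Form.eval_conj, Form.eval_neg, Bool.and_eq_true, Bool.not_eq_true',
    Form.eval_bigConj, ← Bool.not_eq_true]
  simp only [List.mem_map, List.mem_finRange, true_and, List.mem_filter, decide_eq_true_eq,
    forall_exists_index, forall_apply_eq_imp_iff, and_imp, forall_apply_eq_imp_iff₂,
    Form.eval_eqv, ne_eq, funext_iff, Function.comp]

theorem size_collides_le (ℓ : ℕ) (c c' : Fin k ⊕ T) :
    (collides ℓ c c' : Form (LWire k m d T)).size ≤ 18 * (m + d) + 7 := by
  have h1 := Form.size_bigConj_le ((List.finRange m).map fun j =>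
    Form.eqv (msgW c j : LWire k m d T) (msgW c' j)) 15 (by
      intro φ hφ
      obtain ⟨j, _, rfl⟩ := List.mem_map.1 hφ
      exact le_rfl)
  have h2 := Form.size_bigConj_le (((List.finRange d).filter fun i : Fin d =>
    (i : ℕ) < ℓ).map fun i => Form.eqv (digW c i : LWire k m d T) (digW c' i)) 15 (by
      intro φ hφ
      obtain ⟨j, _, rfl⟩ := List.mem_map.1 hφ
      exact le_rfl)
  have h3 := List.length_filter_le (fun i : Fin d => decide ((i : ℕ) < ℓ)) (List.finRange d)
  simp only [List.length_map, List.length_finRange] at h1 h2 h3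
  simp only [collides, Form.size_conj, Form.size_neg]
  omega

theorem avoids_collides (ℓ : ℕ) (c c' : Fin k ⊕ T) (b : Bool) (j : Fin m) :
    (collides ℓ c c').Avoids (outW b j : LWire k m d T) := by
  refine Form.avoids_conj (Form.avoids_neg (Form.avoids_bigConj _ ?_)) (Form.avoids_bigConj _ ?_)
  · intro φ hφ
    obtain ⟨i, _, rfl⟩ := List.mem_map.1 hφ
    exact Form.avoids_eqv (by simp) (by simp)
  · intro φ hφ
    obtain ⟨i, _, rfl⟩ := List.mem_map.1 hφ
    exact Form.avoids_eqv (by simp) (by simp)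

/-- The result of the search `t` collides with a table entry. -/
def marked (ℓ : ℕ) (t : T) : Form (LWire k m d T) :=
  Form.bigDisj ((List.finRange k).map fun i => collides ℓ (.inl i) (.inr t))

theorem eval_marked (ℓ : ℕ) (t : T) (z : LWire k m d T → Bool) :
    (marked ℓ t).eval z = true ↔ ∃ i : Fin k, (collides ℓ (.inl i) (.inr t)).eval z = true := by
  simp [marked, Form.eval_bigDisj]

theorem size_marked_le (ℓ : ℕ) (t : T) :
    (marked ℓ t : Form (LWire k m d T)).size ≤ k * (18 * (m + d) + 12) + 3 := by
  have h1 := Form.size_bigDisj_le ((List.finRange k).map fun i =>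
    (collides ℓ (.inl i) (.inr t) : Form (LWire k m d T))) (18 * (m + d) + 7) (by
      intro φ hφ
      obtain ⟨j, _, rfl⟩ := List.mem_map.1 hφ
      exact size_collides_le _ _ _)
  simpa [marked] using h1

/-- The `j`-th bit of the message number `b` of the first colliding pair in the list `l`. -/
def select (ℓ : ℕ) (b : Bool) (j : Fin m) (l : List ((Fin k ⊕ T) × (Fin k ⊕ T))) :
    Form (LWire k m d T) :=
  l.foldr (fun p φ =>
    Form.disj (Form.conj (collides ℓ p.1 p.2) (Form.var (msgW (bif b then p.2 else p.1) j)))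
      (Form.conj (Form.neg (collides ℓ p.1 p.2)) φ)) (Form.neg Form.tru)

theorem eval_select (ℓ : ℕ) (l : List ((Fin k ⊕ T) × (Fin k ⊕ T))) (z : LWire k m d T → Bool)
    (h : ∃ p ∈ l, (collides ℓ p.1 p.2).eval z = true) :
    ∃ p ∈ l, (collides ℓ p.1 p.2).eval z = true ∧
      ∀ b j, (select ℓ b j l).eval z = z (msgW (bif b then p.2 else p.1) j) := by
  induction l with
  | nil => simp at h
  | cons p l ih =>
    by_cases hp : (collides ℓ p.1 p.2).eval z = true
    · refine ⟨p, by simp, hp, fun b j => ?_⟩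
      simp only [select, List.foldr_cons, Form.eval_disj, Form.eval_conj, Form.eval_neg, hp]
      simp [Form.eval]
    · obtain ⟨q, hq, hqe⟩ := h
      have hql : q ∈ l := by
        rcases List.mem_cons.1 hq with rfl | hq
        · exact (hp hqe).elim
        · exact hq
      obtain ⟨q, h1, h2, h3⟩ := ih ⟨q, hql, hqe⟩
      refine ⟨q, by simp [h1], h2, fun b j => ?_⟩
      rw [← h3]
      rw [Bool.not_eq_true] at hp
      simp only [select, List.foldr_cons, Form.eval_disj, Form.eval_conj, Form.eval_neg, hp]
      simp

theorem size_select_le (ℓ : ℕ) (b : Bool) (j : Fin m) (l : List ((Fin k ⊕ T) × (Fin k ⊕ T))) :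
    (select ℓ b j l : Form (LWire k m d T)).size ≤ l.length * (36 * (m + d) + 27) + 3 := by
  induction l with
  | nil => simp [select, Form.size_neg, Form.size]
  | cons p l ih =>
    have h := size_collides_le (m := m) (d := d) ℓ p.1 p.2
    rw [select] at ih
    simp only [select, List.foldr_cons, Form.size_disj, Form.size_conj, Form.size_neg,
      List.length_cons] at ih ⊢
    have h0 : ∀ b : LWire k m d T, (Form.var b).size = 0 := fun _ => rfl
    rw [h0]
    nlinarith

theorem avoids_select (ℓ : ℕ) (b b' : Bool) (j j' : Fin m)
    (l : List ((Fin k ⊕ T) × (Fin k ⊕ T))) :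
    (select ℓ b j l).Avoids (outW b' j' : LWire k m d T) := by
  induction l with
  | nil => exact Form.avoids_neg trivial
  | cons p l ih =>
    exact Form.avoids_disj (Form.avoids_conj (avoids_collides _ _ _ _ _)
      (by simp [Form.Avoids])) (Form.avoids_conj (Form.avoids_neg (avoids_collides _ _ _ _ _)) ih)

/-- The `j`-th bit of the seed, shifted by `e`. -/
def shifted (e : Fin k → Bits m) (p : Fin k × Fin m) : Form (LWire k m d T) :=
  bif e p.1 p.2 then Form.neg (Form.var (seedW p.2)) else Form.var (seedW p.2)

theorem eval_shifted (e : Fin k → Bits m) (p : Fin k × Fin m) (z : LWire k m d T → Bool) :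
    (shifted e p).eval z = xor (z (seedW p.2)) (e p.1 p.2) := by
  unfold shifted
  cases e p.1 p.2 <;> simp [Form.eval]

theorem avoids_shifted (e : Fin k → Bits m) (p : Fin k × Fin m) (c : Fin k ⊕ T) (j : Fin m) :
    (shifted e p).Avoids (msgW c j : LWire k m d T) := by
  unfold shifted
  cases e p.1 p.2
  · simp [Form.Avoids]
  · exact Form.avoids_neg (by simp [Form.Avoids])

theorem size_shifted_le (e : Fin k → Bits m) (p : Fin k × Fin m) :
    (shifted e p : Form (LWire k m d T)).size ≤ 2 := by
  unfold shifted
  cases e p.1 p.2 <;> simp [Form.size, Form.size_neg]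

/-- Fill the table with the shifts of a random seed, and compute their digests. -/
def tableOps [DecidableEq T] (e : Fin k → Bits m) : List (HOp (LWire k m d T) m d) :=
  (hadLayer d seedW).reverse ++
    ((Finset.univ : Finset (Fin k × Fin m)).toList.map (fun p =>
        HOp.xor (shifted e p) (msgW (.inl p.1) p.2) (avoids_shifted e p _ _)) ++
      (List.finRange k).map fun i =>
        HOp.oracle (msgW (.inl i)) (digW (.inl i)) (digW_injective _) (msgW_ne_digW _ _))

/-- Grover searches for messages that collide with a table entry, the search `t` with `J t`
iterations. -/
def searchOps [DecidableEq T] (ℓ : ℕ) (J : T → ℕ) (l : List T) : List (HOp (LWire k m d T) m d) :=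
  l.flatMap fun t => groverSearch (msgW (.inr t)) (digW (.inr t)) (digW_injective _)
    (msgW_ne_digW _ _) (marked ℓ t) (J t)

/-- Output the first colliding pair of candidates. -/
def outputOps [Fintype T] [DecidableEq T] (ℓ : ℕ) : List (HOp (LWire k m d T) m d) :=
  (Finset.univ : Finset (Bool × Fin m)).toList.map fun p =>
    HOp.xor (select ℓ p.1 p.2 Finset.univ.toList) (outW p.1 p.2) (avoids_select ℓ _ _ _ _ _)

/-! ### Analysis of the collision finder -/

variable (f : Bits m → Bits d) (ℓ : ℕ)

/-- A basis state in which the searches in `l` have not been run yet: their registers are zero, and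
the digests of all other candidates are correct. -/
def Pending (l : List T) (z : LWire k m d T → Bool) : Prop :=
  (∀ c, (∀ t ∈ l, c ≠ .inr t) → z ∘ digW c = f (z ∘ msgW c)) ∧
    (∀ t ∈ l, (∀ j, z (msgW (.inr t) j) = false) ∧ ∀ i, z (digW (.inr t) i) = false) ∧
      ∀ b j, z (outW b j) = false

/-- Two candidates other than the results of the searches in `l` collide. -/
def HasCollision (l : List T) (z : LWire k m d T → Bool) : Prop :=
  ∃ c c', (∀ t ∈ l, c ≠ .inr t) ∧ (∀ t ∈ l, c' ≠ .inr t) ∧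
    NearCollision f ℓ (z ∘ msgW c) (z ∘ msgW c')

/-- The basis states from which a near-collision can be output. -/
def winning : Set (LWire k m d T → Bool) := {z | Pending f [] z ∧ HasCollision f ℓ [] z}

open Classical in
/-- The messages that collide with one of the messages `x i`. -/
def partners (x : Fin k → Bits m) (y : Bits m) : Bool := decide (∃ i, NearCollision f ℓ (x i) y)

theorem partners_eq_true (x : Fin k → Bits m) (y : Bits m) :
    partners f ℓ x y = true ↔ ∃ i, NearCollision f ℓ (x i) y := by
  simp [partners]

/-- The messages in the table. -/
def table (z : LWire k m d T → Bool) (i : Fin k) : Bits m := z ∘ msgW (.inl i)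

/-- The basis state after the search `t` has returned the message `x`. -/
def found (t : T) (z : LWire k m d T → Bool) (x : Bits m) : LWire k m d T → Bool :=
  setReg (digW (.inr t)) (f x) (setReg (msgW (.inr t)) x z)

theorem found_apply (t : T) (z : LWire k m d T → Bool) (x : Bits m) (w : LWire k m d T)
    (h1 : ∀ j, msgW (.inr t) j ≠ w) (h2 : ∀ i, digW (.inr t) i ≠ w) : found f t z x w = z w := by
  rw [found, setReg_of_ne _ _ _ h2, setReg_of_ne _ _ _ h1]

theorem found_comp_msgW (t : T) (z : LWire k m d T → Bool) (x : Bits m) :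
    found f t z x ∘ msgW (.inr t) = x := by
  funext j
  rw [Function.comp, found, setReg_of_ne _ _ _ (fun i => by simp)]
  exact (msgW_injective _).extend_apply _ _ _

theorem found_comp_digW (t : T) (z : LWire k m d T → Bool) (x : Bits m) :
    found f t z x ∘ digW (.inr t) = f x := by
  funext j
  exact (digW_injective _).extend_apply _ _ _

theorem found_comp_msgW_of_ne (t : T) (z : LWire k m d T → Bool) (x : Bits m) (c : Fin k ⊕ T)
    (hc : c ≠ .inr t) : found f t z x ∘ msgW c = z ∘ msgW c := by
  funext j
  exact found_apply f t z x _ (by simp [hc.symm]) (by simp)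

theorem found_comp_digW_of_ne (t : T) (z : LWire k m d T → Bool) (x : Bits m) (c : Fin k ⊕ T)
    (hc : c ≠ .inr t) : found f t z x ∘ digW c = z ∘ digW c := by
  funext j
  exact found_apply f t z x _ (by simp) (by simp [hc.symm])

theorem table_found (t : T) (z : LWire k m d T → Bool) (x : Bits m) :
    table (found f t z x) = table z := by
  funext i
  exact found_comp_msgW_of_ne f t z x _ (by simp)

theorem Pending.found {t : T} {l : List T} {z : LWire k m d T → Bool} (hz : Pending f (t :: l) z)
    (ht : t ∉ l) (x : Bits m) : Pending f l (found f t z x) := by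
  obtain ⟨h1, h2, h3⟩ := hz
  refine ⟨?_, ?_, ?_⟩
  · intro c hc
    by_cases hct : c = .inr t
    · subst hct
      rw [found_comp_digW, found_comp_msgW]
    · rw [found_comp_digW_of_ne _ _ _ _ _ hct, found_comp_msgW_of_ne _ _ _ _ _ hct]
      exact h1 c (by simpa [hct] using hc)
  · intro t' ht'
    have hne : (.inr t' : Fin k ⊕ T) ≠ .inr t := fun h => ht (Sum.inr_injective h ▸ ht')
    have h4 := h2 t' (by simp [ht'])
    exact ⟨fun j => (congrFun (found_comp_msgW_of_ne f t z x _ hne) j).trans (h4.1 j),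
      fun j => (congrFun (found_comp_digW_of_ne f t z x _ hne) j).trans (h4.2 j)⟩
  · intro b j
    rw [found_apply _ _ _ _ _ (by simp) (by simp), h3]

theorem HasCollision.found {t : T} {l : List T} {z : LWire k m d T → Bool}
    (hz : HasCollision f ℓ (t :: l) z) (x : Bits m) : HasCollision f ℓ l (found f t z x) := by
  obtain ⟨c, c', h1, h2, h3⟩ := hz
  refine ⟨c, c', fun t ht => h1 t (by simp [ht]), fun t ht => h2 t (by simp [ht]), ?_⟩
  rwa [found_comp_msgW_of_ne _ _ _ _ _ (h1 t (by simp)),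
    found_comp_msgW_of_ne _ _ _ _ _ (h2 t (by simp))]

theorem hasCollision_found {t : T} {l : List T} {z : LWire k m d T → Bool} (ht : t ∉ l)
    (x : Bits m) (hx : partners f ℓ (table z) x = true) : HasCollision f ℓ l (found f t z x) := by
  obtain ⟨i, hi⟩ := (partners_eq_true f ℓ _ x).1 hx
  refine ⟨.inl i, .inr t, by simp, fun t' ht' h => ht (Sum.inr_injective h ▸ ht'), ?_⟩
  rw [found_comp_msgW, found_comp_msgW_of_ne _ _ _ _ _ (by simp)]
  exact hi

theorem eval_marked_found {t : T} {l : List T} {z : LWire k m d T → Bool}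
    (hz : Pending f (t :: l) z) (x : Bits m) :
    (marked ℓ t).eval (found f t z x) = partners f ℓ (table z) x := by
  rw [Bool.eq_iff_iff, eval_marked, partners_eq_true]
  refine exists_congr fun i => ?_
  rw [eval_collides, found_comp_msgW, found_comp_msgW_of_ne _ _ _ _ _ (by simp), NearCollision]
  refine and_congr Iff.rfl (forall₂_congr fun j _ => ?_)
  have e1 : found f t z x (digW (.inr t) j) = f x j := congrFun (found_comp_digW f t z x) j
  have e2 : found f t z x (digW (.inl i) j) = f (table z i) j :=
    (congrFun (found_comp_digW_of_ne f t z x (.inl i) (by simp)) j).trans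
      (congrFun (hz.1 (.inl i) (by simp)) j)
  rw [e1, e2]

variable [DecidableEq T]

/-- The probability that a search with `J` iterations for the partners of the messages `x i`
fails. -/
def failProb (x : Fin k → Bits m) (J : ℕ) : ℝ :=
  Real.cos ((2 * J + 1) * groverAngle (partners f ℓ x)) ^ 2

theorem groverSearch_avoids {B : Type} [DecidableEq B] (X : Fin m → B) (Y : Fin d → B)
    (hY : Function.Injective Y) (h : ∀ i j, X i ≠ Y j) (φ : Form B) (J : ℕ) (b : B)
    (hXb : ∀ i, X i ≠ b) (hYb : ∀ i, Y i ≠ b) : ∀ o ∈ groverSearch X Y hY h φ J, o.Avoids b := by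
  have hh : ∀ o ∈ (hadLayer d X : List (HOp B m d)), o.Avoids b := by
    intro o ho
    obtain ⟨w, hw, rfl⟩ := List.mem_map.1 ho
    obtain ⟨i, rfl⟩ := (List.mem_ofFn' _ _).1 hw
    exact hXb i
  intro o ho
  simp only [groverSearch, List.mem_append, List.mem_reverse, List.mem_flatten,
    List.mem_replicate, List.mem_singleton] at ho
  rcases ho with ho | ⟨l, ⟨_, rfl⟩, ho⟩ | rfl
  · exact hh o ho
  · simp only [groverIter, diffusion, List.mem_cons, List.mem_append, List.mem_reverse] at ho
    rcases ho with rfl | rfl | rfl | ho | rfl | ho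
    · exact hYb
    · trivial
    · exact hYb
    · exact hh o ho
    · trivial
    · exact hh o ho
  · exact hYb

theorem searchOps_avoids (J : T → ℕ) (l : List T) (b : LWire k m d T)
    (h : ∀ t ∈ l, (∀ j, msgW (.inr t) j ≠ b) ∧ ∀ i, digW (.inr t) i ≠ b) :
    ∀ o ∈ (searchOps ℓ J l : List (HOp (LWire k m d T) m d)), o.Avoids b := by
  intro o ho
  obtain ⟨t, ht, ho⟩ := List.mem_flatMap.1 ho
  exact groverSearch_avoids _ _ _ _ _ _ b (h t ht).1 (h t ht).2 o ho

variable [Fintype T]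

open Classical in
/-- The probabilities of failure of the searches multiply. The first search leaves a superposition
of the states `found f t z x`; the other searches do not write to the register of `t`, which
therefore keeps these branches apart. -/
theorem weight_run_searchOps_le (J : T → ℕ) (l : List T) (hl : l.Nodup)
    (z : LWire k m d T → Bool) (hz : Pending f l z) :
    weight (HOp.run f (searchOps ℓ J l) (ket z)) (winning f ℓ)ᶜ ≤
      (if HasCollision f ℓ l z then 0 else 1) *
        (l.map fun t => failProb f ℓ (table z) (J t)).prod := by
  induction l generalizing z with
  | nil =>
    have : HOp.run f (searchOps ℓ J ([] : List T)) (ket z) = ket z := rfl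
    rw [this, weight_ket, List.map_nil, List.prod_nil, mul_one]
    by_cases hc : HasCollision f ℓ [] z
    · have : z ∉ (winning f ℓ)ᶜ := by simpa [winning] using ⟨hz, hc⟩
      rw [if_neg this, if_pos hc]
    · rw [if_neg hc]
      split <;> norm_num
  | cons t l ih =>
    obtain ⟨htl, hl⟩ := List.nodup_cons.1 hl
    have hrun : HOp.run f (searchOps ℓ J (t :: l)) (ket z) =
        ∑ x, (groverAmp (partners f ℓ (table z)) (J t) x : ℂ) •
          HOp.run f (searchOps ℓ J l) (ket (found f t z x)) := by
      have h0 := hz.2.1 t (by simp)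
      rw [searchOps, List.flatMap_cons, HOp.run_append,
        run_groverSearch (msgW_injective _) f _ _ _ z (partners f ℓ (table z)) h0.1 h0.2
          (fun x => eval_marked_found f ℓ hz x), HOp.run_sum_smul]
      rfl
    have hdisj : ∀ x y w, HOp.run f (searchOps ℓ J l) (ket (found f t z x)) w ≠ 0 →
        HOp.run f (searchOps ℓ J l) (ket (found f t z y)) w ≠ 0 → x = y := by
      have h1 : ∀ x w, HOp.run f (searchOps ℓ J l) (ket (found f t z x)) w ≠ 0 →
          w ∘ msgW (.inr t) = x := by
        intro x w hw
        rw [← found_comp_msgW f t z x]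
        funext j
        refine HOp.apply_eq_of_avoids f _ _ (searchOps_avoids ℓ J l _ fun t' ht' => ?_) _
          (ket (found f t z x)) ?_ w hw
        · have : t' ≠ t := fun h => htl (h ▸ ht')
          simp [this]
        · intro y hy
          have : y = found f t z x := by
            by_contra hne
            simp [ket, hne] at hy
          rw [this]
          rfl
      intro x y w hx hy
      rw [← h1 x w hx, h1 y w hy]
    rw [hrun, weight_sum_smul _ _ hdisj, List.map_cons, List.prod_cons]
    set Q := (l.map fun t => failProb f ℓ (table z) (J t)).prod with hQ
    have hQ0 : 0 ≤ Q := List.prod_nonneg fun q hq => by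
      obtain ⟨t, _, rfl⟩ := List.mem_map.1 hq
      exact sq_nonneg _
    have hx : ∀ x, weight (HOp.run f (searchOps ℓ J l) (ket (found f t z x))) (winning f ℓ)ᶜ ≤
        (if HasCollision f ℓ l (found f t z x) then 0 else 1) * Q := by
      intro x
      have := ih hl (found f t z x) (hz.found f htl x)
      rwa [table_found] at this
    by_cases hc : HasCollision f ℓ (t :: l) z
    · rw [if_pos hc, zero_mul]
      refine Finset.sum_nonpos fun x _ => ?_
      have := hx x
      rw [if_pos (hc.found f ℓ x), zero_mul] at this
      exact mul_nonpos_of_nonneg_of_nonpos (by positivity) this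
    · rw [if_neg hc, one_mul, failProb, ← sum_groverAmp_sq, Finset.sum_mul]
      refine Finset.sum_le_sum fun x _ => ?_
      have h1 := hx x
      rw [Complex.norm_real, Real.norm_eq_abs, sq_abs]
      by_cases hp : partners f ℓ (table z) x = true
      · rw [if_pos (hasCollision_found f ℓ htl x hp), zero_mul] at h1
        rw [if_pos hp, zero_mul]
        exact mul_nonpos_of_nonneg_of_nonpos (by positivity) h1
      · rw [if_neg hp]
        refine mul_le_mul_of_nonneg_left (h1.trans ?_) (by positivity)
        split
        · rwa [zero_mul]
        · rw [one_mul]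

/-- The basis states that the table stage prepares: for every seed, the table of its shifts. -/
theorem run_tableOps_ket (e : Fin k → Bits m) (z : LWire k m d T → Bool)
    (hz : ∀ w, (∀ j, seedW j ≠ w) → z w = false) :
    ∃ z', HOp.run f ((Finset.univ : Finset (Fin k × Fin m)).toList.map (fun p =>
        HOp.xor (shifted e p) (msgW (.inl p.1) p.2) (avoids_shifted e p _ _)) ++
      (List.finRange k).map fun i =>
        HOp.oracle (msgW (.inl i)) (digW (.inl i)) (digW_injective _) (msgW_ne_digW _ _))
        (ket z) = ket z' ∧ z' ∘ seedW = z ∘ seedW ∧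
      (∀ i, table z' i = fun j => xor (z (seedW j)) (e i j)) ∧
      Pending f Finset.univ.toList z' := by
  obtain ⟨z₁, h1, h2, h3⟩ := HOp.run_xor_ket (B := LWire k m d T) (m := m) (d := d) f (shifted e)
    (fun p : Fin k × Fin m => msgW (.inl p.1) p.2) (fun p q h => by simpa [Prod.ext_iff] using h)
    (fun p q => avoids_shifted e p _ _) Finset.univ.toList (Finset.nodup_toList _) z
  obtain ⟨z₂, h4, h5, h6⟩ := HOp.run_oracle_ket (B := LWire k m d T) f
    (fun i : Fin k => msgW (.inl i)) (fun i => digW (.inl i)) (fun i => digW_injective _)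
    (fun i j hij a b => by simp [hij]) (fun i j => msgW_ne_digW _ _) (List.finRange k)
    (List.nodup_finRange k) z₁
  refine ⟨z₂, ?_, ?_, ?_, ?_, ?_, ?_⟩
  · rw [HOp.run_append, h1, h4]
  · funext j
    rw [Function.comp, h6 _ (by simp), h3 _ (by simp)]
    rfl
  · intro i
    funext j
    rw [table, Function.comp, h6 _ (by simp), h2 (i, j) (by simp), eval_shifted, hz _ (by simp),
      Bool.false_xor]
  · intro c hc
    rcases c with i | t
    · have e1 : z₂ ∘ msgW (.inl i) = z₁ ∘ msgW (.inl i) := by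
        funext j
        exact h6 _ (by simp)
      rw [e1]
      funext j
      rw [Function.comp, h5 i (by simp), h3 _ (by simp), hz _ (by simp), Bool.false_xor]
    · exact (hc t (by simp) rfl).elim
  · intro t _
    refine ⟨fun j => ?_, fun j => ?_⟩
    · rw [h6 _ (by simp), h3 _ (by simp), hz _ (by simp)]
    · rw [h6 _ (by simp), h3 _ (by simp), hz _ (by simp)]
  · intro b j
    rw [h6 _ (by simp), h3 _ (by simp), hz _ (by simp)]

/-- A list of bit flips is undone by its reversal. -/
theorem reverse_run_xor {B J : Type} [DecidableEq B] (F : J → Form B) (tgt : J → B)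
    (hF : ∀ j, (F j).Avoids (tgt j)) (l : List J) (ψ : State B) :
    HOp.run f (l.map fun j => HOp.xor (F j) (tgt j) (hF j)).reverse
      (HOp.run f (l.map fun j => HOp.xor (F j) (tgt j) (hF j)) ψ) = ψ := by
  induction l generalizing ψ with
  | nil => rfl
  | cons j l ih =>
    rw [List.map_cons, List.reverse_cons, HOp.run_append, HOp.run_cons f _ (l.map _) ψ, ih]
    funext z
    have := update_xor_involutive (F j) (tgt j) (hF j) z
    simp only [HOp.run, List.foldl_cons, List.foldl_nil, HOp.eff]
    exact congrArg ψ this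

/-- On basis states the output stage is classical, and it outputs a near-collision if it can. -/
theorem run_outputOps_ket (z : LWire k m d T → Bool) :
    ∃ z', HOp.run f (outputOps ℓ) (ket z) = ket z' ∧
      (z ∈ winning f ℓ → NearCollision f ℓ (z' ∘ outW false) (z' ∘ outW true)) := by
  obtain ⟨z', h1, h2, -⟩ := HOp.run_xor_ket (B := LWire k m d T) (m := m) (d := d) f
    (fun p : Bool × Fin m => select ℓ p.1 p.2 Finset.univ.toList)
    (fun p : Bool × Fin m => outW p.1 p.2) (fun p q h => by simpa [Prod.ext_iff] using h)
    (fun p q => avoids_select ℓ _ _ _ _ _) Finset.univ.toList (Finset.nodup_toList _) z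
  refine ⟨z', h1, ?_⟩
  rintro ⟨⟨hd, -, ho⟩, c, c', -, -, hcc⟩
  have hdig : ∀ c j, z (digW c j) = f (z ∘ msgW c) j := fun c j =>
    congrFun (hd c (by simp)) j
  have heval : ∀ c c', (collides ℓ c c').eval z = true ↔
      NearCollision f ℓ (z ∘ msgW c) (z ∘ msgW c') := by
    intro c c'
    rw [eval_collides]
    simp only [hdig]
    rfl
  obtain ⟨p, -, hp, hs⟩ := eval_select ℓ Finset.univ.toList z ⟨(c, c'), by simp, (heval c c').2 hcc⟩
  have hout : ∀ b j, z' (outW b j) = z (msgW (bif b then p.2 else p.1) j) := by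
    intro b j
    rw [h2 (b, j) (by simp), ho, hs, Bool.false_xor]
  have e1 : z' ∘ outW false = z ∘ msgW p.1 := funext fun j => hout false j
  have e2 : z' ∘ outW true = z ∘ msgW p.2 := funext fun j => hout true j
  rw [e1, e2]
  exact (heval _ _).1 hp

theorem weight_run_outputOps_le (ψ : State (LWire k m d T)) :
    weight (HOp.run f (outputOps ℓ) ψ)
        {z | ¬ NearCollision f ℓ (z ∘ outW false) (z ∘ outW true)} ≤
      weight ψ (winning f ℓ)ᶜ := by
  classical
  choose τ h1 h2 using run_outputOps_ket (k := k) (T := T) f ℓ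
  -- The output stage permutes the basis states, being reversible.
  have hinj : ∀ z z' w, ket (τ z) w ≠ 0 → ket (τ z') w ≠ 0 → z = z' := by
    intro z z' w hz hz'
    have e1 : w = τ z := by
      by_contra hne
      simp [ket, hne] at hz
    have e2 : w = τ z' := by
      by_contra hne
      simp [ket, hne] at hz'
    have e3 : (ket z : State (LWire k m d T)) = ket z' := by
      have hr := reverse_run_xor (B := LWire k m d T) f
        (fun p : Bool × Fin m => select ℓ p.1 p.2 Finset.univ.toList)
        (fun p => outW p.1 p.2) (fun p => avoids_select ℓ _ _ _ _ _) Finset.univ.toList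
      rw [← hr (ket z), ← hr (ket z')]
      congr 1
      exact (h1 z).trans ((congrArg ket (e1.symm.trans e2)).trans (h1 z').symm)
    have := congrFun e3 z
    by_contra hne
    simp [ket, hne] at this
  have hrun : HOp.run f (outputOps ℓ) ψ = ∑ z, ψ z • ket (τ z) := by
    conv_lhs => rw [← sum_smul_ket ψ]
    rw [HOp.run_sum_smul]
    exact Finset.sum_congr rfl fun z _ => by rw [h1]
  rw [hrun, weight_sum_smul _ _ hinj, weight]
  refine Finset.sum_le_sum fun z _ => ?_
  rw [weight_ket]
  by_cases hz : z ∈ winning f ℓ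
  · have : τ z ∉ {z : LWire k m d T → Bool |
        ¬ NearCollision f ℓ (z ∘ outW false) (z ∘ outW true)} := by
      simpa using h2 z hz
    rw [if_neg this, mul_zero]
    exact Set.indicator_nonneg (fun _ _ => by positivity) z
  · rw [Set.indicator_of_mem (by simpa using hz)]
    split
    · rw [mul_one]
    · rw [mul_zero]
      positivity

/-- All operations of the collision finder. -/
def finderOps (e : Fin k → Bits m) (ℓ : ℕ) (J : T → ℕ) : List (HOp (LWire k m d T) m d) :=
  tableOps e ++ (searchOps ℓ J Finset.univ.toList ++ outputOps ℓ)

open Classical in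
/-- The collision finder fails only if, for the random seed, the table has no collision and all
searches fail. -/
theorem weight_run_finderOps_le (e : Fin k → Bits m) (J : T → ℕ) :
    weight (HOp.run f (finderOps e ℓ J) (ket fun _ => false))
        {z | ¬ NearCollision f ℓ (z ∘ outW false) (z ∘ outW true)} ≤
      ∑ s : Bits m, (1 / 2) ^ m *
        ((if ∃ i i', NearCollision f ℓ (fun j => xor (s j) (e i j)) (fun j => xor (s j) (e i' j))
            then 0 else 1) *
          ∏ t, failProb f ℓ (fun i j => xor (s j) (e i j)) (J t)) := by
  rw [finderOps, HOp.run_append, HOp.run_append]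
  refine (weight_run_outputOps_le f ℓ _).trans ?_
  have hz : ∀ s : Bits m, ∀ w : LWire k m d T, (∀ j, seedW j ≠ w) →
      setReg seedW s (fun _ => false) w = false := fun s w hw => setReg_of_ne _ _ _ hw
  choose z h1 h2 h3 h4 using fun s => run_tableOps_ket (T := T) f e _ (hz s)
  have hseed : ∀ s : Bits m, z s ∘ seedW = s := by
    intro s
    rw [h2, setReg_comp seedW_injective]
  have htab : HOp.run f (tableOps e) (ket fun _ => false) =
      ∑ s, (((1 / Real.sqrt 2) ^ m : ℝ) : ℂ) • (ket (z s) : State (LWire k m d T)) := by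
    rw [tableOps, HOp.run_append, run_hadLayer_reverse_ket seedW_injective f _ (fun _ => rfl),
      spread_eq_sum seedW_injective, HOp.run_sum_smul]
    exact Finset.sum_congr rfl fun s _ => by rw [h1]
  have hdisj : ∀ s s' w, HOp.run f (searchOps ℓ J Finset.univ.toList) (ket (z s)) w ≠ 0 →
      HOp.run f (searchOps ℓ J Finset.univ.toList) (ket (z s')) w ≠ 0 → s = s' := by
    have h5 : ∀ s w, HOp.run f (searchOps ℓ J Finset.univ.toList) (ket (z s)) w ≠ 0 →
        w ∘ seedW = s := by
      intro s w hw
      conv_rhs => rw [← hseed s]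
      funext j
      refine HOp.apply_eq_of_avoids f _ _ (searchOps_avoids ℓ J _ _ (by simp)) _ (ket (z s)) ?_ w hw
      intro y hy
      have : y = z s := by
        by_contra hne
        simp [ket, hne] at hy
      rw [this]
      rfl
    intro s s' w hs hs'
    rw [← h5 s w hs, h5 s' w hs']
  rw [htab, HOp.run_sum_smul, weight_sum_smul _ _ hdisj]
  refine Finset.sum_le_sum fun s _ => ?_
  have hamp : ‖(((1 / Real.sqrt 2) ^ m : ℝ) : ℂ)‖ ^ 2 = (1 / 2) ^ m := by
    rw [Complex.norm_real, Real.norm_eq_abs, sq_abs, ← pow_mul, mul_comm, pow_mul, div_pow,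
      Real.sq_sqrt (by norm_num), one_pow]
  rw [hamp]
  refine mul_le_mul_of_nonneg_left ?_ (by positivity)
  have hsd : ∀ j, setReg seedW s (fun _ => false) (seedW j : LWire k m d T) = s j := fun j =>
    congrFun (setReg_comp (seedW_injective (k := k) (d := d) (T := T)) s _) j
  have htz : table (z s) = fun i j => xor (s j) (e i j) := by
    funext i
    rw [h3]
    simp only [hsd]
  have h6 := weight_run_searchOps_le f ℓ J _ (Finset.nodup_toList Finset.univ) (z s) (h4 s)
  have hprod : (Finset.univ.toList.map fun t => failProb f ℓ (table (z s)) (J t)).prod =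
      ∏ t, failProb f ℓ (fun i j => xor (s j) (e i j)) (J t) := by
    rw [Finset.prod_map_toList, htz]
  rw [hprod] at h6
  refine h6.trans (mul_le_mul_of_nonneg_right ?_ (Finset.prod_nonneg fun t _ => sq_nonneg _))
  by_cases hc : ∃ i i', NearCollision f ℓ (fun j => xor (s j) (e i j))
      (fun j => xor (s j) (e i' j))
  · have hc' : HasCollision f ℓ Finset.univ.toList (z s) := by
      obtain ⟨i, i', hii⟩ := hc
      refine ⟨.inl i, .inl i', by simp, by simp, ?_⟩
      have e1 : ∀ i, z s ∘ msgW (.inl i) = fun j => xor (s j) (e i j) := fun i => congrFun htz i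
      rw [e1, e1]
      exact hii
    rw [if_pos hc', if_pos hc]
  · rw [if_neg hc]
    split <;> norm_num

end Finder

/-! ### The success probability of the collision finder -/

section Success

set_option synthInstance.maxSize 1000

variable {k m d : ℕ} (f : Bits m → Bits d) (ℓ : ℕ)

/-- The messages that are not part of any near-collision. -/
def lonely : Set (Bits m) := {x | ∀ y, ¬ NearCollision f ℓ x y}

theorem NearCollision.symm {f : Bits m → Bits d} {ℓ : ℕ} {x y : Bits m}
    (h : NearCollision f ℓ x y) : NearCollision f ℓ y x :=
  ⟨h.1.symm, fun i hi => (h.2 i hi).symm⟩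

open Classical in
/-- Distinct lonely messages have distinct prefixes. -/
theorem card_lonely_le : (Finset.univ.filter (· ∈ lonely f ℓ)).card ≤ 2 ^ ℓ := by
  have hc : (Finset.univ : Finset (Bits ℓ)).card = 2 ^ ℓ := by simp [Bits]
  rw [← hc]
  refine Finset.card_le_card_of_injOn
    (fun x i => if h : (i : ℕ) < d then f x ⟨i, h⟩ else false) (fun _ _ => Finset.mem_univ _) ?_
  intro x hx y _ hxy
  by_contra hne
  refine (Finset.mem_filter.1 hx).2 y ⟨hne, fun i hi => ?_⟩
  simpa using congrFun hxy ⟨i, hi⟩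

theorem xor_right_involutive (e : Bits m) :
    Function.Involutive fun (s : Bits m) j => xor (s j) (e j) := by
  intro s
  funext j
  simp

open Classical in
/-- For few seeds only, more than half of the shifts are lonely, since each shift of a uniform seed
is uniform. -/
theorem card_bad_le (hk : 0 < k) (e : Fin k → Bits m) :
    (Finset.univ.filter fun s : Bits m =>
      k < 2 * (Finset.univ.filter fun i => (fun j => xor (s j) (e i j)) ∈ lonely f ℓ).card).card ≤
        2 * 2 ^ ℓ := by
  set c : Bits m → ℕ := fun s =>
    (Finset.univ.filter fun i => (fun j => xor (s j) (e i j)) ∈ lonely f ℓ).card with hc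
  have hsum : ∑ s, c s = k * (Finset.univ.filter (· ∈ lonely f ℓ)).card := by
    simp only [hc, Finset.card_filter]
    rw [Finset.sum_comm]
    have : ∀ i : Fin k, ∑ s : Bits m, (if (fun j => xor (s j) (e i j)) ∈ lonely f ℓ then 1 else 0) =
        ∑ s : Bits m, if s ∈ lonely f ℓ then 1 else 0 := fun i =>
      Equiv.sum_comp (xor_right_involutive (e i)).toPerm
        fun s => if s ∈ lonely f ℓ then 1 else 0
    simp only [this, Finset.sum_const, Finset.card_univ, Fintype.card_fin, smul_eq_mul]
  have h1 : (Finset.univ.filter fun s => k < 2 * c s).card * k ≤ 2 * ∑ s, c s := by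
    rw [Finset.mul_sum, ← smul_eq_mul, ← Finset.sum_const]
    refine (Finset.sum_le_sum fun s hs => (Finset.mem_filter.1 hs).2.le).trans ?_
    exact Finset.sum_le_sum_of_subset (Finset.filter_subset _ _)
  have h2 := card_lonely_le f ℓ
  rw [hsum] at h1
  refine Nat.le_of_mul_le_mul_right ?_ hk
  calc _ ≤ _ := h1
    _ ≤ 2 * (k * 2 ^ ℓ) := by gcongr
    _ = _ := by ring

open Classical in
/-- In a table without collisions, entries that are not lonely have distinct partners. -/
theorem le_card_partners (x : Fin k → Bits m) (hx : Function.Injective x)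
    (hcoll : ¬ ∃ i i', NearCollision f ℓ (x i) (x i'))
    (hbad : ¬ k < 2 * (Finset.univ.filter fun i => x i ∈ lonely f ℓ).card) :
    k ≤ 2 * (Finset.univ.filter fun y => partners f ℓ x y = true).card := by
  have h1 : ∀ i, ∃ y, x i ∉ lonely f ℓ → NearCollision f ℓ (x i) y := by
    intro i
    by_cases hi : x i ∈ lonely f ℓ
    · exact ⟨x i, fun h => (h hi).elim⟩
    · have := hi
      simp only [lonely, Set.mem_ofPred_eq, not_forall, not_not] at this
      exact this.imp fun _ h _ => h
  choose p hp using h1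
  have h2 : (Finset.univ.filter fun i => x i ∉ lonely f ℓ).card ≤
      (Finset.univ.filter fun y => partners f ℓ x y = true).card := by
    refine Finset.card_le_card_of_injOn p ?_ ?_
    · intro i hi
      exact Finset.mem_filter.2 ⟨Finset.mem_univ _,
        (partners_eq_true f ℓ x _).2 ⟨i, hp i (Finset.mem_filter.1 hi).2⟩⟩
    · intro i hi i' hi' hii
      by_contra hne
      have hi := hp i (Finset.mem_filter.1 hi).2
      have hi' := hp i' (Finset.mem_filter.1 hi').2
      refine hcoll ⟨i, i', hx.ne hne, fun j hj => ?_⟩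
      rw [hi.2 j hj, hi'.2 j hj, hii]
  have h3 := Finset.card_filter_add_card_filter_not (s := Finset.univ)
    (fun i => x i ∈ lonely f ℓ)
  rw [Finset.card_univ, Fintype.card_fin] at h3
  omega

open Classical in
/-- With at least `k / 2` partners, one of the Grover searches with `3 ^ i / 2` iterations, `i ≤ L`,
succeeds with probability at least `1 / 4`. -/
theorem exists_failProb_le {L : ℕ} (hL : 2 ^ (m + 1) ≤ 9 ^ L * k) (x : Fin k → Bits m)
    (hx : k ≤ 2 * (Finset.univ.filter fun y => partners f ℓ x y = true).card) :
    ∃ i ≤ L, failProb f ℓ x (3 ^ i / 2) ≤ 3 / 4 := by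
  set θ := groverAngle (partners f ℓ x) with hθ
  have h0 : 0 ≤ θ := groverAngle_nonneg _
  have h1 : (1 : ℝ) ≤ (3 ^ L * Real.sin θ) ^ 2 := by
    have h2 : (k : ℝ) ≤ 2 * (Finset.univ.filter fun y => partners f ℓ x y = true).card := by
      exact_mod_cast hx
    have h3 : (2 : ℝ) ^ (m + 1) ≤ 9 ^ L * k := by exact_mod_cast hL
    have h4 : Real.sin θ ^ 2 =
        (Finset.univ.filter fun y => partners f ℓ x y = true).card / 2 ^ m := by
      rw [hθ, sin_groverAngle, Real.sq_sqrt (by positivity)]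
    rw [mul_pow, h4, ← pow_mul, mul_comm L 2, pow_mul, mul_div_assoc', le_div_iff₀ (by positivity)]
    norm_num
    rw [pow_succ] at h3
    nlinarith [mul_le_mul_of_nonneg_left h2 (by positivity : (0 : ℝ) ≤ 9 ^ L)]
  have h2 : Real.pi / 6 ≤ 3 ^ L * θ := by
    have h3 : Real.sin θ ≤ θ := Real.sin_le h0
    have h5 : 0 ≤ Real.sin θ :=
      Real.sin_nonneg_of_nonneg_of_le_pi h0 ((groverAngle_le _).trans (by linarith [Real.pi_pos]))
    have h4 : (1 : ℝ) ≤ 3 ^ L * Real.sin θ := by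
      by_contra hlt
      have : (3 ^ L * Real.sin θ) ^ 2 < 1 :=
        pow_lt_one₀ (by positivity) (not_le.1 hlt) (by norm_num)
      linarith
    calc Real.pi / 6 ≤ 1 := by linarith [Real.pi_le_four]
      _ ≤ _ := h4
      _ ≤ _ := by gcongr
  obtain ⟨i, hi, h3⟩ := exists_cos_sq_le θ (groverAngle_le _) L h2
  refine ⟨i, hi, ?_⟩
  rw [failProb, ← hθ]
  -- `3 ^ i` is odd
  have : (2 * ((3 ^ i / 2 : ℕ) : ℝ) + 1) = 3 ^ i := by
    have : 2 * (3 ^ i / 2) + 1 = 3 ^ i := Nat.two_mul_div_two_add_one_of_odd (Odd.pow (by decide))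
    exact_mod_cast this
  rwa [this]

theorem failProb_nonneg (x : Fin k → Bits m) (J : ℕ) : 0 ≤ failProb f ℓ x J := sq_nonneg _

theorem failProb_le_one (x : Fin k → Bits m) (J : ℕ) : failProb f ℓ x J ≤ 1 :=
  Real.cos_sq_le_one _

/-- If every level is repeated five times, one good level suffices. -/
theorem prod_failProb_le {L : ℕ} (x : Fin k → Bits m)
    (h : ∃ i ≤ L, failProb f ℓ x (3 ^ i / 2) ≤ 3 / 4) :
    ∏ t : Fin (L + 1) × Fin 5, failProb f ℓ x (3 ^ (t.1 : ℕ) / 2) ≤ (3 / 4) ^ 5 := by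
  obtain ⟨i, hi, h⟩ := h
  rw [Fintype.prod_prod_type]
  simp only [Finset.prod_const, Finset.card_univ, Fintype.card_fin]
  rw [← Finset.mul_prod_erase _ _ (Finset.mem_univ (⟨i, by omega⟩ : Fin (L + 1)))]
  calc _ ≤ (3 / 4 : ℝ) ^ 5 * 1 := by
        refine mul_le_mul (pow_le_pow_left₀ (failProb_nonneg _ _ _ _) h 5)
          (Finset.prod_le_one (fun _ _ => pow_nonneg (failProb_nonneg _ _ _ _) _)
            fun _ _ => pow_le_one₀ (failProb_nonneg _ _ _ _) (failProb_le_one _ _ _ _))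
          (Finset.prod_nonneg fun _ _ => pow_nonneg (failProb_nonneg _ _ _ _) _) (by positivity)
    _ = _ := mul_one _

/-- The collision finder fails with probability less than `1 / 2`: at most a quarter of the
seeds is bad, and for the others all searches fail with probability at most `(3 / 4) ^ 5`. -/
theorem weight_run_finderOps_lt {L : ℕ} (hk : 0 < k) (hL : 2 ^ (ℓ + 4) ≤ 9 ^ L * k)
    (f : Bits (ℓ + 3) → Bits d) (e : Fin k → Bits (ℓ + 3)) (he : Function.Injective e) :
    weight (HOp.run f (finderOps e ℓ fun t : Fin (L + 1) × Fin 5 => 3 ^ (t.1 : ℕ) / 2)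
        (ket fun _ => false)) {z | ¬ NearCollision f ℓ (z ∘ outW false) (z ∘ outW true)} <
      1 / 2 := by
  classical
  refine (weight_run_finderOps_le f ℓ e _).trans_lt ?_
  set bad : Finset (Bits (ℓ + 3)) := Finset.univ.filter fun s =>
    k < 2 * (Finset.univ.filter fun i => (fun j => xor (s j) (e i j)) ∈ lonely f ℓ).card
  have hbad : bad.card ≤ 2 * 2 ^ ℓ := card_bad_le f ℓ hk e
  have hs : ∀ s : Bits (ℓ + 3),
      (if ∃ i i', NearCollision f ℓ (fun j => xor (s j) (e i j)) (fun j => xor (s j) (e i' j))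
            then 0 else 1) *
          ∏ t : Fin (L + 1) × Fin 5,
            failProb f ℓ (fun i j => xor (s j) (e i j)) (3 ^ (t.1 : ℕ) / 2) ≤
        (if s ∈ bad then 1 else 0) + (3 / 4 : ℝ) ^ 5 := by
    intro s
    set Q := ∏ t : Fin (L + 1) × Fin 5,
      failProb f ℓ (fun i j => xor (s j) (e i j)) (3 ^ (t.1 : ℕ) / 2)
    have hQ1 : Q ≤ 1 := Finset.prod_le_one (fun _ _ => failProb_nonneg _ _ _ _)
      fun _ _ => failProb_le_one _ _ _ _
    split_ifs with hc hb hb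
    · rw [zero_mul]
      positivity
    · rw [zero_mul]
      positivity
    · rw [one_mul]
      linarith [show (0 : ℝ) ≤ (3 / 4) ^ 5 by positivity]
    · rw [one_mul, zero_add]
      refine prod_failProb_le f ℓ _ (exists_failProb_le f ℓ hL _ (le_card_partners f ℓ _ ?_ hc ?_))
      · intro i i' h
        refine he (funext fun j => ?_)
        simpa using congrFun h j
      · simpa [bad] using hb
  calc _ ≤ ∑ s : Bits (ℓ + 3), (1 / 2 : ℝ) ^ (ℓ + 3) *
        ((if s ∈ bad then 1 else 0) + (3 / 4 : ℝ) ^ 5) :=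
      Finset.sum_le_sum fun s _ => mul_le_mul_of_nonneg_left (hs s) (by positivity)
    _ = (1 / 2 : ℝ) ^ (ℓ + 3) * (bad.card + 2 ^ (ℓ + 3) * (3 / 4) ^ 5) := by
      rw [← Finset.mul_sum, Finset.sum_add_distrib]
      simp [Bits]
    _ ≤ (1 / 2 : ℝ) ^ (ℓ + 3) * (2 * 2 ^ ℓ + 2 ^ (ℓ + 3) * (3 / 4) ^ 5) := by
      gcongr
      exact_mod_cast hbad
    _ = 1 / 4 + (3 / 4) ^ 5 := by
      have : (1 / 2 : ℝ) ^ ℓ * 2 ^ ℓ = 1 := by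
        rw [← mul_pow]
        norm_num
      rw [pow_add, pow_add]
      linear_combination (1 / 4 + (3 / 4) ^ 5) * this
    _ < 1 / 2 := by norm_num

end Success

/-! ### The cost of the collision finder -/

section Cost

set_option synthInstance.maxSize 1000

variable {B T : Type} {k m d : ℕ}

theorem length_hadLayer (X : Fin m → B) : (hadLayer d X : List (HOp B m d)).length = m := by
  simp [hadLayer]

theorem queries_hadLayer (X : Fin m → B) :
    ((hadLayer d X : List (HOp B m d)).map HOp.queries).sum = 0 := by
  refine List.sum_eq_zero fun q hq => ?_
  obtain ⟨o, ho, rfl⟩ := List.mem_map.1 hq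
  obtain ⟨w, -, rfl⟩ := List.mem_map.1 ho
  rfl

theorem anc_hadLayer (X : Fin m → B) : ∀ o ∈ (hadLayer d X : List (HOp B m d)), o.anc = 0 := by
  intro o ho
  obtain ⟨w, -, rfl⟩ := List.mem_map.1 ho
  rfl

theorem queries_groverSearch (X : Fin m → B) (Y : Fin d → B) (hY : Function.Injective Y)
    (h : ∀ i j, X i ≠ Y j) (φ : Form B) (J : ℕ) :
    ((groverSearch X Y hY h φ J).map HOp.queries).sum = 4 * J + 2 := by
  simp [groverSearch, groverIter, diffusion, queries_hadLayer, HOp.queries, List.map_flatten,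
    List.sum_flatten]
  ring

theorem length_groverSearch (X : Fin m → B) (Y : Fin d → B) (hY : Function.Injective Y)
    (h : ∀ i j, X i ≠ Y j) (φ : Form B) (J : ℕ) :
    (groverSearch X Y hY h φ J).length = m + J * (2 * m + 4) + 1 := by
  simp [groverSearch, groverIter, diffusion, length_hadLayer]
  ring

theorem anc_groverSearch_le (X : Fin m → B) (Y : Fin d → B) (hY : Function.Injective Y)
    (h : ∀ i j, X i ≠ Y j) (φ : Form B) (J : ℕ) :
    ∀ o ∈ groverSearch X Y hY h φ J, o.anc ≤ φ.size + (5 * m + 3) := by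
  intro o ho
  simp only [groverSearch, List.mem_append, List.mem_reverse, List.mem_flatten,
    List.mem_replicate, List.mem_singleton] at ho
  rcases ho with ho | ⟨l, ⟨_, rfl⟩, ho⟩ | rfl
  · exact (anc_hadLayer _ _ ho).trans_le (Nat.zero_le _)
  · simp only [groverIter, diffusion, List.mem_cons, List.mem_append, List.mem_reverse] at ho
    rcases ho with rfl | rfl | rfl | ho | rfl | ho
    · exact Nat.zero_le _
    · exact Nat.le_add_right _ _
    · exact Nat.zero_le _
    · exact (anc_hadLayer _ _ ho).trans_le (Nat.zero_le _)
    · exact (Form.size_anyOf_le X).trans (Nat.le_add_left _ _)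
    · exact (anc_hadLayer _ _ ho).trans_le (Nat.zero_le _)
  · exact Nat.zero_le _

variable [Fintype T] [DecidableEq T]

theorem queries_finderOps (e : Fin k → Bits m) (ℓ : ℕ) (J : T → ℕ) :
    ((finderOps e ℓ J : List (HOp (LWire k m d T) m d)).map HOp.queries).sum =
      2 * k + ∑ t, (4 * J t + 2) := by
  have h1 : ∀ (l : List T), ((searchOps ℓ J l : List (HOp (LWire k m d T) m d)).map
      HOp.queries).sum = (l.map fun t => 4 * J t + 2).sum := by
    intro l
    induction l with
    | nil => rfl
    | cons t l ih =>
      rw [searchOps, List.flatMap_cons, List.map_append, List.sum_append, queries_groverSearch,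
        List.map_cons, List.sum_cons, ← ih]
      rfl
  have h2 : ((outputOps ℓ : List (HOp (LWire k m d T) m d)).map HOp.queries).sum = 0 := by
    refine List.sum_eq_zero fun q hq => ?_
    obtain ⟨o, ho, rfl⟩ := List.mem_map.1 hq
    obtain ⟨w, -, rfl⟩ := List.mem_map.1 ho
    rfl
  have h3 : ((tableOps e : List (HOp (LWire k m d T) m d)).map HOp.queries).sum = 2 * k := by
    simp [tableOps, queries_hadLayer, Function.comp_def, HOp.queries]
    ring
  rw [finderOps, List.map_append, List.map_append, List.sum_append, List.sum_append, h1, h2, h3,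
    Finset.sum_map_toList, add_zero]

theorem length_finderOps (e : Fin k → Bits m) (ℓ : ℕ) (J : T → ℕ) :
    (finderOps e ℓ J : List (HOp (LWire k m d T) m d)).length =
      m + (k * m + k) + (∑ t, (m + J t * (2 * m + 4) + 1) + 2 * m) := by
  have h1 : ∀ (l : List T), (searchOps ℓ J l : List (HOp (LWire k m d T) m d)).length =
      (l.map fun t => m + J t * (2 * m + 4) + 1).sum := by
    intro l
    induction l with
    | nil => rfl
    | cons t l ih =>
      rw [searchOps, List.flatMap_cons, List.length_append, length_groverSearch,
        List.map_cons, List.sum_cons, ← ih]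
      rfl
  have h2 : (outputOps ℓ : List (HOp (LWire k m d T) m d)).length = 2 * m := by
    simp [outputOps]
  have h3 : (tableOps e : List (HOp (LWire k m d T) m d)).length = m + (k * m + k) := by
    simp [tableOps, length_hadLayer]
  rw [finderOps, List.length_append, List.length_append, h1, h2, h3, Finset.sum_map_toList]

theorem anc_finderOps_le (e : Fin k → Bits m) (ℓ : ℕ) (J : T → ℕ) :
    ∀ o ∈ (finderOps e ℓ J : List (HOp (LWire k m d T) m d)), o.anc ≤
      k * (18 * (m + d) + 12) + 3 + (5 * m + 3) +
        ((k + Fintype.card T) ^ 2 * (36 * (m + d) + 27) + 3) := by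
  intro o ho
  rw [finderOps, List.mem_append, List.mem_append] at ho
  rcases ho with ho | ho | ho
  · rw [tableOps, List.mem_append, List.mem_append] at ho
    rcases ho with ho | ho | ho
    · exact (anc_hadLayer _ _ (List.mem_reverse.1 ho)).trans_le (Nat.zero_le _)
    · obtain ⟨p, -, rfl⟩ := List.mem_map.1 ho
      exact (size_shifted_le e p).trans (by omega)
    · obtain ⟨i, -, rfl⟩ := List.mem_map.1 ho
      exact Nat.zero_le _
  · obtain ⟨t, -, ho⟩ := List.mem_flatMap.1 ho
    refine (anc_groverSearch_le _ _ _ _ _ _ o ho).trans ?_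
    have := size_marked_le (k := k) (m := m) (d := d) ℓ t
    omega
  · obtain ⟨p, -, rfl⟩ := List.mem_map.1 ho
    refine (size_select_le ℓ p.1 p.2 _).trans ?_
    rw [Finset.length_toList, Finset.card_univ, Fintype.card_prod, Fintype.card_sum,
      Fintype.card_fin, ← sq]
    omega

end Cost

/-! ### The choice of parameters -/

/-- The binary digits of `i`. -/
def binary (k m : ℕ) (i : Fin k) (j : Fin m) : Bool := (i : ℕ).testBit j

theorem binary_injective {k m : ℕ} (h : k ≤ 2 ^ m) : Function.Injective (binary k m) := by
  intro i i' hii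
  refine Fin.ext (Nat.eq_of_testBit_eq fun j => ?_)
  by_cases hj : j < m
  · exact congrFun hii ⟨j, hj⟩
  · have hm : 2 ^ m ≤ 2 ^ j := Nat.pow_le_pow_right (by norm_num) (by omega)
    rw [Nat.testBit_lt_two_pow (by omega), Nat.testBit_lt_two_pow (by omega)]

/-- The size `2 ^ (ℓ / 3)` of the table. -/
def tableSize (ℓ : ℕ) : ℕ := 2 ^ (ℓ / 3)

/-- The largest level `L` of the Grover searches, those of level `i` using `3 ^ i / 2` iterations:
`3 ^ L` is about `8 * tableSize ℓ`. -/
def maxLevel (ℓ : ℕ) : ℕ := Nat.clog 3 (8 * tableSize ℓ)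

theorem tableSize_pos (ℓ : ℕ) : 0 < tableSize ℓ := by
  unfold tableSize
  positivity

theorem tableSize_le (ℓ : ℕ) : tableSize ℓ ≤ 2 ^ ℓ :=
  Nat.pow_le_pow_right (by norm_num) (Nat.div_le_self _ _)

theorem tableSize_le_rpow (ℓ : ℕ) : (tableSize ℓ : ℝ) ≤ ((2 : ℝ) ^ ℓ) ^ ((1 : ℝ) / 3) := by
  have h1 : ((tableSize ℓ : ℝ) ^ 3) ≤ 2 ^ ℓ := by
    rw [tableSize]
    push_cast
    rw [← pow_mul]
    exact pow_le_pow_right₀ (by norm_num) (Nat.div_mul_le_self _ _)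
  calc (tableSize ℓ : ℝ) = ((tableSize ℓ : ℝ) ^ 3) ^ ((1 : ℝ) / 3) := by
        rw [← Real.rpow_natCast, ← Real.rpow_mul (by positivity)]
        norm_num
    _ ≤ _ := Real.rpow_le_rpow (by positivity) h1 (by norm_num)

theorem three_pow_maxLevel_le (ℓ : ℕ) : 3 ^ maxLevel ℓ ≤ 24 * tableSize ℓ := by
  have h0 := tableSize_pos ℓ
  have h1 : 3 ^ (maxLevel ℓ).pred < 8 * tableSize ℓ :=
    Nat.pow_pred_clog_lt_self (by norm_num) (by omega)
  have h2 : maxLevel ℓ ≠ 0 := (Nat.clog_pos (by norm_num) (by omega)).ne'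
  rw [← Nat.succ_pred_eq_of_ne_zero h2, pow_succ]
  omega

theorem two_pow_le_nine_pow_maxLevel_mul (ℓ : ℕ) :
    2 ^ (ℓ + 4) ≤ 9 ^ maxLevel ℓ * tableSize ℓ := by
  have h1 : 8 * tableSize ℓ ≤ 3 ^ maxLevel ℓ := Nat.le_pow_clog (by norm_num) _
  have h2 : 2 ^ ℓ ≤ 4 * tableSize ℓ ^ 3 := by
    rw [tableSize, ← pow_mul, show 4 = 2 ^ 2 by norm_num, ← pow_add]
    exact Nat.pow_le_pow_right (by norm_num) (by omega)
  calc 2 ^ (ℓ + 4) = 16 * 2 ^ ℓ := by ring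
    _ ≤ 16 * (4 * tableSize ℓ ^ 3) := by gcongr
    _ = (8 * tableSize ℓ) ^ 2 * tableSize ℓ := by ring
    _ ≤ (3 ^ maxLevel ℓ) ^ 2 * tableSize ℓ := by gcongr
    _ = 9 ^ maxLevel ℓ * tableSize ℓ := by
      rw [← pow_mul, mul_comm (maxLevel ℓ), pow_mul]
      norm_num

/-- The collision finder, with `n`-bit digests and messages of `ℓ + 3` bits: the table consists of
the shifts of the seed by `0, …, tableSize ℓ - 1`, and there are five searches of each level. -/
def collisionFinder (n ℓ : ℕ) : OracleCircuit n :=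
  ofOps (finderOps (binary (tableSize ℓ) (ℓ + 3)) ℓ
    fun t : Fin (maxLevel ℓ + 1) × Fin 5 => 3 ^ (t.1 : ℕ) / 2) (outW false) (outW true)

set_option synthInstance.maxSize 1000 in
theorem half_lt_collisionFinder (n ℓ : ℕ)
    (f : Bits (collisionFinder n ℓ).msgLen → Bits n) :
    1 / 2 < ((collisionFinder n ℓ).output f).toOuterMeasure {M | NearCollision f ℓ M.1 M.2} := by
  have h := weight_run_finderOps_lt ℓ (tableSize_pos ℓ) (two_pow_le_nine_pow_maxLevel_mul ℓ) f
    (binary (tableSize ℓ) (ℓ + 3)) (binary_injective ((tableSize_le ℓ).trans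
      (Nat.pow_le_pow_right (by norm_num) (by omega))))
  refine lt_of_lt_of_eq ?_ (toOuterMeasure_output_ofOps _ _ _ f _).symm
  have h2 : (1 / 2 : ℝ≥0∞) = ENNReal.ofReal (1 / 2) := by
    rw [ENNReal.ofReal_div_of_pos (by norm_num)]
    simp
  rw [h2, ENNReal.ofReal_lt_ofReal_iff']
  exact ⟨lt_sub_comm.1 (h.trans_eq (by norm_num)), sub_pos.2 (h.trans (by norm_num))⟩

theorem queries_collisionFinder_le (n ℓ : ℕ) :
    ((collisionFinder n ℓ).queries : ℝ) ≤ 400 * ((2 : ℝ) ^ ℓ) ^ ((1 : ℝ) / 3) := by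
  have h : (collisionFinder n ℓ).queries ≤ 400 * tableSize ℓ := by
    rw [collisionFinder, queries_ofOps, queries_finderOps, Fintype.sum_prod_type]
    have h1 : ∀ i, 4 * (3 ^ i / 2) + 2 = 2 * 3 ^ i := by
      intro i
      have := Nat.two_mul_div_two_add_one_of_odd (Odd.pow (n := i) (by decide : Odd 3))
      omega
    simp only [h1, Finset.sum_const, Finset.card_univ, Fintype.card_fin, smul_eq_mul]
    rw [← Finset.mul_sum, ← Finset.mul_sum, Fin.sum_univ_eq_sum_range fun i => 3 ^ i]
    have h2 := Nat.geomSum_eq (le_refl 3 |>.trans' (by norm_num : 2 ≤ 3)) (maxLevel ℓ + 1)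
    have h3 := three_pow_maxLevel_le ℓ
    rw [pow_succ] at h2
    omega
  calc ((collisionFinder n ℓ).queries : ℝ) ≤ 400 * tableSize ℓ := by exact_mod_cast h
    _ ≤ _ := by
      gcongr
      exact tableSize_le_rpow ℓ

theorem exists_size_collisionFinder_le :
    ∃ p : Polynomial ℕ, ∀ n ℓ, 2 ^ ℓ ≤ n → (collisionFinder n ℓ).size ≤ p.eval n := by
  -- with `N = n + 3`, there are at most `N` table entries of at most `N` bits, at most `120 * N`
  -- searches, and at most `24 * N` iterations in each of them
  let N : Polynomial ℕ := Polynomial.X + 3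
  refine ⟨((N + (N * N + N) + (120 * N * (N + 24 * N * (2 * N + 4) + 1) + 2 * N)) + 1) *
    (5 * (N * (18 * (N + N) + 12) + 3 + (5 * N + 3) +
        ((N + 120 * N) ^ 2 * (36 * (N + N) + 27) + 3)) + 3 * (N + N + 1)) +
      (N + ((N + 120 * N) * N + ((N + 120 * N) * N + 2 * N))), fun n ℓ hn => ?_⟩
  set k := tableSize ℓ with hkdef
  set L := maxLevel ℓ with hLdef
  have hℓ : ℓ < 2 ^ ℓ := Nat.lt_two_pow_self
  have hk : k ≤ n + 3 := (tableSize_le ℓ).trans (by omega)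
  have hm : ℓ + 3 ≤ n + 3 := by omega
  have hd : n ≤ n + 3 := by omega
  have h3 : 3 ^ L ≤ 24 * (n + 3) := (three_pow_maxLevel_le ℓ).trans (by omega)
  have hT : Fintype.card (Fin (L + 1) × Fin 5) ≤ 120 * (n + 3) := by
    have : L < 3 ^ L := Nat.lt_pow_self (by norm_num)
    simp only [Fintype.card_prod, Fintype.card_fin]
    omega
  have hsum : ∑ t : Fin (L + 1) × Fin 5,
      ((ℓ + 3) + 3 ^ (t.1 : ℕ) / 2 * (2 * (ℓ + 3) + 4) + 1) ≤
        120 * (n + 3) * ((n + 3) + 24 * (n + 3) * (2 * (n + 3) + 4) + 1) := by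
    refine (Finset.sum_le_card_nsmul _ _
      ((n + 3) + 24 * (n + 3) * (2 * (n + 3) + 4) + 1) fun t _ => ?_).trans ?_
    · have h4 : 3 ^ (t.1 : ℕ) / 2 ≤ 24 * (n + 3) :=
        (Nat.div_le_self _ _).trans ((Nat.pow_le_pow_right (by norm_num) (by omega)).trans h3)
      gcongr
    · rw [smul_eq_mul, Finset.card_univ]
      gcongr
  have hcard : Fintype.card (LWire k (ℓ + 3) n (Fin (L + 1) × Fin 5)) =
      (ℓ + 3) + ((k + Fintype.card (Fin (L + 1) × Fin 5)) * (ℓ + 3) +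
        ((k + Fintype.card (Fin (L + 1) × Fin 5)) * n + 2 * (ℓ + 3))) := by
    simp only [Fintype.card_sum, Fintype.card_prod, Fintype.card_fin, Fintype.card_bool]
  refine (size_ofOps_le _ _ _ _ (anc_finderOps_le _ ℓ _)).trans ?_
  rw [length_finderOps, hcard]
  simp only [N, Polynomial.eval_add, Polynomial.eval_mul, Polynomial.eval_pow, Polynomial.eval_X,
    Polynomial.eval_ofNat, Polynomial.eval_one]
  gcongr

theorem eval_polynomial_mono (p : Polynomial ℕ) {a b : ℕ} (h : a ≤ b) : p.eval a ≤ p.eval b := by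
  rw [Polynomial.eval_eq_sum_range, Polynomial.eval_eq_sum_range]
  gcongr

/-! ### The attack on the protocol -/

theorem nearCollision_ofFn {m n ℓ : ℕ} (g : Str → Bits n) (x y : Bits m)
    (h : NearCollision (fun x => g (List.ofFn x)) ℓ x y) :
    NearCollision g ℓ (List.ofFn x) (List.ofFn y) :=
  ⟨fun hxy => h.1 (List.ofFn_injective hxy), h.2⟩

/-- Finding near-collisions among messages of a fixed length with `400 * ∛(2 ^ ℓ)` evaluations, at
a rate of `400` evaluations per unit of time, suffices to win. -/
theorem le_impersonationProb_collisionFinder {κ : ℕ} (n ℓ r : ℕ) (kgen : PMF (Bits κ))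
    (eval : Bits κ → Str → Bits n)
    (out : Bits κ → PMF (Bits (collisionFinder n ℓ).msgLen × Bits (collisionFinder n ℓ).msgLen))
    (hout : ∀ k, out k = (collisionFinder n ℓ).output fun x => eval k (List.ofFn x))
    (IS : IdentScheme) :
    ENNReal.ofReal (1 - Real.exp (-(r : ℝ) / 16)) ≤ impersonationProb IS n ℓ r kgen eval
      (impersonator 400 (collisionFinder n ℓ).queries out) := by
  refine le_impersonationProb ℓ kgen eval 400 _ out ?_ (fun k => ?_) IS r
  · rw [div_le_iff₀ (by norm_num), mul_comm]
    refine (queries_collisionFinder_le n ℓ).trans ?_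
    gcongr
    exact Nat.le_ceil _
  · rw [hout]
    refine (half_lt_collisionFinder n ℓ _).trans_le (MeasureTheory.measure_mono fun M hM => ?_)
    exact nearCollision_ofFn _ _ _ hM

theorem le_oracleAttackProb {κ : ℕ} (n ℓ r : ℕ) (kgen : PMF (Bits κ)) (IS : IdentScheme) :
    ENNReal.ofReal (1 - Real.exp (-(r : ℝ) / 16)) ≤
      oracleAttackProb 400 IS n ℓ r kgen (collisionFinder n ℓ) := by
  unfold oracleAttackProb randomOracle
  calc _ = ∫⁻ _, ENNReal.ofReal (1 - Real.exp (-(r : ℝ) / 16)) ∂(MeasureTheory.Measure.infinitePi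
        fun _ : Bits κ × Str => (PMF.uniformOfFintype (Bits n)).toMeasure) := by simp
    _ ≤ _ := MeasureTheory.lintegral_mono fun H =>
      le_impersonationProb_collisionFinder n ℓ r kgen _ _ (fun _ => rfl) IS

theorem oracleAttackProb_le_one {κ : ℕ} (α : ℝ) (n ℓ r : ℕ) (kgen : PMF (Bits κ))
    (IS : IdentScheme) (A : OracleCircuit n) : oracleAttackProb α IS n ℓ r kgen A ≤ 1 := by
  unfold oracleAttackProb randomOracle
  calc _ ≤ ∫⁻ _, 1 ∂(MeasureTheory.Measure.infinitePi
        fun _ : Bits κ × Str => (PMF.uniformOfFintype (Bits n)).toMeasure) :=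
      MeasureTheory.lintegral_mono fun H => impersonationProb_le_one _ _ _ _ _ _
    _ = 1 := by simp

theorem exists_evalCircuit (H : HashFunction) (hH : H.IsEfficient) :
    ∃ p : Polynomial ℕ, (∀ n, H.keyLen n ≤ p.eval n) ∧
      ∀ n m, ∃ E : EvalCircuit (H.keyLen n) m n,
        (E.Implements fun k x => H.eval n k (List.ofFn x)) ∧
          E.gates.length ≤ 4 * p.eval (n + m) + n ∧ E.anc ≤ p.eval (n + m) + 1 := by
  obtain ⟨p, h1, h2⟩ := hH
  refine ⟨p, h1, fun n m => ?_⟩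
  obtain ⟨C, hC, hF⟩ := h2 n m
  refine ⟨C.toEvalCircuit, C.toEvalCircuit_implements _ hF, ?_, Nat.succ_le_succ hC⟩
  exact C.length_gates_toEvalCircuit.trans (by omega)

/-- The instantiated collision finder has polynomial size. -/
theorem polyBoundedOn_rounds_mul_instSize (P : Params) (κ : ℕ → ℕ) (p : Polynomial ℕ)
    (hκ : ∀ n, κ n ≤ p.eval n)
    (E : (n ℓ : ℕ) → EvalCircuit (κ n) (collisionFinder n ℓ).msgLen n)
    (hE : ∀ n ℓ, (E n ℓ).gates.length ≤ 4 * p.eval (n + (ℓ + 3)) + n ∧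
      (E n ℓ).anc ≤ p.eval (n + (ℓ + 3)) + 1) :
    PolyBoundedOn (fun n => 2 ^ P.ell n ≤ n)
      fun n => P.rounds n * (collisionFinder n (P.ell n)).instSize (E n (P.ell n)) := by
  obtain ⟨s, hs⟩ := exists_size_collisionFinder_le
  obtain ⟨ρ, hρ⟩ := P.rounds_poly
  let p' : Polynomial ℕ := p.comp (2 * Polynomial.X + 3)
  refine ⟨ρ * (s * (4 * p' + Polynomial.X + 1) + p + (p' + 1)), fun n hn => ?_⟩
  have hℓ : P.ell n < 2 ^ P.ell n := Nat.lt_two_pow_self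
  have hp : p.eval (n + (P.ell n + 3)) ≤ p'.eval n := by
    simp only [p', Polynomial.eval_comp, Polynomial.eval_add, Polynomial.eval_mul,
      Polynomial.eval_X, Polynomial.eval_ofNat]
    exact eval_polynomial_mono p (by omega)
  obtain ⟨h1, h2⟩ := hE n (P.ell n)
  have h3 : (E n (P.ell n)).gates.length ≤ 4 * p'.eval n + n := by omega
  have h4 : (E n (P.ell n)).anc ≤ p'.eval n + 1 := by omega
  simp only [Polynomial.eval_add, Polynomial.eval_mul, Polynomial.eval_X, Polynomial.eval_ofNat,
    Polynomial.eval_one]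
  refine Nat.mul_le_mul (hρ n trivial) ((OracleCircuit.instSize_le _ _).trans ?_)
  have h5 := hs n _ hn
  have h6 := hκ n
  gcongr

end QRO

end

theorem mainTheorem10 :
    ∃ α : ℝ, 1 ≤ α ∧ ∃ A : (n : ℕ) → ℕ → QRO.OracleCircuit n,
      -- the adversary is efficient
      (∃ p : Polynomial ℕ, ∀ n ℓ, 2 ^ ℓ ≤ n → (A n ℓ).size ≤ p.eval n) ∧
      -- it uses at most `α ∛(2^ℓ)` evaluations per round
      (∀ n ℓ, 2 ^ ℓ ≤ n →
        ((A n ℓ).queries : ℝ) ≤ α * ((2 : ℝ) ^ ℓ) ^ ((1 : ℝ) / 3)) ∧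
      -- for every oracle, a near-collision is found with probability greater than 1/2
      (∀ n ℓ, 2 ^ ℓ ≤ n → ∀ f : QRO.Bits (A n ℓ).msgLen → QRO.Bits n,
        1 / 2 < ((A n ℓ).output f).toOuterMeasure {M | QRO.NearCollision f ℓ M.1 M.2}) ∧
      -- the protocol is insecure for every hash function
      (∀ H : QRO.HashFunction, H.IsEfficient →
        ∃ E : (n ℓ : ℕ) → QRO.EvalCircuit (H.keyLen n) (A n ℓ).msgLen n,
          (∀ n ℓ, (E n ℓ).Implements fun k x => H.eval n k (List.ofFn x)) ∧
          ∀ P : QRO.Params,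
            QRO.PolyBoundedOn (fun n => 2 ^ P.ell n ≤ n)
              (fun n => P.rounds n * (A n (P.ell n)).instSize (E n (P.ell n))) ∧
            ∀ IS : QRO.IdentScheme,
              (∀ n, 2 ^ P.ell n ≤ n →
                ENNReal.ofReal (1 - Real.exp (-(P.rounds n : ℝ) / 16)) ≤
                  QRO.hashAttackProb α IS H n (P.ell n) (P.rounds n)
                    (A n (P.ell n)) (E n (P.ell n))) ∧
              ¬ QRO.Negligible fun n =>
                (QRO.hashAttackProb α IS H n (P.ell n) (P.rounds n)
                  (A n (P.ell n)) (E n (P.ell n))).toReal) ∧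
      -- the protocol is insecure in the quantum-accessible random oracle model
      (∀ (κ : ℕ → ℕ) (kgen : (n : ℕ) → PMF (QRO.Bits (κ n))) (P : QRO.Params)
          (IS : QRO.IdentScheme),
        (∀ n, 2 ^ P.ell n ≤ n →
          ENNReal.ofReal (1 - Real.exp (-(P.rounds n : ℝ) / 16)) ≤
            QRO.oracleAttackProb α IS n (P.ell n) (P.rounds n) (kgen n) (A n (P.ell n))) ∧
        ¬ QRO.Negligible fun n =>
          (QRO.oracleAttackProb α IS n (P.ell n) (P.rounds n) (kgen n)
            (A n (P.ell n))).toReal) ∧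
      -- with the same number of classical queries the collision stage is passed with exponentially
      -- small probability only, for all sufficiently large `ℓ`
      (∃ ℓ₀ : ℕ, ∀ (n ℓ r q : ℕ) (X : Type) [Fintype X] [DecidableEq X],
        ℓ₀ ≤ ℓ → 2 ^ ℓ ≤ n → (q : ℝ) ≤ α * QRO.deadline ℓ →
        ∀ B : List (X → QRO.Bits n) → QRO.QueryAlg X (QRO.Bits n) (X × X),
          (∀ past, (B past).QueriesAtMost q) →
          (PMF.uniformOfFintype (Fin r → X → QRO.Bits n)).toOuterMeasure
              {h | r < 4 * QRO.classicalCollCount ℓ B h} ≤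
            ENNReal.ofReal (Real.exp (-(r : ℝ) / 16))) := by

  refine ⟨400, by norm_num, QRO.collisionFinder, QRO.exists_size_collisionFinder_le,
    fun n ℓ _ => QRO.queries_collisionFinder_le n ℓ,
    fun n ℓ _ => QRO.half_lt_collisionFinder n ℓ, fun H hH => ?_, fun κ kgen P IS => ?_, ?_⟩
  · obtain ⟨p, hκ, h⟩ := QRO.exists_evalCircuit H hH
    choose E hE hgates hanc using fun n ℓ => h n (QRO.collisionFinder n ℓ).msgLen
    refine ⟨E, hE, fun P => ⟨QRO.polyBoundedOn_rounds_mul_instSize P H.keyLen p hκ E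
      fun n ℓ => ⟨hgates n ℓ, hanc n ℓ⟩, fun IS => ?_⟩⟩
    have hle : ∀ n, ENNReal.ofReal (1 - Real.exp (-(P.rounds n : ℝ) / 16)) ≤
        QRO.hashAttackProb 400 IS H n (P.ell n) (P.rounds n)
          (QRO.collisionFinder n (P.ell n)) (E n (P.ell n)) := fun n =>
      QRO.le_impersonationProb_collisionFinder n _ _ _ _ _
        (fun k => QRO.OracleCircuit.instOutput_eq _ _ _ (hE n _) k) IS
    exact ⟨fun n _ => hle n, QRO.not_negligible_of_le _ P
      (fun n => QRO.impersonationProb_le_one _ _ _ _ _ _) fun n _ => hle n⟩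
  · have hle : ∀ n, ENNReal.ofReal (1 - Real.exp (-(P.rounds n : ℝ) / 16)) ≤
        QRO.oracleAttackProb 400 IS n (P.ell n) (P.rounds n) (kgen n)
          (QRO.collisionFinder n (P.ell n)) := fun n => QRO.le_oracleAttackProb n _ _ _ IS
    exact ⟨fun n _ => hle n, QRO.not_negligible_of_le _ P
      (fun n => QRO.oracleAttackProb_le_one _ _ _ _ _ _ _) fun n _ => hle n⟩
  · obtain ⟨ℓ₀, h⟩ := QRO.exists_forall_sq_div_two_pow_le 400 (by norm_num)
    refine ⟨ℓ₀, fun n ℓ r q X _ _ hℓ hn hq B hB => ?_⟩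
    exact QRO.toOuterMeasure_classicalCollCount_le ℓ q (Nat.lt_two_pow_self.le.trans hn) B hB
      (h ℓ q hℓ hq) r
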